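/- Let $1\le k\le n$ be integers. Let $S_n$ act on $\mathbb{Q}[x_1,\dots,x_n]$ by permuting the variables, let $e_d=\sum_{1\le i_1<\cdots<i_d\le n}x_{i_1}\cdots x_{i_d}$ be the elementary symmetric polynomials, and let $$R_{n,k}=\mathbb{Q}[x_1,\dots,x_n]/I_{n,k},\qquad I_{n,k}=\langle x_1^k,\dots,x_n^k,\,e_n,e_{n-1},\dots,e_{n-k+1}\rangle ,$$ with the induced action of $S_n$. Standard Young tableaux are drawn in the French convention: the entries $1,\dots,n$ increase along rows from left to right and up columns. For a standard Young tableau $S$ with $n$ boxes, $\mathrm{des}(S)$ is the number of $i\in\{1,\dots,n-1\}$ that lie in a lower row of $S$ than $i+1$. The reading word of $S$ is obtained by reading its rows from top to bottom, each from left to right. The cocharge labels of $S$ are defined as follows: the entry $1$ has label $0$; if the entry $i$ has label $j$, then the entry $i+1$ has label $j$ if it stands to the right of $i$ in the reading word, and label $j+1$ otherwise. For standard Young tableaux $S,T$ of the same shape with $n$ boxes put $\mathbf{x}_T^{\mathrm{cw}(S)}=\prod_{i=1}^n x_i^{c_i}$, where $c_i$ is the cocharge label of the entry of $S$ in the box that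 contains $i$ in $T$. The higher Specht polynomial is $$F_T^S=\sum_{\tau\in C(T)}\sum_{\sigma\in R(T)}\mathrm{sgn}(\tau)\,\tau\sigma\cdot \mathbf{x}_T^{\mathrm{cw}(S)},$$ where $C(T)$ and $R(T)$ are the subgroups of $S_n$ of the permutations that preserve every column, respectively every row, of $T$. For a partition $\lambda$ of $n$, let $V_\lambda$ be the irreducible $S_n$-module over $\mathbb{Q}$ indexed by $\lambda$, that is, the span of the Specht polynomials $\prod(x_{T(d)}-x_{T(c)})$ of the tableaux $T$ of shape $\lambda$ (bijective fillings with $1,\dots,n$), the product being over the pairs of boxes $c,d$ in the same column with $c$ below $d$. A higher Specht basis of an $S_n$-module $R$ is a subset $\mathcal{B}\subseteq R$ for which there are a decomposition $R=\bigoplus_{\lambda\vdash n}\bigoplus_{i=1}^{c_\lambda}W_{\lambda,i}$ into submodules $W_{\lambda,i}\cong V_\lambda$ and a decomposition $\mathcal{B}=\bigcup_{\lambda}\bigcup_{i=1}^{c_\lambda}\mathcal{B}_{\lambda,i}$ such that $\mathcal{B}_{\lambda,i}$ is a basis of $W_{\lambda,i}$ for all $\lambda$ and $i$. Theorem. Consider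 the polynomials $$F_T^S\cdot e_1^{i_1}e_2^{i_2}\cdots e_{n-k}^{i_{n-k}},$$ where $S,T$ are standard Young tableaux with $n$ boxes of the same shape and $(i_1,\dots,i_{n-k})$ is a tuple of $n-k$ nonnegative integers with $i_1+\cdots+i_{n-k}<k-\mathrm{des}(S)$. Their images in $R_{n,k}$ form a basis of $R_{n,k}$ over $\mathbb{Q}$, with different index tuples $(S,T,i_1,\dots,i_{n-k})$ giving different elements, and the set of these images is a higher Specht basis of $R_{n,k}$. -/

import Mathlib

open MvPolynomial

noncomputable section

namespace HigherSpecht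

/-- The action of `S_n` on `ℚ[x_1, …, x_n]` by permuting the variables, `g · x_i = x_{g(i)}`. -/
def polyRep (n : ℕ) : Representation ℚ (Equiv.Perm (Fin n)) (MvPolynomial (Fin n) ℚ) where
  toFun g := (rename g : MvPolynomial (Fin n) ℚ →ₐ[ℚ] MvPolynomial (Fin n) ℚ).toLinearMap
  map_one' := by
    ext1 d
    ext1
    simp
  map_mul' g h := by
    refine LinearMap.ext fun p => ?_
    simp [rename_rename, Equiv.Perm.coe_mul]

theorem polyRep_apply {n : ℕ} (g : Equiv.Perm (Fin n)) (p : MvPolynomial (Fin n) ℚ) :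
    polyRep n g p = rename g p := rfl

/-! ### Tableaux

A cell of a Young diagram is a pair (row, column), both counted from `0`. In the French convention
row `0` is the bottom row and larger row indices are higher rows. The entries `1, …, n` of a
tableau and the variables `x_1, …, x_n` are indexed by `Fin n`, that is, shifted by one. -/

/-- A bijective filling of the diagram `μ` with the `n` entries `Fin n`. -/
abbrev Tableau (μ : YoungDiagram) (n : ℕ) : Type := ↥μ.cells ≃ Fin n

namespace Tableau

variable {μ : YoungDiagram} {n : ℕ}

/-- The row containing the entry `i`. -/
def rowOf (T : Tableau μ n) (i : Fin n) : ℕ := (T.symm i).1.1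

/-- The column containing the entry `i`. -/
def colOf (T : Tableau μ n) (i : Fin n) : ℕ := (T.symm i).1.2

/-- Entries increase along rows and up columns. -/
def IsStandard (T : Tableau μ n) : Prop :=
  (∀ c d : ↥μ.cells, c.1.1 = d.1.1 → c.1.2 < d.1.2 → T c < T d) ∧
  (∀ c d : ↥μ.cells, c.1.2 = d.1.2 → c.1.1 < d.1.1 → T c < T d)

/-- The column permutations `C(T)`: every entry goes to an entry in the same column of `T`. -/
def colPerms (T : Tableau μ n) : Finset (Equiv.Perm (Fin n)) :=
  Finset.univ.filter fun τ => ∀ i, T.colOf (τ i) = T.colOf i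

/-- The row permutations `R(T)`: every entry goes to an entry in the same row of `T`. -/
def rowPerms (T : Tableau μ n) : Finset (Equiv.Perm (Fin n)) :=
  Finset.univ.filter fun σ => ∀ i, T.rowOf (σ i) = T.rowOf i

/-- The Young idempotent `ε_T = ∑_{τ ∈ C(T)} ∑_{σ ∈ R(T)} sgn(τ) τσ` in `ℚ[S_n]`. -/
def youngIdempotent (T : Tableau μ n) : MonoidAlgebra ℚ (Equiv.Perm (Fin n)) :=
  ∑ τ ∈ T.colPerms, ∑ σ ∈ T.rowPerms,
    MonoidAlgebra.single (τ * σ) ((Equiv.Perm.sign τ : ℤ) : ℚ)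

/-- The ordinary Specht polynomial `F_T`: the product, over all pairs of cells `c`, `d` in the same
column with `c` lower than `d`, of `x_{T(d)} - x_{T(c)}`. -/
def spechtPoly (T : Tableau μ n) : MvPolynomial (Fin n) ℚ :=
  ∏ p ∈ (Finset.univ : Finset (↥μ.cells × ↥μ.cells)).filter
      (fun p => p.1.1.2 = p.2.1.2 ∧ p.1.1.1 < p.2.1.1),
    (X (T p.2) - X (T p.1))

end Tableau

/-- The irreducible `S_n`-module `V_μ`, realized as the span of the Specht polynomials of all
tableaux of shape `μ`. -/
def spechtModule (n : ℕ) (μ : YoungDiagram) : Subrepresentation (polyRep n) where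
  toSubmodule := Submodule.span ℚ (Set.range fun T : Tableau μ n => T.spechtPoly)
  apply_mem_toSubmodule := by
    intro g v hv
    induction hv using Submodule.span_induction with
    | mem x hx =>
      obtain ⟨T, rfl⟩ := hx
      refine Submodule.subset_span ⟨T.trans g, ?_⟩
      simp [Tableau.spechtPoly, polyRep_apply, map_prod]
    | zero => simp
    | add x y _ _ hx hy => rw [map_add]; exact add_mem hx hy
    | smul a x _ hx => rw [map_smul]; exact Submodule.smul_mem _ a hx

/-- Standard Young tableaux of shape `μ` with `n` boxes. -/
abbrev SYT (μ : YoungDiagram) (n : ℕ) : Type := {T : Tableau μ n // T.IsStandard}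

/-! ### Cocharge labels and descents -/

/-- The cocharge labels of a word in which every letter of `Fin n` occurs once, the letter `i`
at position `pos i`: the first letter has label `0`, and the letter `m + 1` has the label of `m` if
it stands to the right of `m`, and one more than the label of `m` otherwise. -/
def cochargeLabel {n : ℕ} {P : Type*} [LinearOrder P] (pos : Fin n → P) : ∀ m : ℕ, m < n → ℕ
  | 0, _ => 0
  | m + 1, h =>
    cochargeLabel pos m (Nat.lt_of_succ_lt h) +
      if pos ⟨m, Nat.lt_of_succ_lt h⟩ < pos ⟨m + 1, h⟩ then 0 else 1

/-- The position of the entry `i` in the reading word of `S`, the rows being read from top to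
bottom and each row from left to right: higher rows come first, and in a row smaller columns come
first. -/
def readingPos {μ : YoungDiagram} {n : ℕ} (S : Tableau μ n) (i : Fin n) : ℕᵒᵈ ×ₗ ℕ :=
  toLex (OrderDual.toDual (S.rowOf i), S.colOf i)

/-- The label of the entry `i` of `S` in the cocharge word `cw(S)`. -/
def cw {μ : YoungDiagram} {n : ℕ} (S : Tableau μ n) (i : Fin n) : ℕ :=
  cochargeLabel (readingPos S) i.1 i.2

/-- The number of descents of `S`: entries `i` in a lower row than `i + 1`. -/
def des {μ : YoungDiagram} {n : ℕ} (S : Tableau μ n) : ℕ :=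
  (Finset.univ.filter fun i : Fin n =>
    ∃ h : i.1 + 1 < n, S.rowOf i < S.rowOf ⟨i.1 + 1, h⟩).card

/-! ### Higher Specht polynomials -/

/-- The monomial `x_T^{cw(S)}`: the exponent of `x_i` is the cocharge label of `S` in the cell that
contains `i` in `T`. -/
def cwMonomial {μ : YoungDiagram} {n : ℕ} (S T : Tableau μ n) : MvPolynomial (Fin n) ℚ :=
  ∏ i : Fin n, X i ^ cw S (S (T.symm i))

/-- The higher Specht polynomial `F_T^S = ε_T · x_T^{cw(S)}`. -/
def higherSpecht {μ : YoungDiagram} {n : ℕ} (S T : Tableau μ n) : MvPolynomial (Fin n) ℚ :=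
  (polyRep n).asAlgebraHom T.youngIdempotent (cwMonomial S T)

/-! ### The rings `R_{n,k}` -/

/-- `I_{n,k} = ⟨x_1^k, …, x_n^k, e_n, e_{n-1}, …, e_{n-k+1}⟩` (for `k ≤ n`). -/
def idealI (n k : ℕ) : Ideal (MvPolynomial (Fin n) ℚ) :=
  Ideal.span ((Set.range fun i : Fin n => (X i ^ k : MvPolynomial (Fin n) ℚ)) ∪
    (fun d : ℕ => esymm (Fin n) ℚ d) '' Set.Icc (n - k + 1) n)

theorem idealI_le_comap (n k : ℕ) (g : Equiv.Perm (Fin n)) :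
    idealI n k ≤ (idealI n k).comap
      (rename g : MvPolynomial (Fin n) ℚ →ₐ[ℚ] MvPolynomial (Fin n) ℚ) := by
  refine Ideal.span_le.mpr ?_
  rintro p (⟨i, rfl⟩ | ⟨d, hd, rfl⟩)
  · have h : (X (g i) ^ k : MvPolynomial (Fin n) ℚ) ∈ idealI n k :=
      Ideal.subset_span (Or.inl ⟨g i, rfl⟩)
    simpa using h
  · have h : esymm (Fin n) ℚ d ∈ idealI n k := Ideal.subset_span (Or.inr ⟨d, hd, rfl⟩)
    simpa [rename_esymm] using h

/-- `R_{n,k} = ℚ[x_1, …, x_n] / I_{n,k}`. -/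
abbrev RingR (n k : ℕ) : Type := MvPolynomial (Fin n) ℚ ⧸ idealI n k

/-- The action of `S_n` on `R_{n,k}` induced by permuting the variables. -/
def ringRep (n k : ℕ) : Representation ℚ (Equiv.Perm (Fin n)) (RingR n k) where
  toFun g := (Ideal.quotientMapₐ (idealI n k)
    (rename g : MvPolynomial (Fin n) ℚ →ₐ[ℚ] MvPolynomial (Fin n) ℚ)
    (idealI_le_comap n k g)).toLinearMap
  map_one' := by
    refine LinearMap.ext fun p => ?_
    obtain ⟨p, rfl⟩ := Ideal.Quotient.mk_surjective p
    simp
  map_mul' g h := by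
    refine LinearMap.ext fun p => ?_
    obtain ⟨p, rfl⟩ := Ideal.Quotient.mk_surjective p
    simp [rename_rename, Equiv.Perm.coe_mul]

/-! ### Higher Specht bases -/

/-- `B` is a higher Specht basis of the `S_n`-module `V`: there are multiplicities `c_μ` for the
partitions `μ` of `n`, a decomposition of `V` as an internal direct sum of submodules
`W_{μ,i} ≅ V_μ` (`i < c_μ`), and a decomposition `B = ⋃_{μ,i} B_{μ,i}` such that `B_{μ,i}` is a
basis of `W_{μ,i}`. -/
def IsHigherSpechtBasis {n : ℕ} {V : Type*} [AddCommGroup V] [Module ℚ V]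
    (ρ : Representation ℚ (Equiv.Perm (Fin n)) V) (B : Set V) : Prop :=
  ∃ (c : {μ : YoungDiagram // μ.card = n} → ℕ)
    (W : (Σ μ : {μ : YoungDiagram // μ.card = n}, Fin (c μ)) → Subrepresentation ρ)
    (D : (Σ μ : {μ : YoungDiagram // μ.card = n}, Fin (c μ)) → Set V),
    iSupIndep (fun p => (W p).toSubmodule) ∧
    (⨆ p, (W p).toSubmodule) = ⊤ ∧
    (∀ p, Nonempty ((W p).toRepresentation.Equiv (spechtModule n p.1.1).toRepresentation)) ∧
    (∀ p, LinearIndepOn ℚ id (D p) ∧ Submodule.span ℚ (D p) = (W p).toSubmodule) ∧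
    B = ⋃ p, D p

/-! ### The family `B_{n,k}` -/

/-- The indices of `B_{n,k}`: two standard Young tableaux `S`, `T` with `n` boxes and the same
shape, and a tuple `(i_1, …, i_{n-k})` of nonnegative integers with sum less than `k - des(S)`. -/
structure BasisIndex (n k : ℕ) where
  shape : YoungDiagram
  S : SYT shape n
  T : SYT shape n
  exps : Fin (n - k) → ℕ
  sum_lt : ((∑ j, exps j : ℕ) : ℤ) < (k : ℤ) - (des S.1 : ℤ)

/-- The polynomial `F_T^S · e_1^{i_1} ⋯ e_{n-k}^{i_{n-k}}`. -/
def basisPoly {n k : ℕ} (a : BasisIndex n k) : MvPolynomial (Fin n) ℚ :=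
  higherSpecht a.S.1 a.T.1 * ∏ j : Fin (n - k), esymm (Fin n) ℚ (j.1 + 1) ^ a.exps j

/-- The set `B_{n,k}` of polynomials. -/
def setB (n k : ℕ) : Set (MvPolynomial (Fin n) ℚ) :=
  Set.range (basisPoly : BasisIndex n k → MvPolynomial (Fin n) ℚ)

end HigherSpecht

end

open MvPolynomial

noncomputable section

namespace HigherSpecht

/-! The images span `R_{n,k}`, and there are at most `dim R_{n,k}` of them; hence they form a basis.
Both halves rest on one basis of `ℚ[S_n]`.

Group algebra. For a pair `(S, T)` of equal shape let `leading` be `ε_T · g · Σ`, where `g` carries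
the filling `S` to `T` and `Σ` sums the stabilizer of the labels `cw(S)`. These elements are
independent: for a fixed shape they are triangular with respect to the rows of the entries compared
in colexicographic order, and different shapes are separated by von Neumann's lemma together with
the positivity of `x ↦ x* x`. Young's lattice gives at least `n!` pairs, so they form a basis. If
`m` is not a descent of `S`, then `leading` is right invariant under the transposition of `m` and `m
+ 1`. Transposing tableaux shows that half of the basis has this property, which is also the
dimension of the invariants. Consequently elements invariant under the stabilizer of a weight `f`
involve only those `S` whose descents are jumps of `f` (`mul_fiberSum_mem_span`).

Spanning. Up to monomials with a smaller sum of squared exponents, `F_T^S · e^a` is a nonzero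
multiple of `leading` applied to `x^(cw(S) + weight(a))`, where `e_d` raises the last `d` exponents.
Conversely, for a sorted weight `λ` whose jumps include the descents of `S`, the difference `λ -
cw(S)` is again weakly increasing, hence of the form `weight(a)`. So each monomial is a combination
of such products modulo smaller monomials (`mon_mem_span_sup`). In the quotient only exponents below
`k` and factors `e_1, …, e_{n-k}` survive; the largest exponent of the weight is `des(S) + ∑ a`, and
this gives the index condition.

Dimension. The generators of `I_{n,k}` are top homogeneous components of polynomials that vanish at
the points indexed by the surjections `[n] → [k]`. Monomials spanning the quotient therefore span
the functions on these points, so `dim R_{n,k}` is at least the number of surjections.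

Counting. The tuples belonging to `S` number at most `C(n - 1 - des(S), n - k)`, the number of
`(n-k)`-sets `E` of positions avoiding the descents of `S`. For fixed `E`, the pairs whose descents
avoid `E` give independent elements invariant under the stabilizer of a step function, so there are
at most as many as its rearrangements; over all `E` these rearrangements are distinct surjections.

Module structure. With `S` and the exponents fixed, the basis elements span an equivariant image of
the left ideal of `ε`. It is injective by independence, and the same left ideal maps isomorphically
onto the Specht module. -/

/-! ### Symmetrizers and antisymmetrizers in the group algebra -/

/-- The group algebra of the symmetric group. -/
abbrev GroupAlg (n : ℕ) : Type := MonoidAlgebra ℚ (Equiv.Perm (Fin n))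

/-- A group element as an element of the group algebra. -/
abbrev perm {n : ℕ} (g : Equiv.Perm (Fin n)) : GroupAlg n := MonoidAlgebra.single g 1

theorem perm_mul {n : ℕ} (g h : Equiv.Perm (Fin n)) : perm g * perm h = perm (g * h) := by
  simp [perm, MonoidAlgebra.single_mul_single]

theorem single_eq_smul_perm {n : ℕ} (g : Equiv.Perm (Fin n)) (r : ℚ) :
    (MonoidAlgebra.single g r : GroupAlg n) = r • perm g := by
  simp [perm, MonoidAlgebra.smul_single]

/-- The permutations preserving the fibres of `f`. -/
def fiberPerms {n : ℕ} {β : Type*} [DecidableEq β] (f : Fin n → β) :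
    Finset (Equiv.Perm (Fin n)) :=
  Finset.univ.filter fun σ => ∀ i, f (σ i) = f i

section Fiber

variable {n : ℕ} {β γ : Type*} [DecidableEq β] [DecidableEq γ] {f : Fin n → β} {h : Fin n → γ}
  {σ τ : Equiv.Perm (Fin n)}

theorem mem_fiberPerms : σ ∈ fiberPerms f ↔ ∀ i, f (σ i) = f i := by
  simp [fiberPerms]

theorem one_mem_fiberPerms : (1 : Equiv.Perm (Fin n)) ∈ fiberPerms f := by
  simp [mem_fiberPerms]

theorem mul_mem_fiberPerms (hσ : σ ∈ fiberPerms f) (hτ : τ ∈ fiberPerms f) :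
    σ * τ ∈ fiberPerms f := by
  rw [mem_fiberPerms] at *
  intro i
  rw [Equiv.Perm.mul_apply, hσ, hτ]

theorem inv_mem_fiberPerms (hσ : σ ∈ fiberPerms f) : σ⁻¹ ∈ fiberPerms f := by
  rw [mem_fiberPerms] at *
  intro i
  have := hσ (σ⁻¹ i)
  simpa using this.symm

theorem swap_mem_fiberPerms {i j : Fin n} (hij : f i = f j) :
    Equiv.swap i j ∈ fiberPerms f := by
  rw [mem_fiberPerms]
  intro a
  rcases eq_or_ne a i with rfl | hi
  · simp [hij]
  rcases eq_or_ne a j with rfl | hj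
  · simp [hij]
  rw [Equiv.swap_apply_of_ne_of_ne hi hj]

theorem conj_mem_fiberPerms_iff (g : Equiv.Perm (Fin n)) :
    g * σ * g⁻¹ ∈ fiberPerms (f ∘ ⇑g⁻¹) ↔ σ ∈ fiberPerms f := by
  simp only [mem_fiberPerms]
  constructor
  · intro H i
    simpa using H (g i)
  · intro H i
    simpa using H (g⁻¹ i)

variable (f h) in
/-- The sum of the permutations preserving the fibres of `f`. -/
def fiberSum : GroupAlg n := ∑ σ ∈ fiberPerms f, perm σ

variable (f h) in
/-- The signed sum of the permutations preserving the fibres of `f`. -/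
def fiberAlt : GroupAlg n :=
  ∑ σ ∈ fiberPerms f, MonoidAlgebra.single σ ((Equiv.Perm.sign σ : ℤ) : ℚ)

theorem sum_fiberPerms_mul_left {M : Type*} [AddCommMonoid M] (hσ : σ ∈ fiberPerms f)
    (F : Equiv.Perm (Fin n) → M) :
    ∑ τ ∈ fiberPerms f, F (σ * τ) = ∑ τ ∈ fiberPerms f, F τ := by
  refine Finset.sum_bij (fun τ _ => σ * τ) (fun τ hτ => mul_mem_fiberPerms hσ hτ)
    (fun a _ b _ hab => mul_left_cancel hab) (fun b hb => ?_) (fun _ _ => rfl)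
  exact ⟨σ⁻¹ * b, mul_mem_fiberPerms (inv_mem_fiberPerms hσ) hb, by simp⟩

theorem sum_fiberPerms_mul_right {M : Type*} [AddCommMonoid M] (hσ : σ ∈ fiberPerms f)
    (F : Equiv.Perm (Fin n) → M) :
    ∑ τ ∈ fiberPerms f, F (τ * σ) = ∑ τ ∈ fiberPerms f, F τ := by
  refine Finset.sum_bij (fun τ _ => τ * σ) (fun τ hτ => mul_mem_fiberPerms hτ hσ)
    (fun a _ b _ hab => mul_right_cancel hab) (fun b hb => ?_) (fun _ _ => rfl)
  exact ⟨b * σ⁻¹, mul_mem_fiberPerms hb (inv_mem_fiberPerms hσ), by simp⟩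

theorem fiberSum_mul_perm (hσ : σ ∈ fiberPerms f) : fiberSum f * perm σ = fiberSum f := by
  rw [fiberSum, Finset.sum_mul]
  simp only [perm_mul]
  exact sum_fiberPerms_mul_right hσ fun τ => perm τ

theorem sign_mul_self_rat (σ : Equiv.Perm (Fin n)) :
    ((Equiv.Perm.sign σ : ℤ) : ℚ) * ((Equiv.Perm.sign σ : ℤ) : ℚ) = 1 := by
  rcases Int.units_eq_one_or (Equiv.Perm.sign σ) with h | h <;> simp [h]

theorem perm_mul_fiberAlt (hσ : σ ∈ fiberPerms f) :
    perm σ * fiberAlt f = ((Equiv.Perm.sign σ : ℤ) : ℚ) • fiberAlt f := by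
  rw [fiberAlt, Finset.mul_sum, Finset.smul_sum]
  conv_rhs => rw [← sum_fiberPerms_mul_left hσ]
  refine Finset.sum_congr rfl fun τ _ => ?_
  simp only [perm, MonoidAlgebra.single_mul_single, MonoidAlgebra.smul_single, smul_eq_mul,
    Equiv.Perm.sign_mul, Units.val_mul, Int.cast_mul, ← mul_assoc, sign_mul_self_rat]

theorem fiberAlt_mul_self :
    fiberAlt f * fiberAlt f = ((fiberPerms f).card : ℚ) • fiberAlt f := by
  conv_lhs => enter [1]; rw [fiberAlt]
  rw [Finset.sum_mul]
  have : ∀ σ ∈ fiberPerms f, (MonoidAlgebra.single σ ((Equiv.Perm.sign σ : ℤ) : ℚ) : GroupAlg n) *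
      fiberAlt f = fiberAlt f := by
    intro σ hσ
    rw [single_eq_smul_perm, smul_mul_assoc, perm_mul_fiberAlt hσ, smul_smul, sign_mul_self_rat,
      one_smul]
  rw [Finset.sum_congr rfl this, Finset.sum_const, Nat.cast_smul_eq_nsmul]

theorem card_fiberPerms_ne_zero : ((fiberPerms f).card : ℚ) ≠ 0 := by
  rw [Nat.cast_ne_zero, Finset.card_ne_zero]
  exact ⟨1, one_mem_fiberPerms⟩

theorem sum_fiberPerms_conj {M : Type*} [AddCommMonoid M] (g : Equiv.Perm (Fin n))
    (F : Equiv.Perm (Fin n) → M) :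
    ∑ τ ∈ fiberPerms (f ∘ ⇑g⁻¹), F τ = ∑ τ ∈ fiberPerms f, F (g * τ * g⁻¹) := by
  symm
  refine Finset.sum_bij (fun τ _ => g * τ * g⁻¹)
    (fun τ hτ => (conj_mem_fiberPerms_iff g).2 hτ)
    (fun a _ b _ hab => by simpa using hab) (fun b hb => ?_) (fun _ _ => rfl)
  refine ⟨g⁻¹ * b * g, (conj_mem_fiberPerms_iff g).1 ?_, by group⟩
  convert hb using 1
  group

theorem fiberSum_comp_mul (g : Equiv.Perm (Fin n)) :
    fiberSum (f ∘ ⇑g⁻¹) * perm g = perm g * fiberSum f := by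
  rw [fiberSum, sum_fiberPerms_conj, fiberSum, Finset.sum_mul, Finset.mul_sum]
  refine Finset.sum_congr rfl fun τ _ => ?_
  simp

theorem fiberAlt_comp_mul (g : Equiv.Perm (Fin n)) :
    fiberAlt (f ∘ ⇑g⁻¹) * perm g = perm g * fiberAlt f := by
  rw [fiberAlt, sum_fiberPerms_conj, fiberAlt, Finset.sum_mul, Finset.mul_sum]
  refine Finset.sum_congr rfl fun τ _ => ?_
  rw [MonoidAlgebra.single_mul_single, MonoidAlgebra.single_mul_single]
  simp [mul_comm, ← mul_assoc]

/-- A symmetrizer and an antisymmetrizer annihilate each other if they share a transposition. -/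
theorem fiberSum_mul_fiberAlt_eq_zero {i j : Fin n} (hij : i ≠ j) (hf : f i = f j)
    (hh : h i = h j) : fiberSum f * fiberAlt h = 0 := by
  -- The shared transposition is absorbed by the symmetrizer with sign `+1` and by the
  -- antisymmetrizer with sign `-1`.
  have h1 : fiberSum f * fiberAlt h = -(fiberSum f * fiberAlt h) := by
    conv_lhs => rw [← fiberSum_mul_perm (swap_mem_fiberPerms hf), mul_assoc,
      perm_mul_fiberAlt (swap_mem_fiberPerms hh), Equiv.Perm.sign_swap hij]
    simp
  have h2 : (2 : ℚ) • (fiberSum f * fiberAlt h) = 0 := by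
    rw [two_smul]
    nth_rewrite 1 [h1]
    simp
  simpa using h2

end Fiber

/-! ### The canonical involution -/

/-- The anti-automorphism `g ↦ g⁻¹` of the group algebra. -/
def invol {n : ℕ} : GroupAlg n →ₗ[ℚ] GroupAlg n :=
  (MonoidAlgebra.basis (Equiv.Perm (Fin n)) ℚ).constr ℚ fun g => perm g⁻¹

section Invol

variable {n : ℕ}

theorem invol_perm (g : Equiv.Perm (Fin n)) : invol (perm g) = perm g⁻¹ := by
  have := (MonoidAlgebra.basis (Equiv.Perm (Fin n)) ℚ).constr_basis ℚ (fun g => perm g⁻¹) g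
  simpa [invol] using this

theorem invol_single (g : Equiv.Perm (Fin n)) (r : ℚ) :
    invol (MonoidAlgebra.single g r) = MonoidAlgebra.single g⁻¹ r := by
  rw [single_eq_smul_perm, map_smul, invol_perm, ← single_eq_smul_perm]

theorem invol_mul (x y : GroupAlg n) : invol (x * y) = invol y * invol x := by
  induction x using MonoidAlgebra.induction_linear with
  | zero => simp
  | add x x' hx hx' => rw [add_mul, map_add, map_add, mul_add, hx, hx']
  | single g r =>
    induction y using MonoidAlgebra.induction_linear with
    | zero => simp
    | add y y' hy hy' => rw [mul_add, map_add, map_add, add_mul, hy, hy']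
    | single g' r' =>
      simp [MonoidAlgebra.single_mul_single, invol_single, mul_comm]

theorem coeff_invol (x : GroupAlg n) (g : Equiv.Perm (Fin n)) :
    (invol x).coeff g = x.coeff g⁻¹ := by
  induction x using MonoidAlgebra.induction_linear with
  | zero => simp
  | add x x' hx hx' => simp [hx, hx']
  | single g' r =>
    simp only [invol_single, MonoidAlgebra.coeff_single, Finsupp.single_apply, inv_eq_iff_eq_inv]

/-- The coefficient of `invol x * x` at the identity is the sum of the squares of the coefficients
of `x`. This positivity replaces semisimplicity throughout. -/
theorem eq_zero_of_invol_mul_self {x : GroupAlg n} (hx : invol x * x = 0) : x = 0 := by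
  have h := congrArg (fun y : GroupAlg n => y.coeff 1) hx
  simp only [MonoidAlgebra.coeff_mul_apply_right, MonoidAlgebra.coeff_zero, Finsupp.coe_zero,
    Pi.zero_apply, one_mul, coeff_invol, inv_inv] at h
  rw [Finsupp.sum, Finset.sum_eq_zero_iff_of_nonneg fun g _ => mul_self_nonneg _] at h
  ext g
  by_contra hg
  have := h g (Finsupp.mem_support_iff.2 hg)
  exact hg (mul_self_eq_zero.1 this)

theorem invol_fiberSum {β : Type*} [DecidableEq β] (f : Fin n → β) :
    invol (fiberSum f) = fiberSum f := by
  rw [fiberSum, map_sum]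
  refine Finset.sum_bij (fun τ _ => τ⁻¹) (fun τ hτ => inv_mem_fiberPerms hτ)
    (fun a _ b _ hab => inv_injective hab)
    (fun b hb => ⟨b⁻¹, inv_mem_fiberPerms hb, by simp⟩) (fun τ _ => invol_perm τ)

theorem invol_fiberAlt {β : Type*} [DecidableEq β] (f : Fin n → β) :
    invol (fiberAlt f) = fiberAlt f := by
  rw [fiberAlt, map_sum]
  refine Finset.sum_bij (fun τ _ => τ⁻¹) (fun τ hτ => inv_mem_fiberPerms hτ)
    (fun a _ b _ hab => inv_injective hab)
    (fun b hb => ⟨b⁻¹, inv_mem_fiberPerms hb, by simp⟩) (fun τ _ => ?_)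
  rw [invol_single, Equiv.Perm.sign_inv]

end Invol

/-! ### Row and column symmetrizers of a tableau -/

namespace Tableau

variable {μ ν : YoungDiagram} {n : ℕ}

theorem rowPerms_eq (T : Tableau μ n) : T.rowPerms = fiberPerms T.rowOf := rfl

theorem colPerms_eq (T : Tableau μ n) : T.colPerms = fiberPerms T.colOf := rfl

theorem youngIdempotent_eq (T : Tableau μ n) :
    T.youngIdempotent = fiberAlt T.colOf * fiberSum T.rowOf := by
  rw [youngIdempotent, fiberAlt, fiberSum, Finset.sum_mul_sum]
  simp [perm, MonoidAlgebra.single_mul_single, rowPerms_eq, colPerms_eq]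

theorem rowOf_trans (T : Tableau μ n) (g : Equiv.Perm (Fin n)) :
    rowOf (T.trans g) = T.rowOf ∘ ⇑g⁻¹ := rfl

theorem colOf_trans (T : Tableau μ n) (g : Equiv.Perm (Fin n)) :
    colOf (T.trans g) = T.colOf ∘ ⇑g⁻¹ := rfl

theorem youngIdempotent_trans_mul (T : Tableau μ n) (g : Equiv.Perm (Fin n)) :
    youngIdempotent (T.trans g) * perm g = perm g * T.youngIdempotent := by
  rw [youngIdempotent_eq, youngIdempotent_eq, rowOf_trans, colOf_trans, mul_assoc,
    fiberSum_comp_mul, ← mul_assoc, fiberAlt_comp_mul, mul_assoc]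

theorem rowOf_apply (T : Tableau μ n) (c : ↥μ.cells) : T.rowOf (T c) = c.1.1 := by
  simp [rowOf]

theorem colOf_apply (T : Tableau μ n) (c : ↥μ.cells) : T.colOf (T c) = c.1.2 := by
  simp [colOf]

theorem mem_cells_of (T : Tableau μ n) (i : Fin n) : (T.rowOf i, T.colOf i) ∈ μ.cells :=
  (T.symm i).2

theorem eq_of_rowOf_colOf (T : Tableau μ n) {i j : Fin n} (hr : T.rowOf i = T.rowOf j)
    (hc : T.colOf i = T.colOf j) : i = j := by
  apply T.symm.injective
  exact Subtype.ext (Prod.ext hr hc)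

theorem card_colOf_eq (T : Tableau μ n) (c : ℕ) :
    (Finset.univ.filter fun i => T.colOf i = c).card = μ.colLen c := by
  rw [YoungDiagram.colLen_eq_card]
  refine Finset.card_bij (fun i _ => (T.symm i).1) ?_ ?_ ?_
  · intro i hi
    simp only [Finset.mem_filter, Finset.mem_univ, true_and] at hi
    rw [YoungDiagram.mem_col_iff]
    exact ⟨(T.symm i).2, hi⟩
  · intro i _ j _ hij
    exact T.symm.injective (Subtype.ext hij)
  · intro b hb
    rw [YoungDiagram.mem_col_iff] at hb
    refine ⟨T ⟨b, hb.1⟩, ?_, by simp⟩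
    rw [Finset.mem_filter]
    exact ⟨Finset.mem_univ _, (T.colOf_apply _).trans hb.2⟩

theorem card_rowOf_eq (T : Tableau μ n) (r : ℕ) :
    (Finset.univ.filter fun i => T.rowOf i = r).card = μ.rowLen r := by
  rw [YoungDiagram.rowLen_eq_card]
  refine Finset.card_bij (fun i _ => (T.symm i).1) ?_ ?_ ?_
  · intro i hi
    simp only [Finset.mem_filter, Finset.mem_univ, true_and] at hi
    rw [YoungDiagram.mem_row_iff]
    exact ⟨(T.symm i).2, hi⟩
  · intro i _ j _ hij
    exact T.symm.injective (Subtype.ext hij)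
  · intro b hb
    rw [YoungDiagram.mem_row_iff] at hb
    refine ⟨T ⟨b, hb.1⟩, ?_, by simp⟩
    rw [Finset.mem_filter]
    exact ⟨Finset.mem_univ _, (T.rowOf_apply _).trans hb.2⟩

/-- If `r` separates the entries of every column, then the columns can be rearranged so that
every entry `i` is in a row below or equal to `r i`. -/
theorem exists_colPerm_rowOf_le (T : Tableau μ n) (r : Fin n → ℕ)
    (hr : ∀ i j, T.colOf i = T.colOf j → r i = r j → i = j) :
    ∃ τ ∈ fiberPerms T.colOf, ∀ i, T.rowOf (τ i) ≤ r i := by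
  classical
  -- Within its column the entry `i` is sent to the row numbered by the entries with a smaller value
  -- of `r`. The values in a column are distinct, so this number is at most `r i`.
  let B : Fin n → Finset (Fin n) := fun i =>
    Finset.univ.filter fun j => T.colOf j = T.colOf i ∧ r j < r i
  have hmem : ∀ i, ((B i).card, T.colOf i) ∈ μ.cells := by
    intro i
    rw [YoungDiagram.mem_cells, YoungDiagram.mem_iff_lt_colLen, ← T.card_colOf_eq]
    apply Finset.card_lt_card
    rw [Finset.ssubset_iff_of_subset]
    · exact ⟨i, by simp, by simp [B]⟩
    · intro j hj
      simp only [B, Finset.mem_filter, Finset.mem_univ, true_and] at hj ⊢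
      exact hj.1
  have hle : ∀ i, (B i).card ≤ r i := by
    intro i
    conv_rhs => rw [← Finset.card_range (r i)]
    refine Finset.card_le_card_of_injOn r ?_ ?_
    · intro j hj
      simp only [B, Finset.coe_filter, Finset.mem_univ, true_and, Set.mem_ofPred_eq] at hj
      simpa using hj.2
    · intro j hj j' hj' hjj
      simp only [B, Finset.coe_filter, Finset.mem_univ, true_and, Set.mem_ofPred_eq] at hj hj'
      exact hr _ _ (hj.1.trans hj'.1.symm) hjj
  have hlt : ∀ i j, T.colOf i = T.colOf j → r i < r j → (B i).card < (B j).card := by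
    intro i j hc hij
    apply Finset.card_lt_card
    rw [Finset.ssubset_iff_of_subset]
    · exact ⟨i, by simp [B, hc, hij], by simp [B]⟩
    · intro a ha
      simp only [B, Finset.mem_filter, Finset.mem_univ, true_and] at ha ⊢
      exact ⟨ha.1.trans hc, ha.2.trans hij⟩
  let t : Fin n → Fin n := fun i => T ⟨_, hmem i⟩
  have ht : Function.Injective t := by
    intro i j hij
    have h1 := congrArg Subtype.val (T.injective hij)
    simp only [Prod.mk.injEq] at h1
    apply hr i j h1.2
    by_contra hne
    rcases lt_or_gt_of_ne hne with h2 | h2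
    · exact absurd h1.1 (hlt i j h1.2 h2).ne
    · exact absurd h1.1 (hlt j i h1.2.symm h2).ne'
  refine ⟨Equiv.ofBijective t ht.bijective_of_finite, ?_, ?_⟩
  · rw [mem_fiberPerms]
    intro i
    exact T.colOf_apply _
  · intro i
    have : T.rowOf (t i) = (B i).card := T.rowOf_apply _
    simpa [this] using hle i

/-- The sum of the row indices of the cells of a diagram. -/
def rowWeight (μ : YoungDiagram) : ℕ := ∑ c ∈ μ.cells, c.1

theorem sum_rowOf (T : Tableau μ n) : ∑ i, T.rowOf i = rowWeight μ := by
  rw [rowWeight, ← Finset.sum_coe_sort μ.cells, ← Equiv.sum_comp T]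
  simp [rowOf_apply]

/-- Nonvanishing forbids two entries in a common row of `T'` and a common column of `T`, so the
columns of `T` can be rearranged with every entry at most as high as in `T'`. The total weights then
force equality; `rowWeight` serves as a linear substitute for the dominance order. -/
theorem exists_colPerm_of_mul_ne_zero (T : Tableau μ n) (T' : Tableau ν n)
    (h : fiberSum T'.rowOf * fiberAlt T.colOf ≠ 0) (hw : rowWeight ν ≤ rowWeight μ) :
    ∃ τ ∈ fiberPerms T.colOf, ∀ i, T.rowOf (τ i) = T'.rowOf i := by
  obtain ⟨τ, hτ, hle⟩ := T.exists_colPerm_rowOf_le T'.rowOf fun i j hc hr => by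
    by_contra hij
    exact h (fiberSum_mul_fiberAlt_eq_zero hij hr hc)
  refine ⟨τ, hτ, fun i => ?_⟩
  have hsum : ∑ i, T.rowOf (τ i) = ∑ i, T'.rowOf i := by
    refine le_antisymm (Finset.sum_le_sum fun i _ => hle i) ?_
    rw [Equiv.sum_comp τ T.rowOf, sum_rowOf, sum_rowOf]
    exact hw
  exact (Finset.sum_eq_sum_iff_of_le fun i _ => hle i).1 hsum i (Finset.mem_univ i)

theorem shape_eq_of_rowOf_comp (T : Tableau μ n) (T' : Tableau ν n) (τ : Equiv.Perm (Fin n))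
    (h : ∀ i, T.rowOf (τ i) = T'.rowOf i) : μ = ν := by
  have hrow : ∀ r, μ.rowLen r = ν.rowLen r := by
    intro r
    rw [← T.card_rowOf_eq, ← T'.card_rowOf_eq]
    refine (Finset.card_bij (fun i _ => τ i) ?_ (fun _ _ _ _ => fun h => τ.injective h) ?_).symm
    · intro i hi
      simpa [h i] using hi
    · intro b hb
      refine ⟨τ⁻¹ b, ?_, by simp⟩
      simpa [← h] using hb
  apply SetLike.ext
  rintro ⟨a, b⟩
  rw [YoungDiagram.mem_iff_lt_rowLen, YoungDiagram.mem_iff_lt_rowLen, hrow]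

theorem fiberSum_mul_mul_fiberAlt_eq_zero (T : Tableau μ n) (T' : Tableau ν n) (hne : μ ≠ ν)
    (hw : rowWeight ν ≤ rowWeight μ) (x : GroupAlg n) :
    fiberSum T'.rowOf * x * fiberAlt T.colOf = 0 := by
  induction x using MonoidAlgebra.induction_linear with
  | zero => simp
  | add x y hx hy => rw [mul_add, add_mul, hx, hy, add_zero]
  | single g r =>
    rw [single_eq_smul_perm, mul_smul_comm, smul_mul_assoc, mul_assoc, ← fiberAlt_comp_mul,
      ← colOf_trans, ← mul_assoc]
    by_contra hne0
    have h0 : fiberSum T'.rowOf * fiberAlt (colOf (T.trans g)) ≠ 0 := by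
      intro h0
      rw [h0] at hne0
      simp at hne0
    obtain ⟨τ, -, hτ⟩ := exists_colPerm_of_mul_ne_zero _ _ h0 hw
    exact hne (shape_eq_of_rowOf_comp _ _ _ hτ)

/-- Von Neumann's lemma: a permutation with nonzero contribution factors as a row permutation times
a column permutation of `T`, and the two outer factors absorb these up to a sign. -/
theorem exists_fiberSum_mul_mul_fiberAlt_eq (T : Tableau μ n) (x : GroupAlg n) :
    ∃ c : ℚ, fiberSum T.rowOf * x * fiberAlt T.colOf =
      c • (fiberSum T.rowOf * fiberAlt T.colOf) := by
  induction x using MonoidAlgebra.induction_linear with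
  | zero => exact ⟨0, by simp⟩
  | add x y hx hy =>
    obtain ⟨c, hc⟩ := hx
    obtain ⟨d, hd⟩ := hy
    exact ⟨c + d, by rw [mul_add, add_mul, hc, hd, add_smul]⟩
  | single g r =>
    suffices ∃ c : ℚ, fiberSum T.rowOf * perm g * fiberAlt T.colOf =
        c • (fiberSum T.rowOf * fiberAlt T.colOf) by
      obtain ⟨c, hc⟩ := this
      exact ⟨r * c, by rw [single_eq_smul_perm, mul_smul_comm, smul_mul_assoc, hc, smul_smul]⟩
    by_cases h0 : fiberSum T.rowOf * fiberAlt (colOf (T.trans g)) = 0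
    · refine ⟨0, ?_⟩
      rw [mul_assoc, ← fiberAlt_comp_mul, ← colOf_trans, ← mul_assoc, h0]
      simp
    · obtain ⟨τ, hτ, hrow⟩ := exists_colPerm_of_mul_ne_zero _ _ h0 le_rfl
      have hs : g⁻¹ * τ ∈ fiberPerms T.rowOf := by
        rw [mem_fiberPerms]
        exact hrow
      have hc : g⁻¹ * τ * g ∈ fiberPerms T.colOf := by
        rw [← conj_mem_fiberPerms_iff g]
        have hconj : g * (g⁻¹ * τ * g) * g⁻¹ = τ := by group
        rw [hconj]
        exact hτ
      have hg : g = (g⁻¹ * τ)⁻¹ * (g⁻¹ * τ * g) := by group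
      refine ⟨((Equiv.Perm.sign (g⁻¹ * τ * g) : ℤ) : ℚ), ?_⟩
      conv_lhs => rw [hg]
      rw [← perm_mul, ← mul_assoc, fiberSum_mul_perm (inv_mem_fiberPerms hs), mul_assoc,
        perm_mul_fiberAlt hc, mul_smul_comm]

end Tableau

/-! ### Standard tableaux: triangularity -/

/-- In a vanishing combination, the functional belonging to the index of least key in the support
sees only its own term. -/
theorem linearIndependent_of_triangular {ι κ K V : Type*} [Field K] [AddCommGroup V] [Module K V]
    [LinearOrder κ] (v : ι → V) (φ : ι → V →ₗ[K] K) (key : ι → κ) (hkey : Function.Injective key)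
    (hle : ∀ i j, φ j (v i) ≠ 0 → key i ≤ key j) (hdiag : ∀ i, φ i (v i) ≠ 0) :
    LinearIndependent K v := by
  classical
  rw [linearIndependent_iff]
  intro l hl
  by_contra hne
  obtain ⟨j, hj, hmin⟩ := l.support.exists_min_image key (Finsupp.support_nonempty_iff.2 hne)
  have h1 : φ j (Finsupp.linearCombination K v l) = l j * φ j (v j) := by
    rw [Finsupp.linearCombination_apply, Finsupp.sum, map_sum, Finset.sum_eq_single j]
    · simp
    · intro i hi hij
      rw [map_smul, smul_eq_mul]
      by_contra h0
      have := hle i j (right_ne_zero_of_mul h0)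
      exact hij (hkey (le_antisymm this (hmin i hi)))
    · intro h
      exact absurd hj h
  rw [hl, map_zero] at h1
  exact (mul_ne_zero (Finsupp.mem_support_iff.1 hj) (hdiag j)) h1.symm

theorem inv_apply_self {n : ℕ} (g : Equiv.Perm (Fin n)) (i : Fin n) : g⁻¹ (g i) = i :=
  g.symm_apply_apply i

theorem exists_of_toColex_lt {n : ℕ} {a b : Fin n → ℕ} (h : toColex a < toColex b) :
    ∃ i : Fin n, (∀ j : Fin n, i < j → a j = b j) ∧ a i < b i := h

namespace Tableau

variable {μ : YoungDiagram} {n : ℕ}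

theorem IsStandard.lt_of_colOf_eq {S : Tableau μ n} (hS : S.IsStandard) {i j : Fin n}
    (hc : S.colOf i = S.colOf j) (hr : S.rowOf i < S.rowOf j) : i < j := by
  simpa using hS.2 (S.symm i) (S.symm j) hc hr

theorem IsStandard.lt_of_rowOf_eq {S : Tableau μ n} (hS : S.IsStandard) {i j : Fin n}
    (hr : S.rowOf i = S.rowOf j) (hc : S.colOf i < S.colOf j) : i < j := by
  simpa using hS.1 (S.symm i) (S.symm j) hr hc

/-- The row indices of the entries, compared at the largest entries first. -/
def rowKey (S : Tableau μ n) : Colex (Fin n → ℕ) := toColex S.rowOf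

/-- Consider the largest entry `i` whose row changes. If it moved up its column, `τ i` would exceed
`i`; but `τ` fixes all entries beyond `i`, contradicting injectivity. -/
theorem IsStandard.toColex_comp_le {S : Tableau μ n} (hS : S.IsStandard)
    {τ : Equiv.Perm (Fin n)} (hτ : τ ∈ fiberPerms S.colOf) :
    toColex (S.rowOf ∘ τ) ≤ S.rowKey := by
  rw [mem_fiberPerms] at hτ
  by_contra hlt
  obtain ⟨i, hi, hlt⟩ := exists_of_toColex_lt (not_le.1 hlt)
  change ∀ j, i < j → S.rowOf j = S.rowOf (τ j) at hi
  change S.rowOf i < S.rowOf (τ i) at hlt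
  have h1 : i < τ i := hS.lt_of_colOf_eq (hτ i).symm hlt
  have h2 : τ i = τ (τ i) := S.eq_of_rowOf_colOf (hi _ h1) (hτ _).symm
  exact h1.ne (τ.injective h2)

theorem eq_one_of_rowOf_comp (S : Tableau μ n)
    {τ : Equiv.Perm (Fin n)} (hτ : τ ∈ fiberPerms S.colOf) (h : S.rowOf ∘ τ = S.rowOf) : τ = 1 := by
  rw [mem_fiberPerms] at hτ
  ext i
  rw [S.eq_of_rowOf_colOf (congrFun h i) (hτ i)]
  rfl

/-- Recovers columns from row data alone, so that a standard tableau is determined by its `rowKey`.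
-/
theorem IsStandard.card_filter_rowOf {S : Tableau μ n} (hS : S.IsStandard) (i : Fin n) :
    (Finset.univ.filter fun j => S.rowOf j = S.rowOf i ∧ j < i).card = S.colOf i := by
  have hmem : ∀ c < S.colOf i, (S.rowOf i, c) ∈ μ.cells := fun c hc =>
    μ.up_left_mem le_rfl hc.le (S.mem_cells_of i)
  symm
  conv_lhs => rw [← Finset.card_range (S.colOf i)]
  refine Finset.card_bij (fun c hc => S ⟨_, hmem c (Finset.mem_range.1 hc)⟩) ?_ ?_ ?_
  · intro c hc
    simp only [Finset.mem_filter, Finset.mem_univ, true_and]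
    refine ⟨S.rowOf_apply _, hS.lt_of_rowOf_eq (S.rowOf_apply _) ?_⟩
    rw [S.colOf_apply]
    exact Finset.mem_range.1 hc
  · intro c _ d _ hcd
    simpa using hcd
  · intro j hj
    simp only [Finset.mem_filter, Finset.mem_univ, true_and] at hj
    have hlt : S.colOf j < S.colOf i := by
      by_contra hle
      rcases (not_lt.1 hle).eq_or_lt with h | h
      · exact hj.2.ne (S.eq_of_rowOf_colOf hj.1 h.symm)
      · exact absurd (hS.lt_of_rowOf_eq hj.1.symm h) (not_lt.2 hj.2.le)
    refine ⟨S.colOf j, Finset.mem_range.2 hlt, ?_⟩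
    apply S.eq_of_rowOf_colOf
    · rw [S.rowOf_apply, hj.1]
    · rw [S.colOf_apply]

theorem rowKey_injective :
    Function.Injective fun S : SYT μ n => S.1.rowKey := by
  intro S S' h
  have hrow : S.1.rowOf = S'.1.rowOf := toColex.injective h
  apply Subtype.ext
  apply Equiv.symm_bijective.injective
  refine Equiv.ext fun i => Subtype.ext (Prod.ext (congrFun hrow i) ?_)
  change S.1.colOf i = S'.1.colOf i
  rw [← S.2.card_filter_rowOf, ← S'.2.card_filter_rowOf, hrow]

theorem IsStandard.readingPos_lt_iff {S : Tableau μ n} (hS : S.IsStandard) {m : ℕ}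
    (h : m + 1 < n) : readingPos S ⟨m, Nat.lt_of_succ_lt h⟩ < readingPos S ⟨m + 1, h⟩ ↔
      S.rowOf ⟨m + 1, h⟩ ≤ S.rowOf ⟨m, Nat.lt_of_succ_lt h⟩ := by
  rw [readingPos, readingPos, Prod.Lex.toLex_lt_toLex]
  simp only [OrderDual.toDual_lt_toDual, OrderDual.toDual_inj]
  constructor
  · rintro (h | h)
    · exact h.le
    · exact h.1.ge
  · intro hle
    rcases hle.lt_or_eq with h1 | h1
    · exact Or.inl h1
    · refine Or.inr ⟨h1.symm, ?_⟩
      by_contra hc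
      rcases (not_lt.1 hc).eq_or_lt with h2 | h2
      · have := S.eq_of_rowOf_colOf h1 h2
        simp at this
      · have := hS.lt_of_rowOf_eq h1 h2
        simp at this

theorem IsStandard.cw_succ {S : Tableau μ n} (hS : S.IsStandard) {m : ℕ} (h : m + 1 < n) :
    cw S ⟨m + 1, h⟩ = cw S ⟨m, Nat.lt_of_succ_lt h⟩ +
      if S.rowOf ⟨m, Nat.lt_of_succ_lt h⟩ < S.rowOf ⟨m + 1, h⟩ then 1 else 0 := by
  rw [cw, cw, cochargeLabel]
  congr 1
  rw [if_congr (hS.readingPos_lt_iff h) rfl rfl]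
  simp only [← not_lt, ite_not]

theorem cw_zero (S : Tableau μ n) (h : 0 < n) : cw S ⟨0, h⟩ = 0 := by
  rw [cw, cochargeLabel]

theorem IsStandard.cw_mono {S : Tableau μ n} (hS : S.IsStandard) : Monotone (cw S) := by
  rintro ⟨a, ha⟩ ⟨b, hb⟩ hab
  change a ≤ b at hab
  induction b, hab using Nat.le_induction with
  | base => exact le_rfl
  | succ b hab ih =>
    rw [hS.cw_succ hb]
    exact (ih _).trans (Nat.le_add_right _ _)

theorem IsStandard.rowOf_le_of_cw_eq {S : Tableau μ n} (hS : S.IsStandard) {i j : Fin n}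
    (hij : i ≤ j) (hcw : cw S i = cw S j) : S.rowOf j ≤ S.rowOf i := by
  obtain ⟨a, ha⟩ := i
  obtain ⟨b, hb⟩ := j
  change a ≤ b at hij
  induction b, hij using Nat.le_induction with
  | base => exact le_rfl
  | succ b hab ih =>
    have h1 : cw S ⟨a, ha⟩ ≤ cw S ⟨b, Nat.lt_of_succ_lt hb⟩ := hS.cw_mono hab
    have h2 := hS.cw_succ hb
    by_cases hlt : S.rowOf ⟨b, Nat.lt_of_succ_lt hb⟩ < S.rowOf ⟨b + 1, hb⟩
    · rw [if_pos hlt] at h2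
      omega
    · rw [if_neg hlt] at h2
      exact (not_lt.1 hlt).trans (ih _ (by omega))

/-- Along entries with equal label there is no descent, so their rows weakly decrease. The largest
entries of a label class already occupy its lowest rows, and a rearrangement cannot lower the key.
-/
theorem IsStandard.le_toColex_comp {S : Tableau μ n} (hS : S.IsStandard)
    {y : Equiv.Perm (Fin n)} (hy : y ∈ fiberPerms (cw S)) :
    S.rowKey ≤ toColex (S.rowOf ∘ y) := by
  classical
  rw [mem_fiberPerms] at hy
  by_contra hlt
  obtain ⟨i, hi, hlt⟩ := exists_of_toColex_lt (not_le.1 hlt)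
  change ∀ j, i < j → S.rowOf (y j) = S.rowOf j at hi
  change S.rowOf (y i) < S.rowOf i at hlt
  -- All elements of `A` lie beyond `i`, where `y` preserves rows, so `y` permutes `A`. Then `y i ∈
  -- A` would force `i ∈ A`.
  let A : Finset (Fin n) :=
    Finset.univ.filter fun j => cw S j = cw S i ∧ S.rowOf j ≤ S.rowOf (y i)
  have hA : ∀ j ∈ A, i < j := by
    intro j hj
    simp only [A, Finset.mem_filter, Finset.mem_univ, true_and] at hj
    by_contra hle
    have := hS.rowOf_le_of_cw_eq (not_lt.1 hle) hj.1
    omega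
  have hmaps : A.image y = A := by
    apply Finset.eq_of_subset_of_card_le
    · intro b hb
      obtain ⟨a, ha, rfl⟩ := Finset.mem_image.1 hb
      have h1 := hi a (hA a ha)
      simp only [A, Finset.mem_filter, Finset.mem_univ, true_and] at ha ⊢
      rw [hy, h1]
      exact ha
    · rw [Finset.card_image_of_injective _ y.injective]
  have hyi : y i ∈ A.image y := by
    rw [hmaps]
    simp only [A, Finset.mem_filter, Finset.mem_univ, true_and]
    exact ⟨hy i, le_rfl⟩
  obtain ⟨a, ha, hay⟩ := Finset.mem_image.1 hyi
  rw [y.injective hay] at ha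
  exact (hA i ha).ne rfl

/-- The element of the group algebra that takes `ε_T` to the leading part of the higher Specht
polynomials belonging to `S`. -/
def rightFactor (T S : Tableau μ n) : GroupAlg n :=
  perm (S.symm.trans T) * fiberSum (cw S)

theorem rowOf_symm_trans (S T : Tableau μ n) (j : Fin n) :
    T.rowOf ((S.symm.trans T) j) = S.rowOf j := by
  simp [rowOf]

theorem colOf_symm_trans (S T : Tableau μ n) (j : Fin n) :
    T.colOf ((S.symm.trans T) j) = S.colOf j := by
  simp [colOf]

theorem coeff_youngIdempotent_mul_rightFactor (T S : Tableau μ n) (q : Equiv.Perm (Fin n)) :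
    (T.youngIdempotent * rightFactor T S).coeff q =
      ∑ τ ∈ fiberPerms T.colOf, ∑ σ ∈ fiberPerms T.rowOf, ∑ y ∈ fiberPerms (cw S),
        if τ * σ * ((S.symm.trans T) * y) = q then ((Equiv.Perm.sign τ : ℤ) : ℚ) else 0 := by
  rw [youngIdempotent, rightFactor, fiberSum, Finset.mul_sum, Finset.sum_mul]
  simp only [Finset.sum_mul, Finset.mul_sum, MonoidAlgebra.coeff_sum,
    Finsupp.coe_finsetSum, Finset.sum_apply, MonoidAlgebra.single_mul_single, mul_one,
    MonoidAlgebra.coeff_single, Finsupp.single_apply]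
  exact Finset.sum_congr rfl fun τ _ => Finset.sum_comm

/-- A term of the coefficient of `ε_T w_S` at the permutation of `S'` compares `S` and `S'`. -/
theorem rowKey_le_of_mul_eq {T : Tableau μ n} {S S' : SYT μ n} {τ σ y : Equiv.Perm (Fin n)}
    (hτ : τ ∈ fiberPerms T.colOf) (hσ : σ ∈ fiberPerms T.rowOf) (hy : y ∈ fiberPerms (cw S.1))
    (h : τ * σ * ((S.1.symm.trans T) * y) = S'.1.symm.trans T) :
    S.1.rowKey ≤ S'.1.rowKey ∧ (S = S' → τ = 1) := by
  set g : Equiv.Perm (Fin n) := S'.1.symm.trans T with hg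
  have hτ' : g⁻¹ * τ⁻¹ * g ∈ fiberPerms S'.1.colOf := by
    rw [mem_fiberPerms]
    intro i
    have h1 := colOf_symm_trans S'.1 T (g⁻¹ (τ⁻¹ (g i)))
    change T.colOf (g (g⁻¹ (τ⁻¹ (g i)))) = _ at h1
    rw [← Equiv.Perm.mul_apply g g⁻¹, mul_inv_cancel, Equiv.Perm.one_apply,
      mem_fiberPerms.1 (inv_mem_fiberPerms hτ)] at h1
    change _ = S'.1.colOf (g⁻¹ (τ⁻¹ (g i))) at h1
    change S'.1.colOf (g⁻¹ (τ⁻¹ (g i))) = _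
    rw [← h1]
    exact colOf_symm_trans S'.1 T i
  -- Taking rows in `T` eliminates `σ`. A label-preserving rearrangement of `S`, which cannot lower
  -- its key, then equals a column rearrangement of `S'`, which cannot raise its key.
  have hrow : S.1.rowOf ∘ y = S'.1.rowOf ∘ (g⁻¹ * τ⁻¹ * g : Equiv.Perm (Fin n)) := by
    funext j
    have h1 : σ ((S.1.symm.trans T) (y j)) = τ⁻¹ (g j) := by
      rw [← h]
      simp [Equiv.Perm.mul_apply]
    have h2 := congrArg T.rowOf h1
    rw [mem_fiberPerms.1 hσ, rowOf_symm_trans] at h2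
    change S.1.rowOf (y j) = _
    rw [h2]
    have h3 := rowOf_symm_trans S'.1 T (g⁻¹ (τ⁻¹ (g j)))
    change T.rowOf (g (g⁻¹ (τ⁻¹ (g j)))) = _ at h3
    rw [← Equiv.Perm.mul_apply g g⁻¹, mul_inv_cancel, Equiv.Perm.one_apply] at h3
    exact h3
  have hle1 := S.2.le_toColex_comp hy
  have hle2 := S'.2.toColex_comp_le hτ'
  rw [hrow] at hle1
  refine ⟨hle1.trans hle2, ?_⟩
  rintro rfl
  have h1 := S.1.eq_one_of_rowOf_comp hτ' (toColex.injective (le_antisymm hle2 hle1))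
  have h2 : τ = (g * (g⁻¹ * τ⁻¹ * g) * g⁻¹)⁻¹ := by group
  rw [h2, h1]
  group

/-- Triangular with respect to `rowKey`. On the diagonal every contributing term has `τ = 1`, so
nothing cancels and the identity term makes the coefficient positive. -/
theorem linearIndependent_youngIdempotent_mul_rightFactor (T : Tableau μ n) :
    LinearIndependent ℚ fun S : SYT μ n => T.youngIdempotent * rightFactor T S.1 := by
  refine linearIndependent_of_triangular _
    (fun S' => (MonoidAlgebra.basis (Equiv.Perm (Fin n)) ℚ).coord (S'.1.symm.trans T))
    (fun S => S.1.rowKey) rowKey_injective ?_ ?_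
  · intro S S' hne
    change (T.youngIdempotent * rightFactor T S.1).coeff (S'.1.symm.trans T) ≠ 0 at hne
    rw [coeff_youngIdempotent_mul_rightFactor] at hne
    obtain ⟨τ, hτ, h1⟩ := Finset.exists_ne_zero_of_sum_ne_zero hne
    obtain ⟨σ, hσ, h2⟩ := Finset.exists_ne_zero_of_sum_ne_zero h1
    obtain ⟨y, hy, h3⟩ := Finset.exists_ne_zero_of_sum_ne_zero h2
    exact (rowKey_le_of_mul_eq hτ hσ hy (ite_ne_right_iff.1 h3).1).1
  · intro S
    change (T.youngIdempotent * rightFactor T S.1).coeff (S.1.symm.trans T) ≠ 0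
    rw [coeff_youngIdempotent_mul_rightFactor]
    have hnn : ∀ τ ∈ fiberPerms T.colOf, ∀ σ ∈ fiberPerms T.rowOf, ∀ y ∈ fiberPerms (cw S.1),
        (0 : ℚ) ≤ if τ * σ * ((S.1.symm.trans T) * y) = S.1.symm.trans T then
          ((Equiv.Perm.sign τ : ℤ) : ℚ) else 0 := by
      intro τ hτ σ hσ y hy
      split_ifs with h
      · rw [(rowKey_le_of_mul_eq hτ hσ hy h).2 rfl]
        simp
      · exact le_rfl
    apply ne_of_gt
    refine Finset.sum_pos' (fun τ hτ => Finset.sum_nonneg fun σ hσ => Finset.sum_nonneg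
      fun y hy => hnn τ hτ σ hσ y hy) ⟨1, one_mem_fiberPerms, ?_⟩
    refine Finset.sum_pos' (fun σ hσ => Finset.sum_nonneg
      fun y hy => hnn _ one_mem_fiberPerms σ hσ y hy) ⟨1, one_mem_fiberPerms, ?_⟩
    refine Finset.sum_pos' (fun y hy => hnn _ one_mem_fiberPerms _ one_mem_fiberPerms y hy)
      ⟨1, one_mem_fiberPerms, ?_⟩
    simp

theorem coeff_perm_mul_youngIdempotent (T : Tableau μ n) (g q : Equiv.Perm (Fin n)) :
    (perm g * T.youngIdempotent).coeff q =
      ∑ τ ∈ fiberPerms T.colOf, ∑ σ ∈ fiberPerms T.rowOf,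
        if g * (τ * σ) = q then ((Equiv.Perm.sign τ : ℤ) : ℚ) else 0 := by
  rw [youngIdempotent]
  simp only [perm, Finset.mul_sum, MonoidAlgebra.coeff_sum,
    Finsupp.coe_finsetSum, Finset.sum_apply, MonoidAlgebra.single_mul_single, one_mul,
    MonoidAlgebra.coeff_single, Finsupp.single_apply]
  rfl

theorem rowKey_le_of_mul_eq' {T₀ : Tableau μ n} {T T' : SYT μ n} {τ σ : Equiv.Perm (Fin n)}
    (hτ : τ ∈ fiberPerms T₀.colOf) (hσ : σ ∈ fiberPerms T₀.rowOf)
    (h : T₀.symm.trans T.1 * (τ * σ) = T₀.symm.trans T'.1) :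
    T'.1.rowKey ≤ T.1.rowKey ∧ (T = T' → τ = 1) := by
  set g : Equiv.Perm (Fin n) := T₀.symm.trans T.1 with hg
  have hginv : ∀ j, T₀.rowOf (g⁻¹ j) = T.1.rowOf j := rowOf_symm_trans T.1 T₀
  have hginvc : ∀ j, T₀.colOf (g⁻¹ j) = T.1.colOf j := colOf_symm_trans T.1 T₀
  have hτ' : g * τ⁻¹ * g⁻¹ ∈ fiberPerms T.1.colOf := by
    rw [mem_fiberPerms]
    intro i
    rw [← hginvc, ← hginvc i, Equiv.Perm.mul_apply, Equiv.Perm.mul_apply, inv_apply_self,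
      mem_fiberPerms.1 (inv_mem_fiberPerms hτ)]
  have hrow : T'.1.rowOf = T.1.rowOf ∘ (g * τ⁻¹ * g⁻¹ : Equiv.Perm (Fin n)) := by
    funext j
    have h1 : T'.1.rowOf j = T₀.rowOf ((T₀.symm.trans T'.1 : Equiv.Perm (Fin n))⁻¹ j) :=
      (rowOf_symm_trans T'.1 T₀ j).symm
    rw [h1, ← h, mul_inv_rev, mul_inv_rev, Equiv.Perm.mul_apply, Equiv.Perm.mul_apply,
      mem_fiberPerms.1 (inv_mem_fiberPerms hσ), Function.comp_apply, ← hginv,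
      Equiv.Perm.mul_apply, Equiv.Perm.mul_apply, inv_apply_self]
  have hle := T.2.toColex_comp_le hτ'
  rw [← hrow] at hle
  refine ⟨hle, ?_⟩
  rintro rfl
  have h1 := T.1.eq_one_of_rowOf_comp hτ' hrow.symm
  have h2 : τ = (g⁻¹ * (g * τ⁻¹ * g⁻¹) * g)⁻¹ := by group
  rw [h2, h1]
  group

/-- The same triangularity on the other side, with the order reversed: column permutations only
lower the key of a standard tableau. -/
theorem linearIndependent_perm_mul_youngIdempotent (T₀ : Tableau μ n) :
    LinearIndependent ℚ fun T : SYT μ n => perm (T₀.symm.trans T.1) * T₀.youngIdempotent := by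
  refine linearIndependent_of_triangular _
    (fun T' => (MonoidAlgebra.basis (Equiv.Perm (Fin n)) ℚ).coord (T₀.symm.trans T'.1))
    (fun T => OrderDual.toDual T.1.rowKey)
    (OrderDual.toDual.injective.comp rowKey_injective) ?_ ?_
  · intro T T' hne
    change (perm (T₀.symm.trans T.1) * T₀.youngIdempotent).coeff (T₀.symm.trans T'.1) ≠ 0 at hne
    rw [coeff_perm_mul_youngIdempotent] at hne
    obtain ⟨τ, hτ, h1⟩ := Finset.exists_ne_zero_of_sum_ne_zero hne
    obtain ⟨σ, hσ, h2⟩ := Finset.exists_ne_zero_of_sum_ne_zero h1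
    exact (rowKey_le_of_mul_eq' hτ hσ (ite_ne_right_iff.1 h2).1).1
  · intro T
    change (perm (T₀.symm.trans T.1) * T₀.youngIdempotent).coeff (T₀.symm.trans T.1) ≠ 0
    rw [coeff_perm_mul_youngIdempotent]
    have hnn : ∀ τ ∈ fiberPerms T₀.colOf, ∀ σ ∈ fiberPerms T₀.rowOf,
        (0 : ℚ) ≤ if T₀.symm.trans T.1 * (τ * σ) = T₀.symm.trans T.1 then
          ((Equiv.Perm.sign τ : ℤ) : ℚ) else 0 := by
      intro τ hτ σ hσ
      split_ifs with h
      · rw [(rowKey_le_of_mul_eq' hτ hσ h).2 rfl]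
        simp
      · exact le_rfl
    apply ne_of_gt
    refine Finset.sum_pos' (fun τ hτ => Finset.sum_nonneg fun σ hσ => hnn τ hτ σ hσ)
      ⟨1, one_mem_fiberPerms, ?_⟩
    refine Finset.sum_pos' (fun σ hσ => hnn _ one_mem_fiberPerms σ hσ) ⟨1, one_mem_fiberPerms, ?_⟩
    simp

end Tableau

/-! ### Shapes -/

/-- The Young diagrams with `n` cells. -/
abbrev Shape (n : ℕ) : Type := {μ : YoungDiagram // μ.card = n}

theorem mem_range_of_mem_cells {μ : YoungDiagram} {c : ℕ × ℕ} (hc : c ∈ μ.cells) :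
    c ∈ Finset.range μ.card ×ˢ Finset.range μ.card := by
  obtain ⟨a, b⟩ := c
  rw [Finset.mem_product, Finset.mem_range, Finset.mem_range]
  constructor
  · have h1 : (Finset.range (a + 1)).card ≤ μ.card := by
      refine Finset.card_le_card_of_injOn (fun i => (i, 0)) ?_ ?_
      · intro i hi
        exact μ.up_left_mem (Nat.lt_succ_iff.1 (Finset.mem_range.1 hi)) (Nat.zero_le _) hc
      · intro i _ j _ hij
        exact (Prod.mk.inj hij).1
    simpa using h1
  · have h1 : (Finset.range (b + 1)).card ≤ μ.card := by
      refine Finset.card_le_card_of_injOn (fun i => (0, i)) ?_ ?_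
      · intro i hi
        exact μ.up_left_mem (Nat.zero_le _) (Nat.lt_succ_iff.1 (Finset.mem_range.1 hi)) hc
      · intro i _ j _ hij
        exact (Prod.mk.inj hij).2
    simpa using h1

instance instFiniteShape (n : ℕ) : Finite (Shape n) := by
  refine Finite.of_injective
    (β := ↥(Finset.range n ×ˢ Finset.range n).powerset) (fun μ => ⟨μ.1.cells, ?_⟩) ?_
  · rw [Finset.mem_powerset]
    intro c hc
    simpa only [μ.2] using mem_range_of_mem_cells hc
  · intro μ ν h
    apply Subtype.ext
    apply YoungDiagram.ext
    simpa using h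

instance instFintypeShape (n : ℕ) : Fintype (Shape n) := Fintype.ofFinite _

instance instFintypeSYT (μ : YoungDiagram) (n : ℕ) : Fintype (SYT μ n) := Fintype.ofFinite _

/-- A fixed tableau of each shape. -/
def baseTab {n : ℕ} (μ : Shape n) : Tableau μ.1 n := Finset.equivFinOfCardEq μ.2

theorem card_of_tableau {μ : YoungDiagram} {n : ℕ} (T : Tableau μ n) : μ.card = n := by
  simpa using Fintype.card_congr T

/-! ### Independence across shapes -/

-- Positivity cancels the left symmetrizer. With `C` and `R` the column antisymmetrizer and row
-- symmetrizer and `y = C R r`, one has `invol y * y = invol r * R C² R r`, and `C²` is a scalar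
-- multiple of `C`.
open Tableau in
theorem fiberAlt_mul_eq_zero_of {μ : YoungDiagram} {n : ℕ} (T : Tableau μ n) (r : GroupAlg n)
    (h : fiberSum T.rowOf * fiberAlt T.colOf * (fiberSum T.rowOf * r) = 0) :
    fiberAlt T.colOf * (fiberSum T.rowOf * r) = 0 := by
  apply eq_zero_of_invol_mul_self
  rw [invol_mul, invol_mul, invol_fiberAlt, invol_fiberSum]
  have h1 : invol r * fiberSum T.rowOf * fiberAlt T.colOf *
      (fiberAlt T.colOf * (fiberSum T.rowOf * r)) =
      invol r * (fiberSum T.rowOf * (fiberAlt T.colOf * fiberAlt T.colOf) *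
        (fiberSum T.rowOf * r)) := by
    simp only [mul_assoc]
  rw [h1, fiberAlt_mul_self, mul_smul_comm, smul_mul_assoc, h, smul_zero, mul_zero]

open Tableau in
/-- The left ideals generated by the Young idempotents stay independent after right
multiplication by the factors belonging to the standard tableaux. -/
theorem eq_zero_of_sum_mul_rightFactor {n : ℕ} (y : ∀ μ : Shape n, SYT μ.1 n → GroupAlg n)
    (hy : ∀ μ S, ∃ z, y μ S = z * (baseTab μ).youngIdempotent)
    (h0 : ∑ μ, ∑ S, y μ S * rightFactor (baseTab μ) S.1 = 0) : ∀ μ S, y μ S = 0 := by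
  choose z hz using hy
  suffices H : ∀ w : ℕ, ∀ μ : Shape n, rowWeight μ.1 = w → ∀ S, y μ S = 0 from
    fun μ S => H _ μ rfl S
  intro w
  induction w using Nat.strong_induction_on with
  | _ w ih =>
  rintro μ rfl
  set R := fiberSum (baseTab μ).rowOf with hR
  set C := fiberAlt (baseTab μ).colOf with hC
  -- Multiplication by `R * x` isolates the shape `μ`: other shapes of at least its weight are
  -- annihilated, and lighter ones vanish by induction.
  have key : ∀ x : GroupAlg n, ∑ S, R * x * y μ S * rightFactor (baseTab μ) S.1 = 0 := by
    intro x
    have h1 := congrArg (fun a => R * x * a) h0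
    simp only [mul_zero, Finset.mul_sum] at h1
    rw [Finset.sum_eq_single μ] at h1
    · simpa only [mul_assoc] using h1
    · intro ν _ hν
      refine Finset.sum_eq_zero fun S _ => ?_
      rcases lt_or_ge (rowWeight ν.1) (rowWeight μ.1) with hlt | hle
      · rw [ih _ hlt ν rfl S]
        simp
      · rw [hz, youngIdempotent_eq]
        have h2 := fiberSum_mul_mul_fiberAlt_eq_zero (baseTab ν) (baseTab μ)
          (fun h => hν (Subtype.ext h)) hle (x * z ν S)
        have h3 : R * x * (z ν S * (fiberAlt (baseTab ν).colOf * fiberSum (baseTab ν).rowOf) *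
            rightFactor (baseTab ν) S.1) = R * (x * z ν S) * fiberAlt (baseTab ν).colOf *
            (fiberSum (baseTab ν).rowOf * rightFactor (baseTab ν) S.1) := by
          simp only [mul_assoc]
        rw [h3, h2, zero_mul]
    · simp
  -- Von Neumann's lemma makes each `R * x * y μ S` a multiple of `R * C * R`. After positivity
  -- strips the left `R`, independence of the right factors kills the scalars.
  have hzero : ∀ x S, R * x * y μ S = 0 := by
    intro x
    choose c hc using fun S => exists_fiberSum_mul_mul_fiberAlt_eq (baseTab μ) (x * z μ S)
    have hc' : ∀ S, R * x * y μ S = c S • (R * C * R) := by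
      intro S
      rw [hz, youngIdempotent_eq]
      have h3 : R * x * (z μ S * (C * R)) = R * (x * z μ S) * C * R := by
        simp only [mul_assoc]
      rw [h3, hc S, smul_mul_assoc]
    have h1 : R * C * (R * ∑ S, c S • rightFactor (baseTab μ) S.1) = 0 := by
      rw [← key x, ← mul_assoc, Finset.mul_sum]
      refine Finset.sum_congr rfl fun S _ => ?_
      rw [hc' S, mul_smul_comm, smul_mul_assoc]
    have h2 := fiberAlt_mul_eq_zero_of _ _ h1
    have h3 : ∑ S, c S • ((baseTab μ).youngIdempotent * rightFactor (baseTab μ) S.1) = 0 := by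
      rw [← h2, ← mul_assoc, youngIdempotent_eq, Finset.mul_sum]
      exact Finset.sum_congr rfl fun S _ => (mul_smul_comm _ _ _).symm
    have h4 := Fintype.linearIndependent_iff.1
      (linearIndependent_youngIdempotent_mul_rightFactor (baseTab μ)) c h3
    intro S
    rw [hc' S, h4 S, zero_smul]
  intro S
  -- Writing `y = z C R`, the element `invol y` equals `R * (C * invol z)`, so `invol y * y` is an
  -- instance of `hzero`.
  apply eq_zero_of_invol_mul_self
  conv_lhs => enter [1]; rw [hz, youngIdempotent_eq]
  rw [invol_mul, invol_mul, invol_fiberAlt, invol_fiberSum, mul_assoc R]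
  exact hzero _ S

/-! ### The number of pairs of standard tableaux -/

/-- Pairs of standard tableaux with `n` boxes of the same shape. -/
abbrev TabPair (n : ℕ) : Type := Σ μ : Shape n, SYT μ.1 n × SYT μ.1 n

instance instFintypeTabPair (n : ℕ) : Fintype (TabPair n) := inferInstance

/-- The leading part of a higher Specht polynomial, as an element of the group algebra. -/
def leading {n : ℕ} (p : TabPair n) : GroupAlg n :=
  perm ((baseTab p.1).symm.trans p.2.2.1) * (baseTab p.1).youngIdempotent *
    (baseTab p.1).rightFactor p.2.1.1

theorem linearIndependent_leading (n : ℕ) : LinearIndependent ℚ (leading (n := n)) := by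
  rw [Fintype.linearIndependent_iff]
  intro c hc
  have h := eq_zero_of_sum_mul_rightFactor (n := n)
    (fun μ S => ∑ T, c ⟨μ, S, T⟩ • (perm ((baseTab μ).symm.trans T.1) *
      (baseTab μ).youngIdempotent)) ?_ ?_
  · rintro ⟨μ, S, T⟩
    exact Fintype.linearIndependent_iff.1
      (Tableau.linearIndependent_perm_mul_youngIdempotent (baseTab μ)) _ (h μ S) T
  · intro μ S
    refine ⟨∑ T, c ⟨μ, S, T⟩ • perm ((baseTab μ).symm.trans T.1), ?_⟩
    rw [Finset.sum_mul]
    exact Finset.sum_congr rfl fun T _ => (smul_mul_assoc _ _ _).symm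
  · rw [← hc, Fintype.sum_sigma]
    refine Finset.sum_congr rfl fun μ _ => ?_
    rw [Fintype.sum_prod_type]
    refine Finset.sum_congr rfl fun S _ => ?_
    rw [Finset.sum_mul]
    exact Finset.sum_congr rfl fun T _ => smul_mul_assoc _ _ _

/-! ### Counting in Young's lattice -/

theorem mem_of_mem_of_not_mem {μ ν : YoungDiagram} (hle : μ ≤ ν) (hcard : ν.card = μ.card + 1)
    {c d : ℕ × ℕ} (hc : c ∈ ν) (hc' : c ∉ μ) (hd : d ∈ ν) (hdc : d ≠ c) : d ∈ μ := by
  by_contra hd'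
  have hsub : μ.cells ⊆ ν.cells := YoungDiagram.cells_subset_iff.2 hle
  have h1 : ({c, d} : Finset (ℕ × ℕ)) ⊆ ν.cells \ μ.cells := by
    intro x hx
    rw [Finset.mem_insert, Finset.mem_singleton] at hx
    rw [Finset.mem_sdiff]
    rcases hx with rfl | rfl
    · exact ⟨hc, hc'⟩
    · exact ⟨hd, hd'⟩
  have h2 := Finset.card_le_card h1
  rw [Finset.card_pair hdc.symm, Finset.card_sdiff_of_subset hsub] at h2
  simp only [YoungDiagram.card] at hcard
  omega

theorem exists_mem_not_mem {μ ν : YoungDiagram} (hcard : ν.card = μ.card + 1) :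
    ∃ c, c ∈ ν ∧ c ∉ μ := by
  by_contra hne
  push Not at hne
  have : ν.cells ⊆ μ.cells := fun c hc => hne c hc
  have := Finset.card_le_card this
  simp only [YoungDiagram.card] at hcard
  omega

theorem eq_of_le_of_card_eq {μ ν : YoungDiagram} (hle : μ ≤ ν) (hcard : ν.card = μ.card) :
    μ = ν :=
  YoungDiagram.ext (Finset.eq_of_subset_of_card_le (YoungDiagram.cells_subset_iff.2 hle) hcard.le)

/-- Row `i` can be lengthened by one cell. -/
def IsAddable (μ : YoungDiagram) (i : ℕ) : Prop := ∀ j, j + 1 = i → μ.rowLen i < μ.rowLen j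

/-- Row `i` can be shortened by one cell. -/
def IsRemovable (μ : YoungDiagram) (i : ℕ) : Prop := μ.rowLen (i + 1) < μ.rowLen i

/-- The diagram with one more cell in row `i`. -/
def addCell (μ : YoungDiagram) (i : ℕ) (h : IsAddable μ i) : YoungDiagram where
  cells := insert (i, μ.rowLen i) μ.cells
  isLowerSet := by
    rintro ⟨a, b⟩ ⟨c, d⟩ hle hab
    obtain ⟨hca, hdb⟩ : c ≤ a ∧ d ≤ b := hle
    simp only [Finset.coe_insert, Set.mem_insert_iff, Finset.mem_coe, Prod.mk.injEq] at hab ⊢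
    rcases hab with ⟨rfl, rfl⟩ | hab
    · rcases hca.eq_or_lt with rfl | hca
      · rcases hdb.eq_or_lt with rfl | hdb
        · exact Or.inl ⟨rfl, rfl⟩
        · exact Or.inr (YoungDiagram.mem_iff_lt_rowLen.2 hdb)
      · refine Or.inr (YoungDiagram.mem_iff_lt_rowLen.2 (hdb.trans_lt ?_))
        have h1 := h (a - 1) (by omega)
        exact h1.trans_le (μ.rowLen_anti _ _ (by omega))
    · exact Or.inr (μ.up_left_mem hca hdb hab)

/-- The diagram with one cell less in row `i`. -/
def removeCell (μ : YoungDiagram) (i : ℕ) (h : IsRemovable μ i) : YoungDiagram where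
  cells := μ.cells.erase (i, μ.rowLen i - 1)
  isLowerSet := by
    rintro ⟨a, b⟩ ⟨c, d⟩ hle hab
    obtain ⟨hca, hdb⟩ : c ≤ a ∧ d ≤ b := hle
    simp only [Finset.coe_erase, Set.mem_sdiff, Finset.mem_coe, Set.mem_singleton_iff,
      Prod.mk.injEq, not_and] at hab ⊢
    refine ⟨μ.up_left_mem hca hdb hab.1, ?_⟩
    rintro rfl rfl
    have hb := YoungDiagram.mem_iff_lt_rowLen.1 hab.1
    rcases hca.eq_or_lt with rfl | hca
    · exact hab.2 rfl (by omega)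
    · have h1 := μ.rowLen_anti (c + 1) a hca
      unfold IsRemovable at h
      omega

theorem card_addCell (μ : YoungDiagram) (i : ℕ) (h : IsAddable μ i) :
    (addCell μ i h).card = μ.card + 1 := by
  have h1 : (i, μ.rowLen i) ∉ μ.cells := fun hmem =>
    lt_irrefl _ (YoungDiagram.mem_iff_lt_rowLen.1 hmem)
  exact Finset.card_insert_of_notMem h1

theorem removeCell_mem (μ : YoungDiagram) (i : ℕ) (h : IsRemovable μ i) :
    (i, μ.rowLen i - 1) ∈ μ.cells := by
  apply YoungDiagram.mem_iff_lt_rowLen.2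
  unfold IsRemovable at h
  omega

theorem card_removeCell (μ : YoungDiagram) (i : ℕ) (h : IsRemovable μ i) :
    (removeCell μ i h).card + 1 = μ.card :=
  Finset.card_erase_add_one (removeCell_mem μ i h)

theorem le_addCell (μ : YoungDiagram) (i : ℕ) (h : IsAddable μ i) : μ ≤ addCell μ i h :=
  YoungDiagram.cells_subset_iff.1 (Finset.subset_insert _ _)

theorem removeCell_le (μ : YoungDiagram) (i : ℕ) (h : IsRemovable μ i) : removeCell μ i h ≤ μ :=
  YoungDiagram.cells_subset_iff.1 (Finset.erase_subset _ _)

open Classical in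
theorem card_up {n : ℕ} (μ : Shape n) :
    (Finset.univ.filter fun ν : Shape (n + 1) => μ.1 ≤ ν.1).card =
      ((Finset.range (n + 1)).filter fun i => IsAddable μ.1 i).card := by
  symm
  refine Finset.card_bij (fun i hi => ⟨addCell μ.1 i (Finset.mem_filter.1 hi).2, by
    rw [card_addCell, μ.2]⟩) ?_ ?_ ?_
  · intro i hi
    simpa using le_addCell μ.1 i (Finset.mem_filter.1 hi).2
  · intro i hi j hj hij
    have h1 : (i, μ.1.rowLen i) ∈ (addCell μ.1 j (Finset.mem_filter.1 hj).2).cells := by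
      rw [← congrArg (fun ν : Shape (n + 1) => ν.1.cells) hij]
      exact Finset.mem_insert_self _ _
    rcases Finset.mem_insert.1 h1 with h2 | h2
    · exact (Prod.mk.inj h2).1
    · exact absurd (YoungDiagram.mem_iff_lt_rowLen.1 h2) (lt_irrefl _)
  · intro ν hν
    have hle : μ.1 ≤ ν.1 := by simpa using hν
    have hcard : ν.1.card = μ.1.card + 1 := by rw [μ.2, ν.2]
    obtain ⟨⟨i, j⟩, hc, hc'⟩ := exists_mem_not_mem hcard
    have hj : j = μ.1.rowLen i := by
      by_contra hne
      have hge : μ.1.rowLen i ≤ j := not_lt.1 fun h => hc' (YoungDiagram.mem_iff_lt_rowLen.2 h)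
      have := mem_of_mem_of_not_mem hle hcard hc hc'
        (ν.1.up_left_mem le_rfl hge hc) (fun h => hne (Prod.mk.inj h).2.symm)
      exact lt_irrefl _ (YoungDiagram.mem_iff_lt_rowLen.1 this)
    subst hj
    have hadd : IsAddable μ.1 i := by
      rintro a rfl
      exact YoungDiagram.mem_iff_lt_rowLen.1 (mem_of_mem_of_not_mem hle hcard hc hc'
        (ν.1.up_left_mem (Nat.le_succ a) le_rfl hc) (fun h => by simp at h))
    refine ⟨i, Finset.mem_filter.2 ⟨?_, hadd⟩, ?_⟩
    · have := mem_range_of_mem_cells (μ := ν.1) hc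
      rw [ν.2, Finset.mem_product] at this
      exact this.1
    · apply Subtype.ext
      refine eq_of_le_of_card_eq ?_ (by rw [card_addCell, hcard])
      apply YoungDiagram.cells_subset_iff.1
      exact Finset.insert_subset hc (YoungDiagram.cells_subset_iff.2 hle)

open Classical in
theorem card_down {n : ℕ} (μ : Shape (n + 1)) :
    (Finset.univ.filter fun ρ : Shape n => ρ.1 ≤ μ.1).card =
      ((Finset.range (n + 1)).filter fun i => IsRemovable μ.1 i).card := by
  symm
  refine Finset.card_bij (fun i hi => ⟨removeCell μ.1 i (Finset.mem_filter.1 hi).2, by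
    have := card_removeCell μ.1 i (Finset.mem_filter.1 hi).2
    have := μ.2
    omega⟩) ?_ ?_ ?_
  · intro i hi
    simpa using removeCell_le μ.1 i (Finset.mem_filter.1 hi).2
  · intro i hi j hj hij
    have h1 : (i, μ.1.rowLen i - 1) ∉ (removeCell μ.1 j (Finset.mem_filter.1 hj).2).cells := by
      rw [← congrArg (fun ν : Shape n => ν.1.cells) hij]
      exact Finset.notMem_erase _ _
    by_contra hne
    exact h1 (Finset.mem_erase.2 ⟨fun h => hne (Prod.mk.inj h).1,
      removeCell_mem μ.1 i (Finset.mem_filter.1 hi).2⟩)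
  · intro ρ hρ
    have hle : ρ.1 ≤ μ.1 := by simpa using hρ
    have hcard : μ.1.card = ρ.1.card + 1 := by rw [μ.2, ρ.2]
    obtain ⟨⟨i, j⟩, hc, hc'⟩ := exists_mem_not_mem hcard
    have hj0 : j < μ.1.rowLen i := YoungDiagram.mem_iff_lt_rowLen.1 hc
    have hj : j = μ.1.rowLen i - 1 := by
      by_contra hne
      have h2 : (i, j + 1) ∈ ρ.1 := mem_of_mem_of_not_mem hle hcard hc hc'
        (YoungDiagram.mem_iff_lt_rowLen.2 (by omega)) (fun h => by simp at h)
      exact hc' (ρ.1.up_left_mem le_rfl (Nat.le_succ j) h2)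
    have hrem : IsRemovable μ.1 i := by
      by_contra hnot
      have h1 : (i + 1, j) ∈ ρ.1 := mem_of_mem_of_not_mem hle hcard hc hc'
        (YoungDiagram.mem_iff_lt_rowLen.2 (hj0.trans_le (not_lt.1 hnot))) (fun h => by simp at h)
      exact hc' (ρ.1.up_left_mem (Nat.le_succ i) le_rfl h1)
    subst hj
    refine ⟨i, Finset.mem_filter.2 ⟨?_, hrem⟩, ?_⟩
    · have := mem_range_of_mem_cells (μ := μ.1) hc
      rw [μ.2, Finset.mem_product] at this
      exact this.1
    · apply Subtype.ext
      symm
      refine eq_of_le_of_card_eq ?_ ?_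
      · apply YoungDiagram.cells_subset_iff.1
        exact Finset.subset_erase.2 ⟨YoungDiagram.cells_subset_iff.2 hle, hc'⟩
      · have := card_removeCell μ.1 i hrem
        change (removeCell μ.1 i hrem).card = _
        omega

-- Row `i + 1` can be lengthened exactly when row `i` can be shortened, and row `0` can always be
-- lengthened.
open Classical in
theorem card_up_eq_card_down_add_one {n : ℕ} (μ : Shape (n + 1)) :
    (Finset.univ.filter fun ν : Shape (n + 2) => μ.1 ≤ ν.1).card =
      (Finset.univ.filter fun ρ : Shape n => ρ.1 ≤ μ.1).card + 1 := by
  rw [card_up, card_down]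
  have h : ((Finset.range (n + 2)).filter fun i => IsAddable μ.1 i) =
      insert 0 (((Finset.range (n + 1)).filter fun i => IsRemovable μ.1 i).image Nat.succ) := by
    ext i
    simp only [Finset.mem_filter, Finset.mem_range, Finset.mem_insert, Finset.mem_image]
    rcases i with _ | i
    · simp [IsAddable]
    · simp only [IsAddable, IsRemovable]
      constructor
      · rintro ⟨h1, h2⟩
        exact Or.inr ⟨i, ⟨by omega, h2 i rfl⟩, rfl⟩
      · rintro (h | ⟨a, ⟨h1, h2⟩, h3⟩)
        · omega
        · obtain rfl : a = i := Nat.succ.inj h3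
          refine ⟨by omega, fun j hj => ?_⟩
          obtain rfl : j = a := Nat.succ.inj hj
          exact h2
  rw [h, Finset.card_insert_of_notMem (by simp),
    Finset.card_image_of_injective _ Nat.succ_injective]

-- The commutation relation `DU = UD + 1` of Young's lattice. For `μ ≠ κ` a common cover can only be
-- the union and a common lower neighbour only the intersection; their sizes add up to `2(n + 1)`,
-- so one exists exactly when the other does.
open Classical in
theorem card_up_both {n : ℕ} (μ κ : Shape (n + 1)) :
    (Finset.univ.filter fun ν : Shape (n + 2) => μ.1 ≤ ν.1 ∧ κ.1 ≤ ν.1).card =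
      (Finset.univ.filter fun ρ : Shape n => ρ.1 ≤ μ.1 ∧ ρ.1 ≤ κ.1).card +
        if μ = κ then 1 else 0 := by
  rcases eq_or_ne μ κ with rfl | hne
  · simpa using card_up_eq_card_down_add_one μ
  rw [if_neg hne, add_zero]
  simp only [← sup_le_iff, ← le_inf_iff]
  have hsum : (μ.1 ⊔ κ.1).card + (μ.1 ⊓ κ.1).card = 2 * (n + 1) := by
    have := Finset.card_union_add_card_inter μ.1.cells κ.1.cells
    have h1 := μ.2
    have h2 := κ.2
    simp only [YoungDiagram.card] at h1 h2 ⊢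
    rw [YoungDiagram.cells_sup, YoungDiagram.cells_inf]
    omega
  have hlt : n + 1 < (μ.1 ⊔ κ.1).card := by
    by_contra hle
    have h1 : (μ.1 ⊔ κ.1).card = n + 1 := by
      refine le_antisymm (not_lt.1 hle) ?_
      have h := Finset.card_le_card
        (YoungDiagram.cells_subset_iff.2 (le_sup_left : μ.1 ≤ μ.1 ⊔ κ.1))
      exact μ.2.symm.le.trans h
    have h2 := eq_of_le_of_card_eq (le_sup_left : μ.1 ≤ μ.1 ⊔ κ.1) (by rw [h1, μ.2])
    have h3 := eq_of_le_of_card_eq (le_sup_right : κ.1 ≤ μ.1 ⊔ κ.1) (by rw [h1, κ.2])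
    exact hne (Subtype.ext (h2.trans h3.symm))
  by_cases heq : (μ.1 ⊔ κ.1).card = n + 2
  · have h1 : (Finset.univ.filter fun ν : Shape (n + 2) => μ.1 ⊔ κ.1 ≤ ν.1) = {⟨_, heq⟩} := by
      ext ν
      simp only [Finset.mem_filter, Finset.mem_univ, true_and, Finset.mem_singleton]
      constructor
      · intro h
        exact Subtype.ext (eq_of_le_of_card_eq h (by rw [ν.2, heq])).symm
      · rintro rfl
        exact le_rfl
    have heq' : (μ.1 ⊓ κ.1).card = n := by omega
    have h2 : (Finset.univ.filter fun ρ : Shape n => ρ.1 ≤ μ.1 ⊓ κ.1) = {⟨_, heq'⟩} := by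
      ext ν
      simp only [Finset.mem_filter, Finset.mem_univ, true_and, Finset.mem_singleton]
      constructor
      · intro h
        exact Subtype.ext (eq_of_le_of_card_eq h (by rw [ν.2, heq']))
      · rintro rfl
        exact le_rfl
    rw [h1, h2]
    simp
  · rw [Finset.card_eq_zero.2, Finset.card_eq_zero.2]
    · rw [Finset.filter_eq_empty_iff]
      intro ρ _ h
      have := Finset.card_le_card (YoungDiagram.cells_subset_iff.2 h)
      have h2 := ρ.2
      simp only [YoungDiagram.card] at *
      omega
    · rw [Finset.filter_eq_empty_iff]
      intro ρ _ h
      have := Finset.card_le_card (YoungDiagram.cells_subset_iff.2 h)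
      have h2 := ρ.2
      simp only [YoungDiagram.card] at *
      omega

/-! ### Saturated chains in Young's lattice and the sum of their squared numbers -/

open Classical in
/-- The number of saturated chains from the empty diagram. -/
def numChains : (n : ℕ) → Shape n → ℕ
  | 0, _ => 1
  | n + 1, ν => ∑ μ : Shape n, if μ.1 ≤ ν.1 then numChains n μ else 0

instance instSubsingletonShapeZero : Subsingleton (Shape 0) := by
  refine ⟨fun μ ν => Subtype.ext (YoungDiagram.ext ?_)⟩
  rw [Finset.card_eq_zero.1 μ.2, Finset.card_eq_zero.1 ν.2]

/-- The empty diagram. -/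
instance instInhabitedShapeZero : Inhabited (Shape 0) := ⟨⟨⊥, rfl⟩⟩

open Classical in
theorem card_up_zero (μ : Shape 0) :
    (Finset.univ.filter fun ν : Shape 1 => μ.1 ≤ ν.1).card = 1 := by
  have h1 : IsAddable μ.1 0 := fun j hj => by omega
  rw [card_up]
  simp [Finset.filter_singleton, h1]

-- Induction with the commutation relation: the chain counts arise from the empty diagram by
-- iterating `U`, and `D` is moved past each `U` at the cost of one copy.
open Classical in
theorem sum_numChains_up (n : ℕ) (μ : Shape n) :
    (∑ ν : Shape (n + 1), if μ.1 ≤ ν.1 then numChains (n + 1) ν else 0) =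
      (n + 1) * numChains n μ := by
  induction n with
  | zero =>
    have h1 : ∀ ν : Shape 1, numChains 1 ν = 1 := by
      intro ν
      have hbot : (default : Shape 0).1 ≤ ν.1 := bot_le (a := ν.1)
      rw [numChains, Fintype.sum_subsingleton _ (default : Shape 0), if_pos hbot, numChains]
    simp only [h1]
    rw [← Finset.card_filter, card_up_zero, numChains]
  | succ n ih =>
    have h1 : (∑ ν : Shape (n + 2), if μ.1 ≤ ν.1 then numChains (n + 2) ν else 0) =
        ∑ κ : Shape (n + 1), numChains (n + 1) κ *
          (Finset.univ.filter fun ν : Shape (n + 2) => μ.1 ≤ ν.1 ∧ κ.1 ≤ ν.1).card := by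
      simp only [Finset.card_filter, Finset.mul_sum]
      rw [Finset.sum_comm]
      refine Finset.sum_congr rfl fun ν _ => ?_
      rw [numChains]
      split_ifs with h
      · simp [h]
      · simp [h]
    have h2 : ∑ κ : Shape (n + 1), numChains (n + 1) κ *
        (Finset.univ.filter fun ρ : Shape n => ρ.1 ≤ μ.1 ∧ ρ.1 ≤ κ.1).card =
        ∑ ρ : Shape n, if ρ.1 ≤ μ.1 then (n + 1) * numChains n ρ else 0 := by
      simp only [Finset.card_filter, Finset.mul_sum]
      rw [Finset.sum_comm]
      refine Finset.sum_congr rfl fun ρ _ => ?_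
      rw [← ih ρ]
      split_ifs with h
      · simp [h]
      · simp [h]
    have h3 : (∑ ρ : Shape n, if ρ.1 ≤ μ.1 then (n + 1) * numChains n ρ else 0) =
        (n + 1) * numChains (n + 1) μ := by
      rw [numChains, Finset.mul_sum]
      simp
    rw [h1]
    simp only [card_up_both, mul_add, Finset.sum_add_distrib]
    rw [h2, h3]
    simp
    ring

theorem sum_numChains_sq (n : ℕ) : ∑ μ : Shape n, numChains n μ ^ 2 = n.factorial := by
  classical
  induction n with
  | zero =>
    rw [Fintype.sum_subsingleton _ (default : Shape 0)]
    simp [numChains]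
  | succ n ih =>
    have h1 : ∀ ν : Shape (n + 1), numChains (n + 1) ν ^ 2 =
        ∑ μ : Shape n, numChains n μ * if μ.1 ≤ ν.1 then numChains (n + 1) ν else 0 := by
      intro ν
      rw [sq]
      nth_rewrite 1 [numChains]
      rw [Finset.sum_mul]
      refine Finset.sum_congr rfl fun μ _ => ?_
      split_ifs <;> simp
    simp only [h1]
    rw [Finset.sum_comm]
    simp only [← Finset.mul_sum, sum_numChains_up]
    rw [Nat.factorial_succ, ← ih, Finset.mul_sum]
    refine Finset.sum_congr rfl fun μ _ => ?_
    ring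

/-! ### Standard tableaux from chains -/

/-- Placing the largest entry in the cell of `ν` outside `μ`. -/
def extendFun {μ ν : YoungDiagram} {n : ℕ} (T : Tableau μ n) (c : ↥ν.cells) : Fin (n + 1) :=
  if h : c.1 ∈ μ.cells then (T ⟨c.1, h⟩).castSucc else Fin.last n

theorem extendFun_of_mem {μ ν : YoungDiagram} {n : ℕ} (T : Tableau μ n) {c : ↥ν.cells}
    (h : c.1 ∈ μ.cells) : extendFun T c = (T ⟨c.1, h⟩).castSucc := dif_pos h

theorem extendFun_of_not_mem {μ ν : YoungDiagram} {n : ℕ} (T : Tableau μ n) {c : ↥ν.cells}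
    (h : c.1 ∉ μ.cells) : extendFun T c = Fin.last n := dif_neg h

theorem extendFun_eq_last_iff {μ ν : YoungDiagram} {n : ℕ} (T : Tableau μ n) {c : ↥ν.cells} :
    extendFun T c = Fin.last n ↔ c.1 ∉ μ.cells := by
  refine ⟨fun h hc => ?_, extendFun_of_not_mem T⟩
  rw [extendFun_of_mem T hc] at h
  exact (Fin.castSucc_lt_last _).ne h

theorem extendFun_injective {n : ℕ} {μ : Shape n} {ν : Shape (n + 1)} (hle : μ.1 ≤ ν.1)
    (T : Tableau μ.1 n) : Function.Injective (extendFun (ν := ν.1) T) := by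
  intro c d hcd
  by_cases hc : c.1 ∈ μ.1.cells
  · have hd : d.1 ∈ μ.1.cells := by
      by_contra hd
      rw [extendFun_of_mem T hc, extendFun_of_not_mem T hd] at hcd
      exact (Fin.castSucc_lt_last _).ne hcd
    rw [extendFun_of_mem T hc, extendFun_of_mem T hd] at hcd
    have := T.injective (Fin.castSucc_injective _ hcd)
    exact Subtype.ext (by simpa using this)
  · have hd : d.1 ∉ μ.1.cells := by
      rw [← extendFun_eq_last_iff T, ← hcd, extendFun_eq_last_iff T]
      exact hc
    by_contra hne
    exact hd (mem_of_mem_of_not_mem hle (by rw [μ.2, ν.2]) c.2 hc d.2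
      (fun h => hne (Subtype.ext h.symm)))

/-- The extension of a tableau by one cell containing the largest entry. -/
def extendTab {n : ℕ} {μ : Shape n} {ν : Shape (n + 1)} (hle : μ.1 ≤ ν.1)
    (T : Tableau μ.1 n) : Tableau ν.1 (n + 1) :=
  Equiv.ofBijective (extendFun T)
    ((Fintype.bijective_iff_injective_and_card _).2
      ⟨extendFun_injective hle T, by simpa using ν.2⟩)

theorem extendFun_lt {n : ℕ} {μ : Shape n} {ν : Shape (n + 1)} (hle : μ.1 ≤ ν.1)
    {T : Tableau μ.1 n} {c d : ↥ν.1.cells} (hcd : c.1 ≤ d.1) (hne : c ≠ d)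
    (h : ∀ (hc : c.1 ∈ μ.1.cells) (hd : d.1 ∈ μ.1.cells), T ⟨c.1, hc⟩ < T ⟨d.1, hd⟩) :
    extendFun T c < extendFun T d := by
  by_cases hd : d.1 ∈ μ.1.cells
  · have hc : c.1 ∈ μ.1.cells := μ.1.isLowerSet hcd hd
    rw [extendFun_of_mem T hc, extendFun_of_mem T hd]
    exact h hc hd
  · have hc : c.1 ∈ μ.1.cells := mem_of_mem_of_not_mem hle (by rw [μ.2, ν.2]) d.2 hd c.2
      (fun h => hne (Subtype.ext h))
    rw [extendFun_of_mem T hc, extendFun_of_not_mem T hd]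
    exact Fin.castSucc_lt_last _

theorem extendTab_isStandard {n : ℕ} {μ : Shape n} {ν : Shape (n + 1)} (hle : μ.1 ≤ ν.1)
    {T : Tableau μ.1 n} (hT : T.IsStandard) : (extendTab hle T).IsStandard := by
  constructor
  · intro c d h1 h2
    exact extendFun_lt hle ⟨h1.le, h2.le⟩ (fun h => by simp [h] at h2)
      (fun hc hd => hT.1 ⟨c.1, hc⟩ ⟨d.1, hd⟩ h1 h2)
  · intro c d h1 h2
    exact extendFun_lt hle ⟨h2.le, h1.le⟩ (fun h => by simp [h] at h2)
      (fun hc hd => hT.2 ⟨c.1, hc⟩ ⟨d.1, hd⟩ h1 h2)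

/-- The last step of a chain gives the cell of the largest entry. Only this inequality is needed,
since independence of the leading parts bounds the number of pairs from above. -/
theorem numChains_le_card_SYT (n : ℕ) (μ : Shape n) :
    numChains n μ ≤ Fintype.card (SYT μ.1 n) := by
  classical
  induction n with
  | zero =>
    rw [numChains, Nat.succ_le_iff, Fintype.card_pos_iff]
    refine ⟨⟨baseTab μ, ?_, ?_⟩⟩
    · intro c
      exact (baseTab μ c).elim0
    · intro c
      exact (baseTab μ c).elim0
  | succ n ih =>
    rw [numChains, ← Finset.sum_filter]
    have h1 : Fintype.card (Σ κ : {κ : Shape n // κ.1 ≤ μ.1}, SYT κ.1.1 n) ≤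
        Fintype.card (SYT μ.1 (n + 1)) := by
      refine Fintype.card_le_of_injective
        (fun p => ⟨extendTab p.1.2 p.2.1, extendTab_isStandard p.1.2 p.2.2⟩) ?_
      rintro ⟨⟨κ, hκ⟩, T, hT⟩ ⟨⟨κ', hκ'⟩, T', hT'⟩ h
      have hfun : ∀ c : ↥μ.1.cells, extendFun T c = extendFun T' c := by
        intro c
        have := congrArg (fun U : SYT μ.1 (n + 1) => U.1 c) h
        exact this
      have hκκ : κ = κ' := by
        apply Subtype.ext
        apply YoungDiagram.ext
        ext c
        by_cases hc : c ∈ μ.1.cells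
        · have h2 := extendFun_eq_last_iff T (c := ⟨c, hc⟩)
          rw [hfun ⟨c, hc⟩, extendFun_eq_last_iff] at h2
          exact (not_iff_not.1 h2).symm
        · exact ⟨fun h => absurd (hκ h) hc, fun h => absurd (hκ' h) hc⟩
      subst hκκ
      have hTT : T = T' := by
        refine Equiv.ext fun c => ?_
        have h2 := hfun ⟨c.1, hκ c.2⟩
        rw [extendFun_of_mem T (c := ⟨c.1, hκ c.2⟩) c.2,
          extendFun_of_mem T' (c := ⟨c.1, hκ c.2⟩) c.2] at h2
        exact Fin.castSucc_injective _ h2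
      subst hTT
      rfl
    refine le_trans ?_ h1
    rw [Fintype.card_sigma, ← Finset.sum_subtype_eq_sum_filter, Finset.subtype_univ]
    exact Finset.sum_le_sum fun κ _ => ih κ.1

theorem factorial_le_card_tabPair (n : ℕ) : n.factorial ≤ Fintype.card (TabPair n) := by
  rw [← sum_numChains_sq, Fintype.card_sigma]
  refine Finset.sum_le_sum fun μ _ => ?_
  rw [Fintype.card_prod, sq]
  exact Nat.mul_le_mul (numChains_le_card_SYT n μ) (numChains_le_card_SYT n μ)

/-! ### The basis of leading parts -/

theorem finrank_groupAlg (n : ℕ) : Module.finrank ℚ (GroupAlg n) = n.factorial := by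
  rw [Module.finrank_eq_card_basis (MonoidAlgebra.basis (Equiv.Perm (Fin n)) ℚ),
    Fintype.card_perm, Fintype.card_fin]

instance instFiniteGroupAlg (n : ℕ) : Module.Finite ℚ (GroupAlg n) :=
  Module.Finite.of_basis (MonoidAlgebra.basis (Equiv.Perm (Fin n)) ℚ)

theorem card_tabPair (n : ℕ) : Fintype.card (TabPair n) = n.factorial := by
  refine le_antisymm ?_ (factorial_le_card_tabPair n)
  rw [← finrank_groupAlg]
  exact (linearIndependent_leading n).fintype_card_le_finrank

/-- The basis of the group algebra formed by the leading parts. -/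
def leadingBasis (n : ℕ) : Module.Basis (TabPair n) ℚ (GroupAlg n) :=
  basisOfLinearIndependentOfCardEqFinrank' _ (linearIndependent_leading n)
    (by rw [card_tabPair, finrank_groupAlg])

theorem leadingBasis_apply {n : ℕ} (p : TabPair n) : leadingBasis n p = leading p := by
  simp [leadingBasis]

/-- The standard tableaux generate the left ideal of a Young idempotent. -/
theorem mul_youngIdempotent_mem_span {n : ℕ} (μ : Shape n) (S₀ : SYT μ.1 n) (x : GroupAlg n) :
    x * (baseTab μ).youngIdempotent ∈ Submodule.span ℚ (Set.range fun T : SYT μ.1 n =>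
      perm ((baseTab μ).symm.trans T.1) * (baseTab μ).youngIdempotent) := by
  classical
  -- Right multiplication by the factor of `S₀` gives an element that has two expansions: the
  -- obvious one, concentrated at `(μ, S₀)`, and the one in the leading basis. Independence across
  -- shapes allows them to be compared component by component.
  set c := (leadingBasis n).repr (x * (baseTab μ).youngIdempotent *
    (baseTab μ).rightFactor S₀.1) with hc
  let a : (Σ ν : Shape n, SYT ν.1 n) → GroupAlg n := fun q => if q = ⟨μ, S₀⟩ then x else 0
  have hsum1 : ∑ ν : Shape n, ∑ S : SYT ν.1 n, a ⟨ν, S⟩ * (baseTab ν).youngIdempotent *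
      (baseTab ν).rightFactor S.1 =
      x * (baseTab μ).youngIdempotent * (baseTab μ).rightFactor S₀.1 := by
    rw [← Fintype.sum_sigma (fun q : (Σ ν : Shape n, SYT ν.1 n) =>
      a q * (baseTab q.1).youngIdempotent * (baseTab q.1).rightFactor q.2.1),
      Finset.sum_eq_single ⟨μ, S₀⟩]
    · simp [a]
    · intro q _ hq
      simp [a, hq]
    · simp
  have hsum2 : ∑ ν : Shape n, ∑ S : SYT ν.1 n, (∑ T, c ⟨ν, S, T⟩ •
      (perm ((baseTab ν).symm.trans T.1) * (baseTab ν).youngIdempotent)) *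
      (baseTab ν).rightFactor S.1 =
      x * (baseTab μ).youngIdempotent * (baseTab μ).rightFactor S₀.1 := by
    rw [← (leadingBasis n).sum_repr (x * _ * _), ← hc, Fintype.sum_sigma]
    refine Finset.sum_congr rfl fun ν _ => ?_
    rw [Fintype.sum_prod_type]
    refine Finset.sum_congr rfl fun S _ => ?_
    rw [Finset.sum_mul]
    refine Finset.sum_congr rfl fun T _ => ?_
    rw [leadingBasis_apply, leading, smul_mul_assoc]
  have h := eq_zero_of_sum_mul_rightFactor (n := n)
    (fun ν S => a ⟨ν, S⟩ * (baseTab ν).youngIdempotent -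
      ∑ T, c ⟨ν, S, T⟩ • (perm ((baseTab ν).symm.trans T.1) *
        (baseTab ν).youngIdempotent)) ?_ ?_ μ S₀
  · have h1 : a ⟨μ, S₀⟩ = x := by simp [a]
    rw [h1, sub_eq_zero] at h
    rw [h]
    exact Submodule.sum_mem _ fun T _ => Submodule.smul_mem _ _ (Submodule.subset_span ⟨T, rfl⟩)
  · intro ν S
    refine ⟨a ⟨ν, S⟩ - ∑ T, c ⟨ν, S, T⟩ • perm ((baseTab ν).symm.trans T.1), ?_⟩
    rw [sub_mul, Finset.sum_mul]
    congr 1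
    exact Finset.sum_congr rfl fun T _ => (smul_mul_assoc _ _ _).symm
  · simp only [sub_mul, Finset.sum_sub_distrib]
    rw [hsum1, hsum2, sub_self]

/-! ### Descents and invariants under right multiplication -/

namespace Tableau

variable {μ : YoungDiagram} {n : ℕ}

/-- The entry `m` is a descent: it lies in a lower row than the next entry. -/
def IsDescent (S : Tableau μ n) (m : ℕ) : Prop :=
  ∃ h : m + 1 < n, S.rowOf ⟨m, Nat.lt_of_succ_lt h⟩ < S.rowOf ⟨m + 1, h⟩

theorem IsStandard.le_of_le {S : Tableau μ n} (hS : S.IsStandard) {i j : Fin n}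
    (hr : S.rowOf i ≤ S.rowOf j) (hc : S.colOf i ≤ S.colOf j) : i ≤ j := by
  have hmem : (S.rowOf i, S.colOf j) ∈ μ.cells := μ.up_left_mem hr le_rfl (S.mem_cells_of j)
  have h1 : i ≤ S ⟨_, hmem⟩ := by
    rcases hc.eq_or_lt with h | h
    · refine (S.eq_of_rowOf_colOf ?_ ?_).le
      · rw [rowOf_apply]
      · rw [colOf_apply, h]
    · refine (hS.lt_of_rowOf_eq ?_ ?_).le
      · rw [rowOf_apply]
      · rw [colOf_apply]
        exact h
  have h2 : S ⟨_, hmem⟩ ≤ j := by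
    rcases hr.eq_or_lt with h | h
    · refine (S.eq_of_rowOf_colOf ?_ ?_).le
      · rw [rowOf_apply]
        exact h
      · rw [colOf_apply]
    · refine (hS.lt_of_colOf_eq ?_ ?_).le
      · rw [colOf_apply]
      · rw [rowOf_apply]
        exact h
  exact h1.trans h2

/-- If `m + 1` were both strictly higher and strictly to the right of `m`, the cell in the row of
`m` and the column of `m + 1` would hold an entry strictly between them. Being weakly lower and
weakly to the left is excluded by monotonicity. -/
theorem IsStandard.rowOf_lt_iff {S : Tableau μ n} (hS : S.IsStandard) {m : ℕ} (h : m + 1 < n) :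
    S.rowOf ⟨m, Nat.lt_of_succ_lt h⟩ < S.rowOf ⟨m + 1, h⟩ ↔
      ¬ S.colOf ⟨m, Nat.lt_of_succ_lt h⟩ < S.colOf ⟨m + 1, h⟩ := by
  set i : Fin n := ⟨m, Nat.lt_of_succ_lt h⟩
  set j : Fin n := ⟨m + 1, h⟩
  constructor
  · intro hr hc
    have hmem : (S.rowOf i, S.colOf j) ∈ μ.cells := μ.up_left_mem hr.le le_rfl (S.mem_cells_of j)
    have h1 : i < S ⟨_, hmem⟩ := by
      refine hS.lt_of_rowOf_eq ?_ ?_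
      · rw [rowOf_apply]
      · rw [colOf_apply]
        exact hc
    have h2 : S ⟨_, hmem⟩ < j := by
      refine hS.lt_of_colOf_eq ?_ ?_
      · rw [colOf_apply]
      · rw [rowOf_apply]
        exact hr
    rw [Fin.lt_def] at h1 h2
    simp only [i, j] at h1 h2
    omega
  · intro hc
    by_contra hr
    have := hS.le_of_le (not_lt.1 hr) (not_lt.1 hc)
    rw [Fin.le_def] at this
    simp only [i, j] at this
    omega

/-- The cells of the transposed diagram. -/
def transposeCells (μ : YoungDiagram) : ↥μ.transpose.cells ≃ ↥μ.cells where
  toFun c := ⟨c.1.swap, YoungDiagram.mem_transpose.1 c.2⟩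
  invFun c := ⟨c.1.swap, YoungDiagram.mem_transpose.2 (by simp)⟩
  left_inv c := by simp
  right_inv c := by simp

/-- The transposed tableau. -/
def transpose (S : Tableau μ n) : Tableau μ.transpose n := (transposeCells μ).trans S

theorem rowOf_transpose (S : Tableau μ n) : S.transpose.rowOf = S.colOf := rfl

theorem IsStandard.transpose {S : Tableau μ n} (hS : S.IsStandard) : S.transpose.IsStandard :=
  ⟨fun c d h1 h2 => hS.2 (transposeCells μ c) (transposeCells μ d) h1 h2,
    fun c d h1 h2 => hS.1 (transposeCells μ c) (transposeCells μ d) h1 h2⟩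

theorem transpose_injective : Function.Injective (transpose : Tableau μ n → _) := by
  intro S S' h
  refine Equiv.ext fun c => ?_
  have := congrArg (fun U : Tableau μ.transpose n => U ((transposeCells μ).symm c)) h
  simpa [transpose] using this

theorem IsStandard.isDescent_transpose_iff {S : Tableau μ n} (hS : S.IsStandard) {m : ℕ}
    (h : m + 1 < n) : S.transpose.IsDescent m ↔ ¬ S.IsDescent m := by
  have h1 := hS.rowOf_lt_iff h
  simp only [IsDescent, rowOf_transpose, h, exists_true_left]
  rw [h1, not_not]

theorem IsStandard.cw_eq_of_not_isDescent {S : Tableau μ n} (hS : S.IsStandard) {m : ℕ}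
    (h : m + 1 < n) (hd : ¬ S.IsDescent m) :
    cw S ⟨m, Nat.lt_of_succ_lt h⟩ = cw S ⟨m + 1, h⟩ := by
  have h1 : ¬ S.rowOf ⟨m, Nat.lt_of_succ_lt h⟩ < S.rowOf ⟨m + 1, h⟩ := fun h2 => hd ⟨h, h2⟩
  rw [hS.cw_succ h, if_neg h1, add_zero]

end Tableau

theorem card_transpose (μ : YoungDiagram) : μ.transpose.card = μ.card := by
  simpa using Fintype.card_congr (Tableau.transposeCells μ)

/-- Transposing both tableaux of a pair. -/
def TabPair.transpose {n : ℕ} (p : TabPair n) : TabPair n :=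
  ⟨⟨p.1.1.transpose, (card_transpose _).trans p.1.2⟩, ⟨p.2.1.1.transpose, p.2.1.2.transpose⟩,
    ⟨p.2.2.1.transpose, p.2.2.2.transpose⟩⟩

theorem TabPair.transpose_injective (n : ℕ) :
    Function.Injective (TabPair.transpose : TabPair n → TabPair n) := by
  rintro ⟨⟨μ, hμ⟩, ⟨S, hS⟩, ⟨T, hT⟩⟩ ⟨⟨ν, hν⟩, ⟨S', hS'⟩, ⟨T', hT'⟩⟩ h
  have h1 : μ.transpose = ν.transpose := congrArg (fun q : TabPair n => q.1.1) h
  obtain rfl : μ = ν := YoungDiagram.transpose_eq_iff.1 h1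
  have h2 := eq_of_heq (Sigma.mk.inj h).2
  obtain ⟨h3, h4⟩ := Prod.mk.inj h2
  obtain rfl := Tableau.transpose_injective (congrArg Subtype.val h3)
  obtain rfl := Tableau.transpose_injective (congrArg Subtype.val h4)
  rfl

-- Transposing the tableaux exchanges those with a descent at `m` and those without.
open Classical in
theorem two_mul_card_not_isDescent {n m : ℕ} (h : m + 1 < n) :
    2 * (Finset.univ.filter fun p : TabPair n => ¬ p.2.1.1.IsDescent m).card = n.factorial := by
  have h1 : (Finset.univ.filter fun p : TabPair n => ¬ p.2.1.1.IsDescent m).card ≤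
      (Finset.univ.filter fun p : TabPair n => p.2.1.1.IsDescent m).card := by
    refine Finset.card_le_card_of_injOn TabPair.transpose ?_ (TabPair.transpose_injective n).injOn
    intro p hp
    exact Finset.mem_coe.2 (Finset.mem_filter.2 ⟨Finset.mem_univ _,
      (p.2.1.2.isDescent_transpose_iff h).2 (Finset.mem_filter.1 hp).2⟩)
  have h2 : (Finset.univ.filter fun p : TabPair n => p.2.1.1.IsDescent m).card ≤
      (Finset.univ.filter fun p : TabPair n => ¬ p.2.1.1.IsDescent m).card := by
    refine Finset.card_le_card_of_injOn TabPair.transpose ?_ (TabPair.transpose_injective n).injOn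
    intro p hp
    have hp' : p.2.1.1.IsDescent m := by simpa using hp
    have : ¬ p.2.1.1.transpose.IsDescent m := by
      rw [p.2.1.2.isDescent_transpose_iff h, not_not]
      exact hp'
    exact Finset.mem_coe.2 (Finset.mem_filter.2 ⟨Finset.mem_univ _, this⟩)
  have h3 := Finset.card_filter_add_card_filter_not (s := (Finset.univ : Finset (TabPair n)))
    (fun p : TabPair n => p.2.1.1.IsDescent m)
  rw [Finset.card_univ, card_tabPair] at h3
  omega

/-! ### Right invariants and descents -/

/-- The elements of the group algebra invariant under right multiplication by `s`. -/
def rightInv {n : ℕ} (s : Equiv.Perm (Fin n)) : Submodule ℚ (GroupAlg n) :=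
  LinearMap.ker (LinearMap.mulRight ℚ (perm s) - LinearMap.id)

theorem mem_rightInv {n : ℕ} {s : Equiv.Perm (Fin n)} {x : GroupAlg n} :
    x ∈ rightInv s ↔ x * perm s = x := by
  simp [rightInv, sub_eq_zero]

/-- Right multiplication by a transposition exchanges even and odd permutations, so an invariant
element is determined by its coefficients at the even ones. -/
theorem two_mul_finrank_rightInv_le {n : ℕ} {i j : Fin n} (hij : i ≠ j) :
    2 * Module.finrank ℚ (rightInv (Equiv.swap i j)) ≤ n.factorial := by
  have : Nontrivial (Fin n) := ⟨⟨i, j, hij⟩⟩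
  let φ : rightInv (Equiv.swap i j) →ₗ[ℚ] (alternatingGroup (Fin n) → ℚ) :=
    LinearMap.pi fun g => (MonoidAlgebra.basis (Equiv.Perm (Fin n)) ℚ).coord g.1 ∘ₗ
      (rightInv (Equiv.swap i j)).subtype
  have hφ : Function.Injective φ := by
    rw [injective_iff_map_eq_zero]
    rintro ⟨x, hx⟩ h0
    have heven : ∀ g ∈ alternatingGroup (Fin n), x.coeff g = 0 := fun g hg =>
      congrFun h0 ⟨g, hg⟩
    apply Subtype.ext
    change x = 0
    ext g
    change x.coeff g = 0
    by_cases hg : g ∈ alternatingGroup (Fin n)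
    · exact heven g hg
    · rw [mem_rightInv] at hx
      rw [← hx, MonoidAlgebra.coeff_mul_single_apply, mul_one]
      apply heven
      rw [Equiv.Perm.mem_alternatingGroup] at hg ⊢
      rw [Equiv.swap_inv, Equiv.Perm.sign_mul, Equiv.Perm.sign_swap hij,
        (Int.units_eq_one_or _).resolve_left hg]
      rfl
  have h1 := LinearMap.finrank_le_finrank_of_injective hφ
  rw [Module.finrank_fintype_fun_eq_card] at h1
  have h2 := two_mul_card_alternatingGroup (α := Fin n)
  rw [Fintype.card_perm, Fintype.card_fin] at h2
  omega

theorem leading_mul_perm {n : ℕ} (p : TabPair n) {s : Equiv.Perm (Fin n)}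
    (hs : s ∈ fiberPerms (cw p.2.1.1)) : leading p * perm s = leading p := by
  rw [leading, Tableau.rightFactor, mul_assoc, mul_assoc (perm _) (fiberSum _),
    fiberSum_mul_perm hs]

/-- A non-descent at `m` gives `m` and `m + 1` the same label, hence invariance of the leading part.
Such leading parts number `n!/2`, which is at least the dimension of the invariants. -/
theorem rightInv_eq_span {n m : ℕ} (h : m + 1 < n) :
    rightInv (Equiv.swap (⟨m, Nat.lt_of_succ_lt h⟩ : Fin n) ⟨m + 1, h⟩) =
      Submodule.span ℚ (leadingBasis n '' {p | ¬ p.2.1.1.IsDescent m}) := by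
  classical
  symm
  apply Submodule.eq_of_le_of_finrank_le
  · rw [Submodule.span_le]
    rintro _ ⟨p, hp, rfl⟩
    rw [leadingBasis_apply, SetLike.mem_coe, mem_rightInv]
    apply leading_mul_perm
    exact swap_mem_fiberPerms (p.2.1.2.cw_eq_of_not_isDescent h hp)
  · have h1 := two_mul_finrank_rightInv_le (n := n) (i := ⟨m, Nat.lt_of_succ_lt h⟩)
      (j := ⟨m + 1, h⟩) (by simp)
    have h2 := two_mul_card_not_isDescent h
    have h3 : Module.finrank ℚ (Submodule.span ℚ
        (leadingBasis n '' {p | ¬ p.2.1.1.IsDescent m})) =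
        (Finset.univ.filter fun p : TabPair n => ¬ p.2.1.1.IsDescent m).card := by
      have hli := ((leadingBasis n).linearIndependent.comp
        (Subtype.val : {p : TabPair n // ¬ p.2.1.1.IsDescent m} → TabPair n)
        Subtype.val_injective)
      have h4 := finrank_span_eq_card hli
      rw [Fintype.card_subtype] at h4
      rw [← h4]
      have h5 : Set.range (Subtype.val : {p : TabPair n // ¬ p.2.1.1.IsDescent m} → TabPair n) =
          {p | ¬ p.2.1.1.IsDescent m} := Subtype.range_val
      rw [Set.range_comp, h5]
    omega

/-- Elements invariant under the stabilizer of a weight are combinations of the leading parts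
whose descents are jumps of that weight. -/
theorem mul_fiberSum_mem_span {n : ℕ} (f : Fin n → ℕ) (x : GroupAlg n) :
    x * fiberSum f ∈ Submodule.span ℚ (leading '' {p : TabPair n | ∀ m (h : m + 1 < n),
      f ⟨m, Nat.lt_of_succ_lt h⟩ = f ⟨m + 1, h⟩ → ¬ p.2.1.1.IsDescent m}) := by
  have himage : (leading '' {p : TabPair n | ∀ m (h : m + 1 < n),
      f ⟨m, Nat.lt_of_succ_lt h⟩ = f ⟨m + 1, h⟩ → ¬ p.2.1.1.IsDescent m}) =
      (leadingBasis n '' {p : TabPair n | ∀ m (h : m + 1 < n),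
      f ⟨m, Nat.lt_of_succ_lt h⟩ = f ⟨m + 1, h⟩ → ¬ p.2.1.1.IsDescent m}) :=
    Set.image_congr fun p _ => (leadingBasis_apply p).symm
  -- Invariance under each adjacent transposition restricts the support in one and the same basis,
  -- so the restrictions for all `m` can be imposed simultaneously.
  rw [himage, Module.Basis.mem_span_image]
  intro p hp m h hf
  have h1 : x * fiberSum f ∈
      rightInv (Equiv.swap (⟨m, Nat.lt_of_succ_lt h⟩ : Fin n) ⟨m + 1, h⟩) := by
    rw [mem_rightInv, mul_assoc, fiberSum_mul_perm (swap_mem_fiberPerms hf)]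
  rw [rightInv_eq_span h, Module.Basis.mem_span_image] at h1
  exact h1 hp

/-! ### Monomials and the action of the group algebra -/

/-- The monomial with exponents `γ`. -/
def mon {n : ℕ} (γ : Fin n → ℕ) : MvPolynomial (Fin n) ℚ := ∏ i, X i ^ γ i

/-- The action of the group algebra on polynomials. -/
abbrev act {n : ℕ} (x : GroupAlg n) :
    MvPolynomial (Fin n) ℚ →ₗ[ℚ] MvPolynomial (Fin n) ℚ := (polyRep n).asAlgebraHom x

/-- The indicator function of a finite set. -/
def ind {n : ℕ} (A : Finset (Fin n)) (i : Fin n) : ℕ := if i ∈ A then 1 else 0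

section Mon

variable {n : ℕ}

theorem mon_add (γ δ : Fin n → ℕ) : mon (γ + δ) = mon γ * mon δ := by
  simp [mon, pow_add, Finset.prod_mul_distrib]

theorem rename_mon (g : Equiv.Perm (Fin n)) (γ : Fin n → ℕ) :
    rename g (mon γ) = mon (γ ∘ ⇑g⁻¹) := by
  rw [mon, mon, map_prod, ← Equiv.prod_comp g fun i => X i ^ (γ ∘ ⇑g⁻¹) i]
  refine Finset.prod_congr rfl fun i _ => ?_
  rw [map_pow, rename_X, Function.comp_apply, inv_apply_self]

theorem mon_eq_monomial (γ : Fin n → ℕ) :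
    mon γ = monomial (Finsupp.equivFunOnFinite.symm γ) 1 := by
  rw [monomial_eq, map_one, one_mul, mon, Finsupp.prod_fintype]
  · rfl
  · simp

theorem act_perm (g : Equiv.Perm (Fin n)) (p : MvPolynomial (Fin n) ℚ) :
    act (perm g) p = rename g p := by
  rw [act, perm, Representation.asAlgebraHom_single_one, polyRep_apply]

theorem act_mul (x y : GroupAlg n) (p : MvPolynomial (Fin n) ℚ) :
    act (x * y) p = act x (act y p) := by
  simp [act]

theorem act_add (x y : GroupAlg n) (p : MvPolynomial (Fin n) ℚ) :
    act (x + y) p = act x p + act y p := by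
  simp [act]

theorem act_smul (c : ℚ) (x : GroupAlg n) (p : MvPolynomial (Fin n) ℚ) :
    act (c • x) p = c • act x p := by
  simp [act]

theorem act_sum {ι : Type*} (s : Finset ι) (x : ι → GroupAlg n) (p : MvPolynomial (Fin n) ℚ) :
    act (∑ i ∈ s, x i) p = ∑ i ∈ s, act (x i) p := by
  simp [act]

theorem act_mul_of_isSymmetric (x : GroupAlg n) {p : MvPolynomial (Fin n) ℚ}
    (hp : p.IsSymmetric) (q : MvPolynomial (Fin n) ℚ) : act x (p * q) = p * act x q := by
  induction x using MonoidAlgebra.induction_linear with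
  | zero => simp [act]
  | add x y hx hy => rw [act_add, act_add, hx, hy, mul_add]
  | single g r =>
    rw [single_eq_smul_perm, act_smul, act_smul, act_perm, act_perm, map_mul, hp g,
      mul_smul_comm]

theorem act_mem {W : Submodule ℚ (MvPolynomial (Fin n) ℚ)}
    (hW : ∀ (g : Equiv.Perm (Fin n)), ∀ p ∈ W, rename g p ∈ W) (x : GroupAlg n)
    {p : MvPolynomial (Fin n) ℚ} (hp : p ∈ W) : act x p ∈ W := by
  induction x using MonoidAlgebra.induction_linear with
  | zero => simp [act]
  | add x y hx hy =>
    rw [act_add]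
    exact W.add_mem hx hy
  | single g r =>
    rw [single_eq_smul_perm, act_smul, act_perm]
    exact W.smul_mem _ (hW g p hp)

theorem esymm_eq_sum_mon (d : ℕ) :
    esymm (Fin n) ℚ d = ∑ A ∈ Finset.powersetCard d Finset.univ, mon (ind A) := by
  rw [esymm]
  refine Finset.sum_congr rfl fun A _ => ?_
  rw [mon, ← Finset.prod_subset (Finset.subset_univ A)]
  · refine Finset.prod_congr rfl fun i hi => ?_
    simp [ind, hi]
  · intro i _ hi
    simp [ind, hi]

theorem act_fiberSum_mon (f : Fin n → ℕ) :
    act (fiberSum f) (mon f) = ((fiberPerms f).card : ℚ) • mon f := by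
  rw [fiberSum, act_sum, Finset.sum_congr rfl fun σ hσ => ?_, Finset.sum_const,
    Nat.cast_smul_eq_nsmul]
  rw [act_perm, rename_mon]
  congr 1
  funext i
  exact mem_fiberPerms.1 (inv_mem_fiberPerms hσ) i

/-! ### Dominance -/

/-- The last `d` indices. -/
def topSet (n d : ℕ) : Finset (Fin n) := Finset.univ.filter fun i => n - d ≤ i.1

theorem card_topSet {d : ℕ} (hd : d ≤ n) : (topSet n d).card = d := by
  have h : (topSet n d).map Fin.valEmbedding = Finset.Ico (n - d) n := by
    ext m
    simp only [topSet, Finset.mem_map, Finset.mem_filter, Finset.mem_univ, true_and,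
      Fin.valEmbedding_apply, Finset.mem_Ico]
    constructor
    · rintro ⟨i, hi, rfl⟩
      exact ⟨hi, i.2⟩
    · rintro ⟨h1, h2⟩
      exact ⟨⟨m, h2⟩, h1, rfl⟩
  rw [← Finset.card_map Fin.valEmbedding, h, Nat.card_Ico]
  omega

theorem sum_image_swap (f : Fin n → ℕ) {A : Finset (Fin n)} {a b : Fin n} (ha : a ∈ A)
    (hb : b ∉ A) : ∑ i ∈ A.image (Equiv.swap a b), f i + f a = ∑ i ∈ A, f i + f b := by
  rw [Finset.sum_image (Equiv.injective _).injOn, ← Finset.add_sum_erase _ _ ha,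
    ← Finset.add_sum_erase A f ha, Equiv.swap_apply_left]
  have : ∑ i ∈ A.erase a, f (Equiv.swap a b i) = ∑ i ∈ A.erase a, f i := by
    refine Finset.sum_congr rfl fun i hi => ?_
    rw [Equiv.swap_apply_of_ne_of_ne (Finset.ne_of_mem_erase hi)]
    rintro rfl
    exact hb (Finset.mem_of_mem_erase hi)
  rw [this]
  ring

/-- The largest sums of a monotone function are over the last indices, and up to a permutation
preserving the function only over these. -/
theorem sum_le_sum_topSet {f : Fin n → ℕ} (hf : Monotone f) {d : ℕ} (A : Finset (Fin n))
    (hA : A.card = d) :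
    ∑ i ∈ A, f i ≤ ∑ i ∈ topSet n d, f i ∧
      (∑ i ∈ A, f i = ∑ i ∈ topSet n d, f i →
        ∃ z ∈ fiberPerms f, A = (topSet n d).image z) := by
  have hd : d ≤ n := by
    rw [← hA]
    simpa using Finset.card_le_univ A
  -- Exchange of an element `a` outside the top set for a missing `b` of the top set. The sum does
  -- not decrease, and if it is already maximal then `f a = f b`, so the exchange preserves `f`.
  induction hk : (A \ topSet n d).card generalizing A with
  | zero =>
    have h1 : A ⊆ topSet n d := Finset.sdiff_eq_empty_iff_subset.1 (Finset.card_eq_zero.1 hk)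
    have h2 : A = topSet n d := Finset.eq_of_subset_of_card_le h1 (by rw [card_topSet hd, hA])
    rw [h2]
    exact ⟨le_rfl, fun _ => ⟨1, one_mem_fiberPerms, by simp⟩⟩
  | succ k ih =>
    obtain ⟨a, ha⟩ : (A \ topSet n d).Nonempty := by
      rw [← Finset.card_pos]
      omega
    obtain ⟨b, hb⟩ : (topSet n d \ A).Nonempty := by
      rw [← Finset.card_pos]
      have h1 := Finset.card_sdiff_add_card_inter A (topSet n d)
      have h2 := Finset.card_sdiff_add_card_inter (topSet n d) A
      rw [Finset.inter_comm, card_topSet hd] at h2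
      omega
    rw [Finset.mem_sdiff] at ha hb
    have hab : a ≤ b := by
      have h1 := ha.2
      have h2 := hb.1
      simp only [topSet, Finset.mem_filter, Finset.mem_univ, true_and] at h1 h2
      rw [Fin.le_def]
      omega
    have hfab := hf hab
    have hsum := sum_image_swap f ha.1 hb.2
    obtain ⟨ih1, ih2⟩ := ih (A.image (Equiv.swap a b))
      (by rw [Finset.card_image_of_injective _ (Equiv.injective _), hA]) (by
        have : A.image (Equiv.swap a b) \ topSet n d = (A \ topSet n d).erase a := by
          ext i
          simp only [Finset.mem_sdiff, Finset.mem_image, Finset.mem_erase]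
          constructor
          · rintro ⟨⟨j, hj, rfl⟩, h2⟩
            rcases eq_or_ne j a with rfl | hja
            · rw [Equiv.swap_apply_left] at h2
              exact absurd hb.1 h2
            · have hjb : j ≠ b := fun h => hb.2 (h ▸ hj)
              rw [Equiv.swap_apply_of_ne_of_ne hja hjb] at h2 ⊢
              exact ⟨hja, hj, h2⟩
          · rintro ⟨hia, hi, h2⟩
            have hib : i ≠ b := fun h => hb.2 (h ▸ hi)
            exact ⟨⟨i, hi, Equiv.swap_apply_of_ne_of_ne hia hib⟩, h2⟩
        rw [this, Finset.card_erase_of_mem (Finset.mem_sdiff.2 ha), hk]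
        rfl)
    refine ⟨by omega, fun heq => ?_⟩
    obtain ⟨z, hz, hAz⟩ := ih2 (by omega)
    have hfeq : f a = f b := by omega
    refine ⟨Equiv.swap a b * z, mul_mem_fiberPerms (swap_mem_fiberPerms hfeq) hz, ?_⟩
    have h3 := congrArg (Finset.image (Equiv.swap a b)) hAz
    rw [Finset.image_image, Finset.image_image] at h3
    have h4 : (⇑(Equiv.swap a b) ∘ ⇑(Equiv.swap a b)) = id := by
      funext i
      simp
    rw [h4, Finset.image_id] at h3
    rw [h3]
    rfl

/-! ### The order on monomials and multiplication by elementary symmetric polynomials -/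

/-- The sum of the squares of the exponents. -/
def sqNorm (γ : Fin n → ℕ) : ℕ := ∑ i, γ i ^ 2

/-- `δ` is dominated by `f`, for monotone `f`. -/
def Dominated (δ f : Fin n → ℕ) : Prop :=
  ∀ A : Finset (Fin n), ∑ i ∈ A, δ i ≤ ∑ i ∈ topSet n A.card, f i

/-- The span of the monomials strictly below `f`. -/
def lower (f : Fin n → ℕ) : Submodule ℚ (MvPolynomial (Fin n) ℚ) :=
  Submodule.span ℚ (mon '' {δ | Dominated δ f ∧ sqNorm δ < sqNorm f})

theorem sqNorm_comp (γ : Fin n → ℕ) (g : Equiv.Perm (Fin n)) : sqNorm (γ ∘ g) = sqNorm γ :=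
  Equiv.sum_comp g fun i => γ i ^ 2

theorem sqNorm_add_ind (γ : Fin n → ℕ) (A : Finset (Fin n)) :
    sqNorm (γ + ind A) = sqNorm γ + 2 * ∑ i ∈ A, γ i + A.card := by
  have h1 : ∀ i, (γ + ind A) i ^ 2 = γ i ^ 2 + 2 * (if i ∈ A then γ i else 0) +
      (if i ∈ A then 1 else 0) := by
    intro i
    rw [Pi.add_apply, ind]
    split_ifs <;> ring
  simp only [sqNorm, h1, Finset.sum_add_distrib, ← Finset.mul_sum, Finset.sum_ite_mem,
    Finset.univ_inter, Finset.sum_const, smul_eq_mul, mul_one]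

theorem rename_mem_lower (f : Fin n → ℕ) (g : Equiv.Perm (Fin n)) :
    ∀ p ∈ lower f, rename g p ∈ lower f := by
  intro p hp
  rw [lower] at hp
  induction hp using Submodule.span_induction with
  | mem p hp =>
    obtain ⟨δ, ⟨h1, h2⟩, rfl⟩ := hp
    rw [rename_mon]
    refine Submodule.subset_span ⟨_, ⟨fun A => ?_, ?_⟩, rfl⟩
    · have := h1 (A.image ⇑g⁻¹)
      rwa [Finset.sum_image g⁻¹.injective.injOn,
        Finset.card_image_of_injective _ g⁻¹.injective] at this
    · rwa [sqNorm_comp]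
  | zero => simp
  | add p q _ _ hp hq => rw [map_add]; exact add_mem hp hq
  | smul c p _ hp => rw [map_smul]; exact Submodule.smul_mem _ _ hp

theorem sum_ind (A B : Finset (Fin n)) : ∑ i ∈ B, ind A i = (A ∩ B).card := by
  simp only [ind, Finset.sum_boole, Nat.cast_id]
  congr 1
  ext i
  simp [and_comm]

theorem topSet_subset {d e : ℕ} (h : d ≤ e) : topSet n d ⊆ topSet n e := by
  intro i
  simp only [topSet, Finset.mem_filter, Finset.mem_univ, true_and]
  omega

/-- Two sets meet in at most the smaller of their cardinalities, and nested top sets attain this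
bound. -/
theorem Dominated.add_ind {δ f : Fin n → ℕ} (h : Dominated δ f) {d : ℕ} {A : Finset (Fin n)}
    (hA : A.card = d) : Dominated (δ + ind A) (f + ind (topSet n d)) := by
  have hd : d ≤ n := by
    rw [← hA]
    simpa using Finset.card_le_univ A
  intro B
  have hB : B.card ≤ n := by simpa using Finset.card_le_univ B
  simp only [Pi.add_apply, Finset.sum_add_distrib, sum_ind]
  refine add_le_add (h B) ?_
  rcases le_total d B.card with hle | hle
  · rw [Finset.inter_eq_left.2 (topSet_subset hle), card_topSet hd, ← hA]
    exact Finset.card_le_card Finset.inter_subset_left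
  · rw [Finset.inter_eq_right.2 (topSet_subset hle), card_topSet hB]
    exact Finset.card_le_card Finset.inter_subset_right

theorem dominated_refl {f : Fin n → ℕ} (hf : Monotone f) : Dominated f f :=
  fun A => (sum_le_sum_topSet hf A rfl).1

/-- Adding `ind A` increases the square norm of `δ` by `2 ∑_A δ + d`, and dominance bounds that sum
by its counterpart for `f`. This is why `lower` records dominance besides the square norm. -/
theorem esymm_mul_mem_lower {f : Fin n → ℕ} {d : ℕ} (hd : d ≤ n) {p : MvPolynomial (Fin n) ℚ}
    (hp : p ∈ lower f) : esymm (Fin n) ℚ d * p ∈ lower (f + ind (topSet n d)) := by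
  rw [lower] at hp
  induction hp using Submodule.span_induction with
  | mem p hp =>
    obtain ⟨δ, ⟨h1, h2⟩, rfl⟩ := hp
    rw [esymm_eq_sum_mon, Finset.sum_mul]
    refine Submodule.sum_mem _ fun A hA => ?_
    have hA' : A.card = d := (Finset.mem_powersetCard.1 hA).2
    rw [mul_comm, ← mon_add]
    refine Submodule.subset_span ⟨_, ⟨h1.add_ind hA', ?_⟩, rfl⟩
    rw [sqNorm_add_ind, sqNorm_add_ind, card_topSet hd, hA']
    have := h1 A
    rw [hA'] at this
    omega
  | zero => simp
  | add p q _ _ hp hq => rw [mul_add]; exact add_mem hp hq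
  | smul c p _ hp => rw [mul_smul_comm]; exact Submodule.smul_mem _ _ hp

theorem ind_image_comp (A : Finset (Fin n)) (z : Equiv.Perm (Fin n)) :
    ind (A.image z) = ind A ∘ ⇑z⁻¹ := by
  funext i
  simp only [ind, Function.comp_apply, Finset.mem_image]
  congr 1
  apply propext
  constructor
  · rintro ⟨a, ha, rfl⟩
    rwa [inv_apply_self]
  · intro h
    exact ⟨_, h, z.apply_symm_apply i⟩

/-- Among the terms `x^(f + ind A)` the square norm is maximal exactly for the images of the top set
under the stabilizer of `f`. The product is invariant under that stabilizer, and its symmetrizer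
makes all these maximal terms equal. -/
theorem exists_esymm_mul_mon {f : Fin n → ℕ} (hf : Monotone f) {d : ℕ} (hd : d ≤ n) :
    ∃ c : ℚ, c ≠ 0 ∧ esymm (Fin n) ℚ d * mon f -
      c • act (fiberSum f) (mon (f + ind (topSet n d))) ∈ lower (f + ind (topSet n d)) := by
  classical
  set f' := f + ind (topSet n d) with hf'
  set Y : ℚ := ((fiberPerms f).card : ℚ) with hY
  have hY0 : Y ≠ 0 := card_fiberPerms_ne_zero
  have hinv : act (fiberSum f) (esymm (Fin n) ℚ d * mon f) = Y • (esymm (Fin n) ℚ d * mon f) := by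
    rw [act_mul_of_isSymmetric _ (esymm_isSymmetric _ _ _), act_fiberSum_mon, mul_smul_comm]
  set O := (Finset.powersetCard d (Finset.univ : Finset (Fin n))).filter
    fun A => ∃ z ∈ fiberPerms f, A = (topSet n d).image z with hO
  have hO0 : (O.card : ℚ) ≠ 0 := by
    rw [Nat.cast_ne_zero, Finset.card_ne_zero]
    refine ⟨topSet n d, Finset.mem_filter.2 ⟨?_, 1, one_mem_fiberPerms, by simp⟩⟩
    exact Finset.mem_powersetCard.2 ⟨Finset.subset_univ _, card_topSet hd⟩
  have hexp : esymm (Fin n) ℚ d * mon f =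
      ∑ A ∈ Finset.powersetCard d Finset.univ, mon (f + ind A) := by
    rw [esymm_eq_sum_mon, Finset.sum_mul]
    exact Finset.sum_congr rfl fun A _ => by rw [mul_comm, mon_add]
  have horb : ∀ A ∈ O, act (fiberSum f) (mon (f + ind A)) = act (fiberSum f) (mon f') := by
    intro A hA
    obtain ⟨z, hz, rfl⟩ := (Finset.mem_filter.1 hA).2
    have h1 : mon (f + ind ((topSet n d).image z)) = act (perm z) (mon f') := by
      rw [act_perm, rename_mon, hf', ind_image_comp]
      congr 1
      funext i
      simp only [Pi.add_apply, Function.comp_apply]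
      rw [mem_fiberPerms.1 (inv_mem_fiberPerms hz) i]
    rw [h1, ← act_mul, fiberSum_mul_perm hz]
  have hlow : ∀ A ∈ (Finset.powersetCard d (Finset.univ : Finset (Fin n))).filter
      (fun A => ¬ ∃ z ∈ fiberPerms f, A = (topSet n d).image z), mon (f + ind A) ∈ lower f' := by
    intro A hA
    rw [Finset.mem_filter] at hA
    have hA' : A.card = d := (Finset.mem_powersetCard.1 hA.1).2
    refine Submodule.subset_span ⟨_, ⟨(dominated_refl hf).add_ind hA', ?_⟩, rfl⟩
    rw [hf', sqNorm_add_ind, sqNorm_add_ind, card_topSet hd, hA']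
    obtain ⟨h1, h2⟩ := sum_le_sum_topSet hf A hA'
    have h3 := lt_of_le_of_ne h1 fun h => hA.2 (h2 h)
    omega
  -- There are `O.card` maximal terms, and `Y⁻¹` normalizes the symmetrizer.
  refine ⟨Y⁻¹ * O.card, mul_ne_zero (inv_ne_zero hY0) hO0, ?_⟩
  have hfin : esymm (Fin n) ℚ d * mon f - (Y⁻¹ * O.card) • act (fiberSum f) (mon f') =
      Y⁻¹ • act (fiberSum f) (∑ A ∈ (Finset.powersetCard d (Finset.univ : Finset (Fin n))).filter
        (fun A => ¬ ∃ z ∈ fiberPerms f, A = (topSet n d).image z), mon (f + ind A)) := by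
    have h1 : esymm (Fin n) ℚ d * mon f = Y⁻¹ • act (fiberSum f) (esymm (Fin n) ℚ d * mon f) := by
      rw [hinv, smul_smul, inv_mul_cancel₀ hY0, one_smul]
    rw [h1, hexp, ← Finset.sum_filter_add_sum_filter_not (Finset.powersetCard d Finset.univ)
      (fun A => ∃ z ∈ fiberPerms f, A = (topSet n d).image z), map_add, smul_add, map_sum,
      Finset.sum_congr rfl horb, Finset.sum_const, ← Nat.cast_smul_eq_nsmul ℚ, smul_smul]
    simp [hO]
  rw [hfin]
  exact Submodule.smul_mem _ _ (act_mem (rename_mem_lower f') _ (Submodule.sum_mem _ hlow))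

end Mon

/-! ### Leading terms of the higher Specht polynomials times symmetric polynomials -/

section Leading

variable {n : ℕ}

theorem monotone_of_le_succ {f : Fin n → ℕ}
    (h : ∀ m (hm : m + 1 < n), f ⟨m, Nat.lt_of_succ_lt hm⟩ ≤ f ⟨m + 1, hm⟩) : Monotone f := by
  rintro ⟨a, ha⟩ ⟨b, hb⟩ hab
  change a ≤ b at hab
  induction b, hab using Nat.le_induction with
  | base => exact le_rfl
  | succ b hab ih => exact (ih _).trans (h b hb)

theorem ind_topSet_mono (d : ℕ) : Monotone (ind (topSet n d)) := by
  intro i j hij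
  simp only [ind, topSet, Finset.mem_filter, Finset.mem_univ, true_and]
  rw [Fin.le_def] at hij
  split_ifs <;> omega

/-- `E` multiplies `x^f` to a multiple of the symmetrization of `x^(f+b)` up to lower terms. -/
def RaisesBy (f : Fin n → ℕ) (E : MvPolynomial (Fin n) ℚ) (b : Fin n → ℕ) : Prop :=
  Monotone b ∧ ∃ c : ℚ, c ≠ 0 ∧ E * mon f - c • act (fiberSum f) (mon (f + b)) ∈ lower (f + b)

theorem raisesBy_one (f : Fin n → ℕ) : RaisesBy f 1 0 := by
  refine ⟨monotone_const, ((fiberPerms f).card : ℚ)⁻¹, inv_ne_zero card_fiberPerms_ne_zero, ?_⟩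
  rw [add_zero, act_fiberSum_mon, smul_smul, inv_mul_cancel₀ card_fiberPerms_ne_zero, one_smul,
    one_mul, sub_self]
  exact Submodule.zero_mem _

/-- For weakly increasing `f` and `b`, equal values of `f + b` force equal values of `f`; so the
stabilizer of `f + b` is contained in that of `f` and is absorbed. -/
theorem fiberSum_mul_fiberSum_add {f b : Fin n → ℕ} (hf : Monotone f) (hb : Monotone b) :
    fiberSum f * fiberSum (f + b) = ((fiberPerms (f + b)).card : ℚ) • fiberSum f := by
  conv_lhs => enter [2]; rw [fiberSum]
  rw [Finset.mul_sum, Finset.sum_congr rfl fun σ hσ => fiberSum_mul_perm ?_, Finset.sum_const,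
    Nat.cast_smul_eq_nsmul]
  rw [mem_fiberPerms] at hσ ⊢
  intro i
  have h1 := hσ i
  simp only [Pi.add_apply] at h1
  rcases le_total (σ i) i with h | h
  · have := hf h
    have := hb h
    omega
  · have := hf h
    have := hb h
    omega

theorem RaisesBy.esymm_mul {f b : Fin n → ℕ} (hf : Monotone f) {E : MvPolynomial (Fin n) ℚ}
    (h : RaisesBy f E b) {d : ℕ} (hd : d ≤ n) :
    RaisesBy f (esymm (Fin n) ℚ d * E) (b + ind (topSet n d)) := by
  obtain ⟨hb, c, hc, hlow⟩ := h
  refine ⟨hb.add (ind_topSet_mono d), ?_⟩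
  have hfb : Monotone (f + b) := hf.add hb
  obtain ⟨c', hc', hlow'⟩ := exists_esymm_mul_mon hfb hd
  have hmul := fiberSum_mul_fiberSum_add hf hb
  rw [← add_assoc]
  set lam := f + b
  set lam' := lam + ind (topSet n d)
  refine ⟨c * (c' * ((fiberPerms lam).card : ℚ)),
    mul_ne_zero hc (mul_ne_zero hc' card_fiberPerms_ne_zero), ?_⟩
  -- The old error stays lower after multiplication by `e_d`. The new error comes from `e_d * x^(f +
  -- b)` and stays lower under `fiberSum f`, which commutes with the symmetric `e_d`.
  have h1 := esymm_mul_mem_lower hd hlow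
  have h2 := Submodule.smul_mem _ c (act_mem (rename_mem_lower lam') (fiberSum f) hlow')
  have h3 := Submodule.add_mem _ h1 h2
  convert h3 using 1
  rw [map_sub, map_smul, ← act_mul, hmul, act_smul,
    act_mul_of_isSymmetric _ (esymm_isSymmetric _ _ _), mul_sub, mul_smul_comm, smul_sub, smul_smul,
    smul_smul]
  ring_nf

theorem RaisesBy.esymm_pow_mul {f b : Fin n → ℕ} (hf : Monotone f) {E : MvPolynomial (Fin n) ℚ}
    (h : RaisesBy f E b) {d : ℕ} (hd : d ≤ n) (a : ℕ) :
    RaisesBy f (esymm (Fin n) ℚ d ^ a * E) (b + a • ind (topSet n d)) := by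
  induction a with
  | zero => simpa using h
  | succ a ih =>
    rw [pow_succ', mul_assoc, succ_nsmul, ← add_assoc]
    exact ih.esymm_mul hf hd

/-- The product `e_1^{a_0} ⋯ e_n^{a_{n-1}}`. -/
def esymmProd (a : Fin n → ℕ) : MvPolynomial (Fin n) ℚ :=
  ∏ j : Fin n, esymm (Fin n) ℚ (j.1 + 1) ^ a j

/-- The exponents of the leading monomial of `esymmProd a`. -/
def esymmWeight (a : Fin n → ℕ) : Fin n → ℕ := ∑ j : Fin n, a j • ind (topSet n (j.1 + 1))

theorem raisesBy_esymmProd {f : Fin n → ℕ} (hf : Monotone f) (a : Fin n → ℕ) :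
    RaisesBy f (esymmProd a) (esymmWeight a) := by
  classical
  rw [esymmProd, esymmWeight]
  induction (Finset.univ : Finset (Fin n)) using Finset.induction_on with
  | empty => exact raisesBy_one f
  | insert j s hj ih =>
    rw [Finset.prod_insert hj, Finset.sum_insert hj, add_comm (a j • _)]
    exact ih.esymm_pow_mul hf j.2 (a j)

theorem esymmProd_isSymmetric (a : Fin n → ℕ) : (esymmProd a).IsSymmetric := by
  intro g
  rw [esymmProd, map_prod]
  refine Finset.prod_congr rfl fun j _ => ?_
  rw [map_pow, rename_esymm]

theorem esymmWeight_apply (a : Fin n → ℕ) (i : Fin n) :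
    esymmWeight a i = ∑ j : Fin n, if n - (j.1 + 1) ≤ i.1 then a j else 0 := by
  rw [esymmWeight, Finset.sum_apply]
  refine Finset.sum_congr rfl fun j _ => ?_
  simp only [Pi.smul_apply, ind, topSet, Finset.mem_filter, Finset.mem_univ, true_and, smul_eq_mul]
  split_ifs <;> simp

theorem esymmWeight_last (a : Fin n → ℕ) (h : n - 1 < n) :
    esymmWeight a ⟨n - 1, h⟩ = ∑ j, a j := by
  rw [esymmWeight_apply]
  refine Finset.sum_congr rfl fun j _ => ?_
  rw [if_pos]
  simp only
  omega

/-- A weakly increasing function is a sum of indicators of top sets. The factor `e_{j+1}` raises the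
positions from `j.rev` on, so its exponent is the jump of `D` at `j.rev`, with the value before
position `0` taken to be `0`. -/
theorem exists_esymmWeight_eq {D : Fin n → ℕ} (hD : Monotone D) : ∃ a, esymmWeight a = D := by
  let a : Fin n → ℕ := fun j => D j.rev - if h : 0 < j.rev.1 then D ⟨j.rev.1 - 1, by omega⟩ else 0
  refine ⟨a, ?_⟩
  have hrev : ∀ i, esymmWeight a i =
      ∑ j : Fin n, if j.1 ≤ i.1 then (D j - if h : 0 < j.1 then D ⟨j.1 - 1, by omega⟩ else 0)
        else 0 := by
    intro i
    rw [esymmWeight_apply, ← Equiv.sum_comp Fin.revPerm]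
    refine Finset.sum_congr rfl fun j _ => ?_
    have h1 : n - ((Fin.revPerm j).1 + 1) = j.1 := by
      rw [Fin.revPerm_apply, Fin.val_rev]
      omega
    rw [h1]
    simp only [a, Fin.revPerm_apply, Fin.rev_rev]
  funext i
  rw [hrev]
  obtain ⟨m, hm⟩ := i
  induction m with
  | zero =>
    rw [Finset.sum_eq_single ⟨0, hm⟩]
    · simp
    · intro j _ hj
      rw [if_neg]
      intro h
      exact hj (Fin.ext (by simpa using h))
    · simp
  | succ m ih =>
    have hsplit : ∀ j : Fin n, (if j.1 ≤ m + 1 then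
        (D j - if h : 0 < j.1 then D ⟨j.1 - 1, by omega⟩ else 0) else 0) =
        (if j.1 ≤ m then (D j - if h : 0 < j.1 then D ⟨j.1 - 1, by omega⟩ else 0) else 0) +
        if j = ⟨m + 1, hm⟩ then
          (D j - if h : 0 < j.1 then D ⟨j.1 - 1, by omega⟩ else 0) else 0 := by
      intro j
      by_cases h1 : j.1 ≤ m
      · rw [if_pos h1, if_pos (by omega), if_neg, add_zero]
        rintro rfl
        simp at h1
      · by_cases h2 : j = ⟨m + 1, hm⟩
        · subst h2
          simp
        · rw [if_neg h1, if_neg h2, if_neg]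
          intro h3
          exact h2 (Fin.ext (by simp only; omega))
    rw [Finset.sum_congr rfl fun j _ => hsplit j, Finset.sum_add_distrib, ih (by omega)]
    have hle : D ⟨m, by omega⟩ ≤ D ⟨m + 1, hm⟩ := hD (by simp [Fin.le_def])
    simp
    omega

-- Conjugation turns the idempotent of the base tableau into `ε_T`, so the choice of base tableau
-- drops out.
open Tableau in
theorem leading_eq (p : TabPair n) :
    leading p = p.2.2.1.youngIdempotent * perm (p.2.1.1.symm.trans p.2.2.1) *
      fiberSum (cw p.2.1.1) := by
  obtain ⟨μ, S, T⟩ := p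
  have h1 := youngIdempotent_trans_mul (baseTab μ) ((baseTab μ).symm.trans T.1)
  have h2 : (baseTab μ).trans ((baseTab μ).symm.trans T.1) = T.1 := by
    ext c
    simp
  rw [h2] at h1
  simp only [leading, rightFactor]
  rw [← h1, mul_assoc, ← mul_assoc (perm _) (perm _), perm_mul]
  have h3 : ((baseTab μ).symm.trans T.1 : Equiv.Perm (Fin n)) * (S.1.symm.trans (baseTab μ)) =
      S.1.symm.trans T.1 := by
    ext i
    simp [Equiv.Perm.mul_apply]
  rw [h3, mul_assoc]

theorem cwMonomial_eq {μ : YoungDiagram} (S T : Tableau μ n) :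
    cwMonomial S T = act (perm (S.symm.trans T)) (mon (cw S)) := by
  rw [act_perm, rename_mon, cwMonomial, mon]
  rfl

/-- The expansion of `E * x^(cw S)` for the symmetric product `E` is acted on by `ε_T` times the
permutation from `S` to `T`. The action commutes with `E`, and by `leading_eq` it turns the
symmetrizer into `leading p`. -/
theorem exists_higherSpecht_mul_esymmProd (p : TabPair n) (a : Fin n → ℕ) :
    ∃ c : ℚ, c ≠ 0 ∧ higherSpecht p.2.1.1 p.2.2.1 * esymmProd a -
      c • act (leading p) (mon (cw p.2.1.1 + esymmWeight a)) ∈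
        lower (cw p.2.1.1 + esymmWeight a) := by
  obtain ⟨-, c, hc, hlow⟩ := raisesBy_esymmProd p.2.1.2.cw_mono a
  refine ⟨c, hc, ?_⟩
  have h1 := act_mem (rename_mem_lower _)
    (p.2.2.1.youngIdempotent * perm (p.2.1.1.symm.trans p.2.2.1)) hlow
  convert h1 using 1
  rw [map_sub, map_smul, act_mul_of_isSymmetric _ (esymmProd_isSymmetric a), ← act_mul,
    ← leading_eq, mul_comm, act_mul, ← cwMonomial_eq]
  rfl

/-- Every monomial is a combination of products of higher Specht polynomials with elementary
symmetric polynomials of the same leading weight, up to smaller monomials. -/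
theorem mon_mem_span_sup (γ : Fin n → ℕ) :
    mon γ ∈ Submodule.span ℚ {q | ∃ (p : TabPair n) (a : Fin n → ℕ) (g : Equiv.Perm (Fin n)),
        cw p.2.1.1 + esymmWeight a = γ ∘ g ∧
        q = higherSpecht p.2.1.1 p.2.2.1 * esymmProd a} ⊔
      Submodule.span ℚ (mon '' {δ | sqNorm δ < sqNorm γ}) := by
  set g := Tuple.sort γ with hg
  set lam : Fin n → ℕ := γ ∘ g with hlam
  have hmono : Monotone lam := Tuple.monotone_sort γ
  have hγ : mon γ = act (perm g) (mon lam) := by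
    rw [act_perm, rename_mon]
    congr 1
    funext i
    simp [hlam]
  have hγ' : mon γ = ((fiberPerms lam).card : ℚ)⁻¹ • act (perm g * fiberSum lam) (mon lam) := by
    rw [act_mul, act_fiberSum_mon, map_smul, smul_smul, inv_mul_cancel₀ card_fiberPerms_ne_zero,
      one_smul, hγ]
  rw [hγ']
  refine Submodule.smul_mem _ _ ?_
  have hspan := mul_fiberSum_mem_span lam (perm g)
  generalize perm g * fiberSum lam = x at hspan
  induction hspan using Submodule.span_induction with
  | zero => simp [act]
  | add x y _ _ hx hy => rw [act_add]; exact add_mem hx hy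
  | smul c x _ hx => rw [act_smul]; exact Submodule.smul_mem _ _ hx
  | mem x hx =>
    obtain ⟨p, hp, rfl⟩ := hx
    -- The label rises by one at a descent and nowhere else, and `lam` rises at every descent by the
    -- choice of `p`. Hence `lam - cw S` is nonnegative and weakly increasing.
    have hstep : ∀ m (h : m + 1 < n), cw p.2.1.1 ⟨m + 1, h⟩ + lam ⟨m, Nat.lt_of_succ_lt h⟩ ≤
        lam ⟨m + 1, h⟩ + cw p.2.1.1 ⟨m, Nat.lt_of_succ_lt h⟩ := by
      intro m h
      have h1 : lam ⟨m, Nat.lt_of_succ_lt h⟩ ≤ lam ⟨m + 1, h⟩ := hmono (by simp [Fin.le_def])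
      rcases h1.eq_or_lt with h2 | h2
      · have := p.2.1.2.cw_eq_of_not_isDescent h (hp m h h2)
        omega
      · have := p.2.1.2.cw_succ h
        split_ifs at this <;> omega
    have hcwle : ∀ m (h : m < n), cw p.2.1.1 ⟨m, h⟩ ≤ lam ⟨m, h⟩ := by
      intro m
      induction m with
      | zero =>
        intro h
        rw [Tableau.cw_zero]
        exact Nat.zero_le _
      | succ m ih =>
        intro h
        have := ih (Nat.lt_of_succ_lt h)
        have := hstep m h
        omega
    obtain ⟨a, ha⟩ := exists_esymmWeight_eq (D := fun i => lam i - cw p.2.1.1 i)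
      (monotone_of_le_succ fun m h => by
        have := hstep m h
        have := hcwle m (Nat.lt_of_succ_lt h)
        omega)
    have hsum : cw p.2.1.1 + esymmWeight a = lam := by
      rw [ha]
      funext i
      have := hcwle i.1 i.2
      simp only [Pi.add_apply]
      change cw p.2.1.1 i ≤ lam i at this
      omega
    obtain ⟨c, hc, hlow⟩ := exists_higherSpecht_mul_esymmProd p a
    rw [hsum] at hlow
    have h1 : act (leading p) (mon lam) = c⁻¹ • (higherSpecht p.2.1.1 p.2.2.1 * esymmProd a) -
        c⁻¹ • (higherSpecht p.2.1.1 p.2.2.1 * esymmProd a - c • act (leading p) (mon lam)) := by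
      rw [smul_sub, smul_smul, inv_mul_cancel₀ hc, one_smul, sub_sub_cancel]
    rw [h1]
    refine Submodule.sub_mem _ (Submodule.smul_mem _ _ (Submodule.mem_sup_left
      (Submodule.subset_span ⟨p, a, g, hsum, rfl⟩))) (Submodule.smul_mem _ _
      (Submodule.mem_sup_right ?_))
    refine Submodule.span_mono (Set.image_mono ?_) hlow
    rintro δ ⟨-, hδ⟩
    rwa [hlam, sqNorm_comp] at hδ

end Leading

/-! ### Spanning -/

theorem mon_mem_idealI {n k : ℕ} {γ : Fin n → ℕ} {i : Fin n} (h : k ≤ γ i) :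
    mon γ ∈ idealI n k := by
  have h1 : (X i ^ k : MvPolynomial (Fin n) ℚ) ∈ idealI n k :=
    Ideal.subset_span (Or.inl ⟨i, rfl⟩)
  rw [mon, ← Finset.mul_prod_erase _ _ (Finset.mem_univ i)]
  refine Ideal.mul_mem_right _ _ ?_
  rw [← Nat.sub_add_cancel h, pow_add]
  exact Ideal.mul_mem_left _ _ h1

theorem Tableau.IsStandard.cw_eq_card {μ : YoungDiagram} {n : ℕ} {S : Tableau μ n}
    (hS : S.IsStandard) (m : ℕ) (hm : m < n) :
    cw S ⟨m, hm⟩ = (Finset.univ.filter fun i : Fin n => i.1 < m ∧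
      ∃ h : i.1 + 1 < n, S.rowOf i < S.rowOf ⟨i.1 + 1, h⟩).card := by
  induction m with
  | zero => simp [Tableau.cw_zero]
  | succ m ih =>
    rw [hS.cw_succ hm, ih]
    have hsplit : (Finset.univ.filter fun i : Fin n => i.1 < m + 1 ∧
        ∃ h : i.1 + 1 < n, S.rowOf i < S.rowOf ⟨i.1 + 1, h⟩) =
        (Finset.univ.filter fun i : Fin n => i.1 < m ∧
        ∃ h : i.1 + 1 < n, S.rowOf i < S.rowOf ⟨i.1 + 1, h⟩) ∪
        (if S.rowOf ⟨m, Nat.lt_of_succ_lt hm⟩ < S.rowOf ⟨m + 1, hm⟩ then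
          {⟨m, Nat.lt_of_succ_lt hm⟩} else ∅) := by
      ext i
      simp only [Finset.mem_filter, Finset.mem_univ, true_and, Finset.mem_union]
      constructor
      · rintro ⟨h1, h2⟩
        rcases Nat.lt_succ_iff_lt_or_eq.1 h1 with h3 | h3
        · exact Or.inl ⟨h3, h2⟩
        · right
          obtain ⟨i, hi⟩ := i
          simp only at h3
          subst h3
          obtain ⟨_, h4⟩ := h2
          rw [if_pos h4]
          simp
      · rintro (⟨h1, h2⟩ | h1)
        · exact ⟨by omega, h2⟩
        · split_ifs at h1 with h2
          · rw [Finset.mem_singleton] at h1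
            subst h1
            exact ⟨by simp, hm, h2⟩
          · simp at h1
    rw [hsplit, Finset.card_union_of_disjoint]
    · split_ifs <;> simp
    · rw [Finset.disjoint_left]
      intro i hi hi'
      simp only [Finset.mem_filter, Finset.mem_univ, true_and] at hi
      split_ifs at hi' with h2
      · rw [Finset.mem_singleton] at hi'
        subst hi'
        simp at hi
      · simp at hi'

theorem Tableau.IsStandard.cw_last {μ : YoungDiagram} {n : ℕ} {S : Tableau μ n}
    (hS : S.IsStandard) (h : n - 1 < n) : cw S ⟨n - 1, h⟩ = des S := by
  rw [hS.cw_eq_card, des]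
  congr 1
  ext i
  simp only [Finset.mem_filter, Finset.mem_univ, true_and]
  refine ⟨fun h => h.2, fun h => ⟨?_, h⟩⟩
  obtain ⟨h1, -⟩ := h
  omega

/-- A factor `e_d` with `d > n - k` makes the product vanish in the quotient. Otherwise the bound at
the last position reads `des S + ∑ a < k`, which is the condition on the indices. -/
theorem higherSpecht_mul_esymmProd_mem {n k : ℕ} (hk : 0 < k) (hkn : k ≤ n) (p : TabPair n)
    (a : Fin n → ℕ) (hlt : ∀ i, (cw p.2.1.1 + esymmWeight a) i < k) :
    Ideal.Quotient.mk (idealI n k) (higherSpecht p.2.1.1 p.2.2.1 * esymmProd a) ∈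
      Submodule.span ℚ (Ideal.Quotient.mk (idealI n k) '' setB n k) := by
  by_cases hex : ∃ j : Fin n, n - k ≤ j.1 ∧ a j ≠ 0
  · obtain ⟨j, hj, haj⟩ := hex
    have h1 : esymm (Fin n) ℚ (j.1 + 1) ∈ idealI n k :=
      Ideal.subset_span (Or.inr ⟨j.1 + 1, ⟨by omega, j.2⟩, rfl⟩)
    have h2 : higherSpecht p.2.1.1 p.2.2.1 * esymmProd a ∈ idealI n k := by
      refine Ideal.mul_mem_left _ _ ?_
      rw [esymmProd, ← Finset.mul_prod_erase _ _ (Finset.mem_univ j)]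
      refine Ideal.mul_mem_right _ _ ?_
      rw [← Nat.succ_pred_eq_of_ne_zero haj, pow_succ]
      exact Ideal.mul_mem_left _ _ h1
    rw [Ideal.Quotient.eq_zero_iff_mem.2 h2]
    exact Submodule.zero_mem _
  · push Not at hex
    let e : Fin (n - k) → ℕ := fun j => a (Fin.castLE (Nat.sub_le n k) j)
    have hprod : ∀ {M : Type} [CommMonoid M] (F : Fin n → M),
        (∀ j : Fin n, n - k ≤ j.1 → F j = 1) →
        ∏ j : Fin n, F j = ∏ j : Fin (n - k), F (Fin.castLE (Nat.sub_le n k) j) := by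
      intro M _ F hF
      have h1 := Finset.prod_map Finset.univ (Fin.castLEEmb (Nat.sub_le n k)) F
      simp only [Fin.castLEEmb_apply] at h1
      rw [← h1]
      symm
      refine Finset.prod_subset (Finset.subset_univ _) fun j _ hj => hF j ?_
      by_contra hlt
      exact hj (Finset.mem_map.2 ⟨⟨j.1, not_le.1 hlt⟩, Finset.mem_univ _, rfl⟩)
    have hsum : ∑ j, e j = ∑ j, a j := by
      have := hprod (M := Multiplicative ℕ) (fun j => Multiplicative.ofAdd (a j))
        (fun j hj => by rw [hex j hj]; rfl)
      exact this.symm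
    have hn : n - 1 < n := by omega
    have hlast := hlt ⟨n - 1, hn⟩
    rw [Pi.add_apply, esymmWeight_last, p.2.1.2.cw_last] at hlast
    let b : BasisIndex n k := ⟨p.1.1, p.2.1, p.2.2, e, by rw [hsum]; omega⟩
    have hb : basisPoly b = higherSpecht p.2.1.1 p.2.2.1 * esymmProd a := by
      rw [basisPoly, esymmProd, hprod]
      · rfl
      · intro j hj
        rw [hex j hj, pow_zero]
    rw [← hb]
    exact Submodule.subset_span ⟨_, ⟨b, rfl⟩, rfl⟩

/-- Induction on the square norm. The products that replace `x^γ` have a rearrangement of `γ` as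
leading weight, so they inherit the bound of all exponents by `k`. -/
theorem mk_mon_mem_span {n k : ℕ} (hk : 0 < k) (hkn : k ≤ n) (γ : Fin n → ℕ) :
    Ideal.Quotient.mk (idealI n k) (mon γ) ∈
      Submodule.span ℚ (Ideal.Quotient.mk (idealI n k) '' setB n k) := by
  induction hN : sqNorm γ using Nat.strong_induction_on generalizing γ with
  | _ N ih =>
  subst hN
  by_cases hex : ∃ i, k ≤ γ i
  · obtain ⟨i, hi⟩ := hex
    rw [Ideal.Quotient.eq_zero_iff_mem.2 (mon_mem_idealI hi)]
    exact Submodule.zero_mem _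
  push Not at hex
  have h1 := mon_mem_span_sup γ
  let W := (Submodule.span ℚ (Ideal.Quotient.mk (idealI n k) '' setB n k)).comap
    (Ideal.Quotient.mkₐ ℚ (idealI n k)).toLinearMap
  change mon γ ∈ W
  refine (sup_le ?_ ?_ : _ ≤ W) h1
  · rw [Submodule.span_le]
    rintro q ⟨p, a, g, hpa, rfl⟩
    exact higherSpecht_mul_esymmProd_mem hk hkn p a fun i => by rw [hpa]; exact hex _
  · rw [Submodule.span_le]
    rintro _ ⟨δ, hδ, rfl⟩
    exact ih _ hδ δ rfl

theorem span_mon (n : ℕ) : Submodule.span ℚ (Set.range (mon (n := n))) = ⊤ := by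
  rw [eq_top_iff]
  intro p _
  rw [p.as_sum]
  refine Submodule.sum_mem _ fun d _ => ?_
  have h1 : monomial d (coeff d p) = coeff d p • mon (⇑d) := by
    rw [mon_eq_monomial, smul_monomial, smul_eq_mul, mul_one]
    simp
  rw [h1]
  exact Submodule.smul_mem _ _ (Submodule.subset_span ⟨_, rfl⟩)

theorem span_setB {n k : ℕ} (hk : 0 < k) (hkn : k ≤ n) :
    Submodule.span ℚ (Ideal.Quotient.mk (idealI n k) '' setB n k) = ⊤ := by
  rw [eq_top_iff]
  rintro q -
  obtain ⟨p, rfl⟩ := Ideal.Quotient.mk_surjective q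
  have h1 : p ∈ Submodule.span ℚ (Set.range (mon (n := n))) := by
    rw [span_mon]
    trivial
  let W := (Submodule.span ℚ (Ideal.Quotient.mk (idealI n k) '' setB n k)).comap
    (Ideal.Quotient.mkₐ ℚ (idealI n k)).toLinearMap
  change p ∈ W
  refine (Submodule.span_le.2 ?_ : _ ≤ W) h1
  rintro _ ⟨γ, rfl⟩
  exact mk_mon_mem_span hk hkn γ

/-! ### A lower bound for the dimension: deformation to a finite set of points -/

/-- Surjections from `Fin n` to `Fin k`. -/
abbrev Surj (n k : ℕ) : Type := {f : Fin n → Fin k // Function.Surjective f}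

instance instFintypeSurj (n k : ℕ) : Fintype (Surj n k) := Fintype.ofFinite _

/-- The point of affine space belonging to a surjection. -/
def point {n k : ℕ} (f : Surj n k) (i : Fin n) : ℚ := -((f.1 i).1 : ℚ)

/-- Evaluation at all the points belonging to surjections. -/
def evalSurj (n k : ℕ) : MvPolynomial (Fin n) ℚ →ₐ[ℚ] (Surj n k → ℚ) :=
  AlgHom.pi (R := ℚ) (A := fun _ => ℚ) fun f => aeval (point f)

theorem evalSurj_apply {n k : ℕ} (p : MvPolynomial (Fin n) ℚ) (f : Surj n k) :
    evalSurj n k p f = aeval (point f) p := rfl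

/-- The polynomials of degree less than `d`. -/
def degLt (n d : ℕ) : Submodule ℚ (MvPolynomial (Fin n) ℚ) :=
  Submodule.span ℚ (mon '' {γ | ∑ i, γ i < d})

section Harmonics

variable {n k : ℕ}

/-- Lagrange interpolation: `q f` vanishes at every point except that of `f`. -/
theorem evalSurj_surjective (n k : ℕ) : Function.Surjective (evalSurj n k) := by
  classical
  let q : Surj n k → MvPolynomial (Fin n) ℚ := fun f =>
    ∏ i, ∏ j ∈ Finset.univ.erase (f.1 i), (X i + C (j.1 : ℚ))
  have hq : ∀ f g, aeval (point g) (q f) ≠ 0 ↔ g = f := by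
    intro f g
    simp only [q, map_prod, map_add, aeval_X, aeval_C, point, Finset.prod_ne_zero_iff,
      Finset.mem_univ, true_imp_iff, Finset.mem_erase, and_true]
    constructor
    · intro h
      apply Subtype.ext
      funext i
      by_contra hne
      exact h i (g.1 i) hne (by simp)
    · rintro rfl i j hj h0
      apply hj
      apply Fin.ext
      have : (j.1 : ℚ) = (g.1 i).1 := by
        simp only [Algebra.algebraMap_self, RingHom.id_apply] at h0
        linarith
      exact_mod_cast this
  intro v
  refine ⟨∑ f, (v f * (aeval (point f) (q f))⁻¹) • q f, ?_⟩
  funext g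
  rw [evalSurj_apply, map_sum, Finset.sum_eq_single g]
  · rw [map_smul, smul_eq_mul, mul_assoc, inv_mul_cancel₀ ((hq g g).2 rfl), mul_one]
  · intro f _ hf
    rw [map_smul, not_ne_iff.1 (mt (hq f g).1 hf.symm), smul_zero]
  · simp

theorem mon_mem_degLt {γ : Fin n → ℕ} {d : ℕ} (h : ∑ i, γ i < d) : mon γ ∈ degLt n d :=
  Submodule.subset_span ⟨γ, h, rfl⟩

theorem mon_mul_mem_degLt (γ : Fin n → ℕ) {d : ℕ} {p : MvPolynomial (Fin n) ℚ}
    (hp : p ∈ degLt n d) : mon γ * p ∈ degLt n (∑ i, γ i + d) := by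
  rw [degLt] at hp
  induction hp using Submodule.span_induction with
  | mem p hp =>
    obtain ⟨δ, hδ, rfl⟩ := hp
    rw [← mon_add]
    apply mon_mem_degLt
    simp only [Pi.add_apply, Finset.sum_add_distrib]
    exact Nat.add_lt_add_left hδ _
  | zero => simp
  | add p q _ _ hp hq => rw [mul_add]; exact add_mem hp hq
  | smul c p _ hp => rw [mul_smul_comm]; exact Submodule.smul_mem _ _ hp

theorem mon_isHomogeneous (γ : Fin n → ℕ) : (mon γ).IsHomogeneous (∑ i, γ i) := by
  rw [mon]
  exact IsHomogeneous.prod _ _ _ fun i _ => by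
    simpa using (isHomogeneous_X ℚ i).pow (γ i)

/-- `s` is the top homogeneous component of a polynomial vanishing at all the points. -/
def IsTopOfVanishing (k : ℕ) (s : MvPolynomial (Fin n) ℚ) (e : ℕ) : Prop :=
  s.IsHomogeneous e ∧ ∃ q, evalSurj n k q = 0 ∧ q - s ∈ degLt n e

theorem mon_single (i : Fin n) (m : ℕ) : mon (Pi.single i m) = X i ^ m := by
  classical
  rw [mon, Finset.prod_eq_single i]
  · simp
  · intro j _ hj
    simp [hj]
  · simp

theorem isTopOfVanishing_X_pow (i : Fin n) :
    IsTopOfVanishing k (X i ^ k : MvPolynomial (Fin n) ℚ) k := by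
  refine ⟨by simpa using (isHomogeneous_X ℚ i).pow k,
    ∏ j : Fin k, (X i + C (j.1 : ℚ)), ?_, ?_⟩
  · funext f
    rw [evalSurj_apply, map_prod]
    refine Finset.prod_eq_zero (Finset.mem_univ (f.1 i)) ?_
    simp [point]
  · set P : Polynomial ℚ := ∏ j : Fin k, (Polynomial.X + Polynomial.C (j.1 : ℚ)) with hP
    have hmonic : P.Monic := Polynomial.monic_prod_of_monic _ _ fun j _ =>
      Polynomial.monic_X_add_C _
    have hdeg : P.natDegree = k := by
      rw [hP, Polynomial.natDegree_prod_of_monic _ _ fun j _ => Polynomial.monic_X_add_C _,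
        Finset.sum_congr rfl fun j _ => Polynomial.natDegree_X_add_C _]
      simp
    have h1 : Polynomial.aeval (X i : MvPolynomial (Fin n) ℚ) P =
        ∏ j : Fin k, (X i + C (j.1 : ℚ)) := by
      rw [hP, map_prod]
      refine Finset.prod_congr rfl fun j _ => ?_
      rw [map_add, Polynomial.aeval_X, Polynomial.aeval_C]
      rfl
    rw [← h1, hmonic.as_sum, hdeg, map_add, map_pow, Polynomial.aeval_X, add_sub_cancel_left,
      map_sum]
    refine Submodule.sum_mem _ fun m hm => ?_
    rw [map_mul, map_pow, Polynomial.aeval_X, Polynomial.aeval_C, ← mon_single,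
      ← Algebra.smul_def]
    refine Submodule.smul_mem _ _ (mon_mem_degLt ?_)
    simpa using Finset.mem_range.1 hm

theorem sum_ind_univ (A : Finset (Fin n)) : ∑ i, ind A i = A.card := by
  rw [sum_ind, Finset.inter_univ]

/-- At the point of a surjection, `∏ (t + x_i)` has each of `0, …, k - 1` as a root in `t`, so its
remainder modulo `P = ∏ (t - j)` vanishes. A coefficient of this remainder is a combination of
elementary symmetric polynomials with top term `e_r`. -/
theorem isTopOfVanishing_esymm (hkn : k ≤ n) {r : ℕ} (h1 : n - k + 1 ≤ r) (h2 : r ≤ n) :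
    IsTopOfVanishing k (esymm (Fin n) ℚ r) r := by
  set P : Polynomial ℚ := ∏ j : Fin k, (Polynomial.X - Polynomial.C (j.1 : ℚ)) with hP
  have hmonic : P.Monic := Polynomial.monic_prod_X_sub_C _ _
  have hdeg : P.degree = k := by
    rw [Polynomial.degree_eq_natDegree hmonic.ne_zero, hP, Polynomial.natDegree_prod_of_monic _ _
      fun j _ => Polynomial.monic_X_sub_C _,
      Finset.sum_congr rfl fun j _ => Polynomial.natDegree_X_sub_C _]
    simp
  -- By Vieta `e_j` accompanies `t^(n-j)`. For `n - j < k` this power is its own remainder, so `c j`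
  -- is `1` for `j = r` and `0` otherwise; the remaining `j` are at most `n - k < r`.
  let c : ℕ → ℚ := fun j => ((Polynomial.X ^ (n - j) : Polynomial ℚ) %ₘ P).coeff (n - r)
  refine ⟨?_, ∑ j ∈ Finset.range (n + 1), c j • esymm (Fin n) ℚ j, ?_, ?_⟩
  · rw [esymm_eq_sum_mon]
    refine IsHomogeneous.sum _ _ _ fun A hA => ?_
    rw [← (Finset.mem_powersetCard.1 hA).2, ← sum_ind_univ]
    exact mon_isHomogeneous _
  · funext f
    rw [evalSurj_apply, map_sum]
    have hdvd : P ∣ ∏ i : Fin n, (Polynomial.X + Polynomial.C (point f i)) := by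
      obtain ⟨s, hs⟩ := f.2.hasRightInverse
      have hinj : Function.Injective s := hs.injective
      have h3 : P = ∏ i ∈ Finset.univ.map ⟨s, hinj⟩,
          (Polynomial.X + Polynomial.C (point f i)) := by
        rw [Finset.prod_map, hP]
        refine Finset.prod_congr rfl fun j _ => ?_
        simp only [Function.Embedding.coeFn_mk, point, hs j, Polynomial.C_neg, sub_eq_add_neg]
      rw [h3]
      exact Finset.prod_dvd_prod_of_subset _ _ _ (Finset.subset_univ _)
    have hvieta := Multiset.prod_X_add_C_eq_sum_esymm
      (Multiset.map (point f) (Finset.univ : Finset (Fin n)).val)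
    rw [Multiset.map_map] at hvieta
    simp only [← aeval_esymm_eq_multiset_esymm (Fin n) ℚ, Multiset.card_map, Finset.card_val,
      Finset.card_univ, Fintype.card_fin] at hvieta
    change ∏ i : Fin n, (Polynomial.X + Polynomial.C (point f i)) = _ at hvieta
    have hmod := (Polynomial.modByMonic_eq_zero_iff_dvd hmonic).2 hdvd
    rw [hvieta] at hmod
    have h4 := congrArg (fun p : Polynomial ℚ => p.coeff (n - r)) hmod
    have h5 : ∀ p : Polynomial ℚ, p %ₘ P = Polynomial.modByMonicHom P p := fun _ => rfl
    simp only [h5, map_sum, ← Polynomial.smul_eq_C_mul, map_smul, Polynomial.finsetSum_coeff,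
      Polynomial.coeff_smul, Polynomial.coeff_zero] at h4
    simp only [← h5] at h4
    rw [Pi.zero_apply]
    rw [← h4]
    refine Finset.sum_congr rfl fun j _ => ?_
    rw [map_smul, smul_eq_mul, smul_eq_mul, mul_comm]
  · have hr : r ∈ Finset.range (n + 1) := Finset.mem_range.2 (by omega)
    rw [← Finset.add_sum_erase _ _ hr]
    have hself : ∀ j, n - j < k → (Polynomial.X ^ (n - j) : Polynomial ℚ) %ₘ P =
        Polynomial.X ^ (n - j) := by
      intro j hj
      rw [Polynomial.modByMonic_eq_self_iff hmonic, hdeg, Polynomial.degree_X_pow]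
      exact_mod_cast hj
    have hcr : c r = 1 := by
      simp only [c]
      rw [hself r (by omega), Polynomial.coeff_X_pow, if_pos rfl]
    rw [hcr, one_smul, add_sub_cancel_left]
    refine Submodule.sum_mem _ fun j hj => ?_
    obtain ⟨hj1, hj2⟩ := Finset.mem_erase.1 hj
    rw [Finset.mem_range] at hj2
    by_cases hjk : n - j < k
    · have : c j = 0 := by
        simp only [c]
        rw [hself j hjk, Polynomial.coeff_X_pow, if_neg (by omega)]
      rw [this, zero_smul]
      exact Submodule.zero_mem _
    · refine Submodule.smul_mem _ _ ?_
      rw [esymm_eq_sum_mon]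
      refine Submodule.sum_mem _ fun A hA => mon_mem_degLt ?_
      rw [sum_ind_univ, (Finset.mem_powersetCard.1 hA).2]
      omega

theorem IsTopOfVanishing.homogeneousComponent_mul_mem {s : MvPolynomial (Fin n) ℚ} {e : ℕ}
    (h : IsTopOfVanishing k s e) (p : MvPolynomial (Fin n) ℚ) (d : ℕ) :
    homogeneousComponent d (p * s) ∈
      LinearMap.ker (evalSurj n k).toLinearMap ⊔ degLt n d := by
  have hp : p ∈ Submodule.span ℚ (Set.range (mon (n := n))) := by
    rw [span_mon]
    trivial
  induction hp using Submodule.span_induction with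
  | mem p hp =>
    obtain ⟨γ, rfl⟩ := hp
    obtain ⟨hs, q, hq, hlow⟩ := h
    rw [homogeneousComponent_of_mem ((mon_isHomogeneous γ).mul hs)]
    split_ifs with hd
    · rw [hd]
      have h1 : mon γ * s = mon γ * q - mon γ * (q - s) := by ring
      rw [h1]
      refine Submodule.sub_mem _ (Submodule.mem_sup_left ?_)
        (Submodule.mem_sup_right (mon_mul_mem_degLt γ hlow))
      rw [LinearMap.mem_ker, AlgHom.toLinearMap_apply, map_mul, hq, mul_zero]
    · exact Submodule.zero_mem _
  | zero => simp
  | add p q _ _ hp hq => rw [add_mul, map_add]; exact add_mem hp hq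
  | smul c p _ hp => rw [smul_mul_assoc, map_smul]; exact Submodule.smul_mem _ _ hp

theorem homogeneousComponent_mem_of_mem_idealI (hkn : k ≤ n) {x : MvPolynomial (Fin n) ℚ}
    (hx : x ∈ idealI n k) (d : ℕ) :
    homogeneousComponent d x ∈ LinearMap.ker (evalSurj n k).toLinearMap ⊔ degLt n d := by
  -- Quantifying over all multiples lets the induction over the ideal pass through scalar
  -- multiplication by polynomials.
  suffices H : ∀ p, homogeneousComponent d (p * x) ∈
      LinearMap.ker (evalSurj n k).toLinearMap ⊔ degLt n d by
    simpa using H 1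
  rw [idealI, Ideal.span] at hx
  induction hx using Submodule.span_induction with
  | mem x hx =>
    intro p
    rcases hx with ⟨i, rfl⟩ | ⟨r, hr, rfl⟩
    · exact (isTopOfVanishing_X_pow i).homogeneousComponent_mul_mem p d
    · exact (isTopOfVanishing_esymm hkn hr.1 hr.2).homogeneousComponent_mul_mem p d
  | zero => simp
  | add x y _ _ hx hy =>
    intro p
    rw [mul_add, map_add]
    exact add_mem (hx p) (hy p)
  | smul a x _ hx =>
    intro p
    rw [smul_eq_mul, ← mul_assoc]
    exact hx _

/-- Induction on the degree: a relation modulo the ideal has a degree `d` component which, on the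
points, is a function coming from lower degree. Since the spanning family consists of monomials,
this component again involves only members of the family. -/
theorem card_surj_le_of_span {ι : Type*} [Fintype ι] (hkn : k ≤ n) (γ : ι → Fin n → ℕ)
    (hspan : Submodule.span ℚ (Set.range fun i => Ideal.Quotient.mk (idealI n k) (mon (γ i))) = ⊤) :
    Fintype.card (Surj n k) ≤ Fintype.card ι := by
  set U := Submodule.span ℚ (Set.range fun i => evalSurj n k (mon (γ i))) with hU
  have hmem : ∀ d, ∀ δ : Fin n → ℕ, ∑ i, δ i = d → evalSurj n k (mon δ) ∈ U := by
    intro d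
    induction d using Nat.strong_induction_on with
    | _ d ih =>
    intro δ hδ
    have h1 : Ideal.Quotient.mk (idealI n k) (mon δ) ∈
        Submodule.span ℚ (Set.range fun i => Ideal.Quotient.mk (idealI n k) (mon (γ i))) := by
      rw [hspan]
      trivial
    obtain ⟨c, hc⟩ := (Submodule.mem_span_range_iff_exists_fun ℚ).1 h1
    have h2 : mon δ - ∑ i, c i • mon (γ i) ∈ idealI n k := by
      rw [← Ideal.Quotient.eq_zero_iff_mem, map_sub, map_sum, sub_eq_zero, ← hc]
      exact Finset.sum_congr rfl fun i _ =>
        ((Ideal.Quotient.mkₐ ℚ (idealI n k)).toLinearMap.map_smul (c i) (mon (γ i))).symm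
    have h3 := homogeneousComponent_mem_of_mem_idealI hkn h2 d
    have h4 : homogeneousComponent d (mon δ - ∑ i, c i • mon (γ i)) =
        mon δ - ∑ i, c i • if d = ∑ j, γ i j then mon (γ i) else 0 := by
      rw [map_sub, map_sum, homogeneousComponent_of_mem (mon_isHomogeneous δ), if_pos hδ.symm]
      congr 1
      refine Finset.sum_congr rfl fun i _ => ?_
      rw [map_smul, homogeneousComponent_of_mem (mon_isHomogeneous (γ i))]
    rw [h4] at h3
    have h5 : LinearMap.ker (evalSurj n k).toLinearMap ⊔ degLt n d ≤
        U.comap (evalSurj n k).toLinearMap := by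
      refine sup_le ?_ ?_
      · intro x hx
        rw [Submodule.mem_comap, LinearMap.mem_ker.1 hx]
        exact Submodule.zero_mem _
      · rw [degLt, Submodule.span_le]
        rintro _ ⟨δ', hδ', rfl⟩
        exact ih _ hδ' δ' rfl
    have h6 := h5 h3
    rw [Submodule.mem_comap, AlgHom.toLinearMap_apply, map_sub] at h6
    have h7 : evalSurj n k (∑ i, c i • if d = ∑ j, γ i j then mon (γ i) else 0) ∈ U := by
      rw [map_sum]
      refine Submodule.sum_mem _ fun i _ => ?_
      rw [map_smul]
      refine Submodule.smul_mem _ _ ?_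
      split_ifs
      · exact Submodule.subset_span ⟨i, rfl⟩
      · rw [map_zero]
        exact Submodule.zero_mem _
    simpa using Submodule.add_mem _ h6 h7
  have htop : U = ⊤ := by
    rw [eq_top_iff]
    rintro v -
    obtain ⟨p, rfl⟩ := evalSurj_surjective n k v
    have hp : p ∈ Submodule.span ℚ (Set.range (mon (n := n))) := by
      rw [span_mon]
      trivial
    have : Submodule.span ℚ (Set.range (mon (n := n))) ≤ U.comap (evalSurj n k).toLinearMap := by
      rw [Submodule.span_le]
      rintro _ ⟨δ, rfl⟩
      exact hmem _ δ rfl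
    exact this hp
  have hle := finrank_range_le_card (R := ℚ) fun i => evalSurj n k (mon (γ i))
  rw [Set.finrank, ← hU, htop, finrank_top, Module.finrank_fintype_fun_eq_card] at hle
  exact hle

theorem card_surj_le_finrank (hkn : k ≤ n) [Module.Finite ℚ (RingR n k)] :
    Fintype.card (Surj n k) ≤ Module.finrank ℚ (RingR n k) := by
  obtain ⟨b, hb, hspan, hli⟩ := exists_linearIndependent ℚ
    (Set.range fun γ : Fin n → ℕ => Ideal.Quotient.mk (idealI n k) (mon γ))
  have htop : Submodule.span ℚ (Set.range fun γ : Fin n → ℕ =>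
      Ideal.Quotient.mk (idealI n k) (mon γ)) = ⊤ := by
    have h1 : (Set.range fun γ : Fin n → ℕ => Ideal.Quotient.mk (idealI n k) (mon γ)) =
        (Ideal.Quotient.mkₐ ℚ (idealI n k)).toLinearMap '' Set.range mon := by
      rw [← Set.range_comp]
      rfl
    rw [h1, Submodule.span_image, span_mon, Submodule.map_top, LinearMap.range_eq_top]
    exact Ideal.Quotient.mk_surjective
  have hfin : Finite b := hli.finite
  have := Fintype.ofFinite b
  choose γ hγ using fun x : b => hb x.2
  have h1 := card_surj_le_of_span hkn γ (by
    have h2 : (fun i : b => Ideal.Quotient.mk (idealI n k) (mon (γ i))) = Subtype.val := by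
      funext i
      exact hγ i
    rw [h2, Subtype.range_val, hspan, htop])
  refine h1.trans ?_
  exact hli.fintype_card_le_finrank

end Harmonics

/-! ### Counting the indices -/

theorem finite_sum_lt (m s : ℕ) : Finite {e : Fin m → ℕ // ∑ j, e j < s} := by
  refine Finite.of_injective (β := Fin m → Fin s) (fun e j => ⟨e.1 j, ?_⟩) ?_
  · exact (Finset.single_le_sum (f := e.1) (fun _ _ => Nat.zero_le _)
      (Finset.mem_univ j)).trans_lt e.2
  · intro e e' h
    apply Subtype.ext
    funext j
    simpa using congrFun h j

/-- A slack entry turns the inequality into a sum equal to `s - 1` over `m + 1` parts, that is, a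
multiset of size `s - 1`. -/
theorem natCard_sum_lt_le (m s : ℕ) (hs : 0 < s) :
    Nat.card {e : Fin m → ℕ // ∑ j, e j < s} ≤ (m + s - 1).choose m := by
  have h1 : Fintype.card (Sym (Fin (m + 1)) (s - 1)) = (m + s - 1).choose m := by
    rw [Sym.card_sym_eq_choose, Fintype.card_fin]
    have h2 : m + 1 + (s - 1) - 1 = m + s - 1 := by omega
    rw [h2, ← Nat.choose_symm (by omega : s - 1 ≤ m + s - 1)]
    congr 1
    omega
  rw [← h1, ← Nat.card_eq_fintype_card]
  refine Nat.card_le_card_of_injective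
    (fun e => (Sym.equivNatSumOfFintype (Fin (m + 1)) (s - 1)).symm
      ⟨Fin.cons (s - 1 - ∑ j, e.1 j) e.1, ?_⟩) ?_
  · rw [Fin.sum_univ_succ]
    simp only [Fin.cons_zero, Fin.cons_succ]
    have := e.2
    omega
  · intro e e' h
    have h2 := congrArg Subtype.val ((Equiv.injective _) h)
    apply Subtype.ext
    funext j
    simpa using congrFun h2 j.succ

open Classical in
/-- The descents of a tableau. -/
def desSet {μ : YoungDiagram} {n : ℕ} (S : Tableau μ n) : Finset ℕ :=
  (Finset.range (n - 1)).filter fun m => S.IsDescent m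

theorem mem_desSet {μ : YoungDiagram} {n : ℕ} {S : Tableau μ n} {m : ℕ} :
    m ∈ desSet S ↔ m < n - 1 ∧ S.IsDescent m := by
  classical
  simp [desSet]

theorem card_desSet {μ : YoungDiagram} {n : ℕ} (S : Tableau μ n) : (desSet S).card = des S := by
  classical
  rw [des, ← Finset.card_map Fin.valEmbedding]
  congr 1
  ext m
  rw [mem_desSet]
  simp only [Tableau.IsDescent, Finset.mem_filter, Finset.mem_map, Finset.mem_univ, true_and,
    Fin.valEmbedding_apply]
  constructor
  · rintro ⟨h1, h2, h3⟩
    exact ⟨⟨m, by omega⟩, ⟨h2, h3⟩, rfl⟩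
  · rintro ⟨i, ⟨h1, h2⟩, rfl⟩
    exact ⟨by omega, h1, h2⟩

/-! ### Step functions, their rearrangements and surjections -/

/-- The step function that is constant exactly at the elements of `E`. -/
def stepFun (n : ℕ) (E : Finset ℕ) (i : Fin n) : ℕ := (Finset.range i.1 \ E).card

section Step

variable {n : ℕ} {E : Finset ℕ}

theorem stepFun_succ {m : ℕ} (h : m + 1 < n) :
    stepFun n E ⟨m + 1, h⟩ = stepFun n E ⟨m, Nat.lt_of_succ_lt h⟩ + if m ∈ E then 0 else 1 := by
  simp only [stepFun]
  rw [Finset.range_add_one]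
  split_ifs with hm
  · rw [Finset.insert_sdiff_of_mem _ hm, add_zero]
  · rw [Finset.insert_sdiff_of_notMem _ hm, Finset.card_insert_of_notMem (by simp)]

theorem stepFun_mono : Monotone (stepFun n E) :=
  monotone_of_le_succ fun m h => by
    rw [stepFun_succ h]
    exact Nat.le_add_right _ _

theorem stepFun_eq_iff {m : ℕ} (h : m + 1 < n) :
    stepFun n E ⟨m, Nat.lt_of_succ_lt h⟩ = stepFun n E ⟨m + 1, h⟩ ↔ m ∈ E := by
  rw [stepFun_succ h]
  split_ifs with hm <;> simp [hm]

theorem exists_stepFun_eq {m : ℕ} (hm : m < n) {v : ℕ} (hv : v ≤ stepFun n E ⟨m, hm⟩) :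
    ∃ i, stepFun n E i = v := by
  induction m with
  | zero =>
    refine ⟨⟨0, hm⟩, ?_⟩
    simp only [stepFun, Finset.range_zero, Finset.empty_sdiff, Finset.card_empty] at hv ⊢
    omega
  | succ m ih =>
    rw [stepFun_succ hm] at hv
    by_cases h : v ≤ stepFun n E ⟨m, Nat.lt_of_succ_lt hm⟩
    · exact ih _ h
    · refine ⟨⟨m + 1, hm⟩, ?_⟩
      rw [stepFun_succ hm]
      split_ifs at hv ⊢ <;> omega

theorem stepFun_last {k : ℕ} (hk : 0 < k) (hkn : k ≤ n) (hE : E ⊆ Finset.range (n - 1))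
    (hcard : E.card = n - k) (h : n - 1 < n) : stepFun n E ⟨n - 1, h⟩ = k - 1 := by
  simp only [stepFun]
  rw [Finset.card_sdiff_of_subset hE, Finset.card_range, hcard]
  omega

theorem stepFun_lt {k : ℕ} (hk : 0 < k) (hkn : k ≤ n) (hE : E ⊆ Finset.range (n - 1))
    (hcard : E.card = n - k) (i : Fin n) : stepFun n E i < k := by
  have hn : n - 1 < n := by omega
  have h1 : stepFun n E i ≤ stepFun n E ⟨n - 1, hn⟩ := stepFun_mono (by
    rw [Fin.le_def]
    have := i.2
    simp only
    omega)
  rw [stepFun_last hk hkn hE hcard] at h1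
  omega

/-- Rearrangements of a function. -/
abbrev Orbit (f : Fin n → ℕ) : Type := Set.range fun g : Equiv.Perm (Fin n) => f ∘ ⇑g⁻¹

/-- Rearrangements of `f` correspond to left cosets of its stabilizer, and a right invariant element
is determined by one coefficient per coset. -/
theorem card_le_card_orbit {ι : Type*} [Fintype ι] (f : Fin n → ℕ) (v : ι → GroupAlg n)
    (hv : LinearIndependent ℚ v) (hinv : ∀ i, ∀ s ∈ fiberPerms f, v i * perm s = v i) :
    Fintype.card ι ≤ Nat.card (Orbit f) := by
  have := Fintype.ofFinite (Orbit f)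
  choose r hr using fun x : Orbit f => x.2
  let φ : GroupAlg n →ₗ[ℚ] (Orbit f → ℚ) :=
    LinearMap.pi fun x => (MonoidAlgebra.basis (Equiv.Perm (Fin n)) ℚ).coord (r x)
  have hφ : ∀ x ∈ Submodule.span ℚ (Set.range v), φ x = 0 → x = 0 := by
    intro x hx h0
    have hxinv : ∀ s ∈ fiberPerms f, x * perm s = x := by
      intro s hs
      have : Submodule.span ℚ (Set.range v) ≤ rightInv s := by
        rw [Submodule.span_le]
        rintro _ ⟨i, rfl⟩
        exact mem_rightInv.2 (hinv i s hs)
      exact mem_rightInv.1 (this hx)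
    ext g
    change x.coeff g = 0
    set y : Orbit f := ⟨f ∘ ⇑g⁻¹, g, rfl⟩
    have hs : g⁻¹ * r y ∈ fiberPerms f := by
      rw [mem_fiberPerms]
      intro i
      have := congrFun (hr y) (r y i)
      simp only [Function.comp_apply, inv_apply_self] at this
      exact this.symm
    have h1 : x.coeff (r y) = 0 := congrFun h0 y
    rw [← hxinv _ hs, MonoidAlgebra.coeff_mul_single_apply, mul_one] at h1
    convert h1 using 2
    group
  have hli : LinearIndependent ℚ (φ ∘ v) := by
    refine hv.map ?_
    rw [Submodule.disjoint_def]
    intro x hx hx'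
    exact hφ x hx (LinearMap.mem_ker.1 hx')
  have h1 := hli.fintype_card_le_finrank
  rwa [Module.finrank_fintype_fun_eq_card, ← Nat.card_eq_fintype_card (α := Orbit f)] at h1

theorem cw_eq_of_stepFun_eq {μ : YoungDiagram} {S : Tableau μ n} (hS : S.IsStandard)
    (hE : Disjoint E (desSet S)) {i j : Fin n} (h : stepFun n E i = stepFun n E j) :
    cw S i = cw S j := by
  wlog hij : i ≤ j generalizing i j
  · exact (this h.symm (le_of_not_ge hij)).symm
  obtain ⟨a, ha⟩ := i
  obtain ⟨b, hb⟩ := j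
  change a ≤ b at hij
  induction b, hij using Nat.le_induction with
  | base => rfl
  | succ b hab ih =>
    have h1 : stepFun n E ⟨a, ha⟩ ≤ stepFun n E ⟨b, Nat.lt_of_succ_lt hb⟩ := stepFun_mono hab
    have h2 := stepFun_succ (E := E) hb
    have hbE : b ∈ E := by
      by_contra hbE
      rw [if_neg hbE] at h2
      omega
    rw [if_pos hbE] at h2
    rw [ih (Nat.lt_of_succ_lt hb) (by omega)]
    refine hS.cw_eq_of_not_isDescent hb fun hd => ?_
    refine Finset.disjoint_left.1 hE hbE ?_
    exact mem_desSet.2 ⟨by omega, hd⟩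

open Classical in
theorem card_disjoint_le_card_orbit (E : Finset ℕ) :
    (Finset.univ.filter fun p : TabPair n => Disjoint E (desSet p.2.1.1)).card ≤
      Nat.card (Orbit (stepFun n E)) := by
  rw [← Fintype.card_subtype]
  refine card_le_card_orbit (stepFun n E)
    (fun p : {p : TabPair n // Disjoint E (desSet p.2.1.1)} => leading p.1)
    ((linearIndependent_leading n).comp _ Subtype.val_injective) ?_
  intro p s hs
  apply leading_mul_perm
  rw [mem_fiberPerms] at hs ⊢
  intro i
  exact cw_eq_of_stepFun_eq p.1.2.1.2 p.2 (hs i)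

/-- A function has only one weakly increasing rearrangement, and `E` is the set of positions where
the step function does not rise. -/
theorem eq_of_comp_eq {E' : Finset ℕ} {g g' : Equiv.Perm (Fin n)}
    (hE : E ⊆ Finset.range (n - 1)) (hE' : E' ⊆ Finset.range (n - 1))
    (h : stepFun n E ∘ ⇑g⁻¹ = stepFun n E' ∘ ⇑g'⁻¹) : E = E' := by
  have h1 : stepFun n E ∘ ⇑(g⁻¹ * g') = stepFun n E' := by
    funext i
    have := congrFun h (g' i)
    simpa [inv_apply_self] using this
  have h2 : stepFun n E = stepFun n E' := by
    rw [← h1]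
    have h3 : Monotone (stepFun n E ∘ ⇑(1 : Equiv.Perm (Fin n))) := stepFun_mono
    exact Tuple.unique_monotone h3 (by rw [h1]; exact stepFun_mono)
  have key : ∀ m, m + 1 < n → (m ∈ E ↔ m ∈ E') := by
    intro m hm
    rw [← stepFun_eq_iff hm, ← stepFun_eq_iff hm, h2]
  ext m
  constructor
  · intro hm
    exact (key m (by have := Finset.mem_range.1 (hE hm); omega)).1 hm
  · intro hm
    exact (key m (by have := Finset.mem_range.1 (hE' hm); omega)).2 hm

theorem sum_card_orbit_le {k : ℕ} (hk : 0 < k) (hkn : k ≤ n) :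
    ∑ E ∈ Finset.powersetCard (n - k) (Finset.range (n - 1)), Nat.card (Orbit (stepFun n E)) ≤
      Fintype.card (Surj n k) := by
  classical
  have hn : n - 1 < n := by omega
  have hfin : ∀ E : Finset ℕ, Fintype (Orbit (stepFun n E)) := fun E => Fintype.ofFinite _
  have hmem : ∀ E : ↥(Finset.powersetCard (n - k) (Finset.range (n - 1))),
      E.1 ⊆ Finset.range (n - 1) ∧ E.1.card = n - k := fun E =>
    Finset.mem_powersetCard.1 E.2
  have h1 : ∑ E ∈ Finset.powersetCard (n - k) (Finset.range (n - 1)),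
      Nat.card (Orbit (stepFun n E)) =
      Fintype.card (Σ E : ↥(Finset.powersetCard (n - k) (Finset.range (n - 1))),
        Orbit (stepFun n E.1)) := by
    rw [Fintype.card_sigma, ← Finset.sum_coe_sort]
    exact Finset.sum_congr rfl fun E _ => Nat.card_eq_fintype_card
  rw [h1]
  have hlt : ∀ (E : ↥(Finset.powersetCard (n - k) (Finset.range (n - 1))))
      (x : Orbit (stepFun n E.1)) (i : Fin n), x.1 i < k := by
    rintro E ⟨_, g, rfl⟩ i
    exact stepFun_lt hk hkn (hmem E).1 (hmem E).2 _
  refine Fintype.card_le_of_injective (fun q => ⟨fun i => ⟨q.2.1 i, hlt q.1 q.2 i⟩, ?_⟩) ?_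
  · obtain ⟨E, ⟨_, g, rfl⟩⟩ := q
    rintro ⟨v, hv⟩
    obtain ⟨i, hi⟩ := exists_stepFun_eq (n := n) (E := E.1) hn (v := v) (by
      rw [stepFun_last hk hkn (hmem E).1 (hmem E).2]
      omega)
    refine ⟨g i, Fin.ext ?_⟩
    simpa [inv_apply_self] using hi
  · rintro ⟨⟨E, hE⟩, x, hx⟩ ⟨⟨E', hE'⟩, x', hx'⟩ h
    have hxx : x = x' := by
      funext i
      have := congrArg (fun f : Surj n k => (f.1 i).1) h
      exact this
    subst hxx
    obtain ⟨g, hg⟩ := id hx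
    obtain ⟨g', hg'⟩ := id hx'
    obtain rfl := eq_of_comp_eq (hmem ⟨E, hE⟩).1 (hmem ⟨E', hE'⟩).1 (hg.trans hg'.symm)
    rfl

end Step

/-! ### Comparison of the counts and linear independence -/

/-- The indices as triples. -/
def basisIndexEquiv (n k : ℕ) : BasisIndex n k ≃
    Σ p : TabPair n, {e : Fin (n - k) → ℕ // ∑ j, e j < k - des p.2.1.1} where
  toFun a := ⟨⟨⟨a.shape, card_of_tableau a.S.1⟩, a.S, a.T⟩, a.exps, by
    have := a.sum_lt
    simp only
    omega⟩
  invFun q := ⟨q.1.1.1, q.1.2.1, q.1.2.2, q.2.1, by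
    have := q.2.2
    omega⟩
  left_inv _ := rfl
  right_inv _ := rfl

instance instFiniteBasisIndex (n k : ℕ) : Finite (BasisIndex n k) := by
  have : ∀ p : TabPair n, Finite {e : Fin (n - k) → ℕ // ∑ j, e j < k - des p.2.1.1} :=
    fun p => finite_sum_lt _ _
  exact Finite.of_equiv _ (basisIndexEquiv n k).symm

/-- The tuples belonging to a pair are bounded by the `(n-k)`-sets `E` of positions that avoid the
descents. Exchanging the sums leaves, for each `E`, a number of pairs bounded by the rearrangements
of its step function. -/
theorem natCard_basisIndex_le {n k : ℕ} (hk : 0 < k) (hkn : k ≤ n) :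
    Nat.card (BasisIndex n k) ≤ Fintype.card (Surj n k) := by
  classical
  have hfin : ∀ p : TabPair n, Finite {e : Fin (n - k) → ℕ // ∑ j, e j < k - des p.2.1.1} :=
    fun p => finite_sum_lt _ _
  have hterm : ∀ p : TabPair n, Nat.card {e : Fin (n - k) → ℕ // ∑ j, e j < k - des p.2.1.1} ≤
      ((Finset.powersetCard (n - k) (Finset.range (n - 1))).filter
        fun E => Disjoint E (desSet p.2.1.1)).card := by
    intro p
    rcases Nat.eq_zero_or_pos (k - des p.2.1.1) with h0 | hpos
    · rw [h0]
      simp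
    · refine (natCard_sum_lt_le _ _ hpos).trans ?_
      have h1 : Finset.powersetCard (n - k) (Finset.range (n - 1) \ desSet p.2.1.1) ⊆
          (Finset.powersetCard (n - k) (Finset.range (n - 1))).filter
            fun E => Disjoint E (desSet p.2.1.1) := by
        intro E hE
        rw [Finset.mem_powersetCard, Finset.subset_sdiff] at hE
        rw [Finset.mem_filter, Finset.mem_powersetCard]
        exact ⟨⟨hE.1.1, hE.2⟩, hE.1.2⟩
      refine le_trans (le_of_eq ?_) (Finset.card_le_card h1)
      have hsub : desSet p.2.1.1 ⊆ Finset.range (n - 1) := fun m hm =>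
        Finset.mem_range.2 (mem_desSet.1 hm).1
      rw [Finset.card_powersetCard, Finset.card_sdiff_of_subset hsub, Finset.card_range,
        card_desSet]
      -- `(n - k) + (k - des S) - 1 = (n - 1) - des S`, where truncation is harmless because `des S
      -- < k ≤ n`.
      congr 1
      omega
  rw [Nat.card_congr (basisIndexEquiv n k), Nat.card_sigma]
  refine (Finset.sum_le_sum fun p _ => hterm p).trans ?_
  simp only [Finset.card_filter]
  rw [Finset.sum_comm]
  refine le_trans (Finset.sum_le_sum fun E _ => ?_) (sum_card_orbit_le hk hkn)
  rw [← Finset.card_filter]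
  exact card_disjoint_le_card_orbit E

/-- The number of indices is at most the number of surjections, hence at most the dimension; a
spanning family of this size is a basis. -/
theorem linearIndependent_basisPoly {n k : ℕ} (hk : 0 < k) (hkn : k ≤ n) :
    LinearIndependent ℚ fun a : BasisIndex n k =>
      Ideal.Quotient.mk (idealI n k) (basisPoly a) := by
  have := Fintype.ofFinite (BasisIndex n k)
  have hrange : (Set.range fun a : BasisIndex n k => Ideal.Quotient.mk (idealI n k) (basisPoly a)) =
      Ideal.Quotient.mk (idealI n k) '' setB n k := by
    rw [setB, ← Set.range_comp]
    rfl
  have hspan : Submodule.span ℚ (Set.range fun a : BasisIndex n k =>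
      Ideal.Quotient.mk (idealI n k) (basisPoly a)) = ⊤ := by
    rw [hrange, span_setB hk hkn]
  have hfin : Module.Finite ℚ (RingR n k) := ⟨⟨(Set.toFinite (Set.range fun a : BasisIndex n k =>
      Ideal.Quotient.mk (idealI n k) (basisPoly a))).toFinset, by
    rw [Set.Finite.coe_toFinset]
    exact hspan⟩⟩
  refine linearIndependent_of_top_le_span_of_card_eq_finrank hspan.ge (le_antisymm ?_ ?_)
  · rw [← Nat.card_eq_fintype_card]
    exact (natCard_basisIndex_le hk hkn).trans (card_surj_le_finrank hkn)
  · have h1 := finrank_range_le_card (R := ℚ) fun a : BasisIndex n k =>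
      Ideal.Quotient.mk (idealI n k) (basisPoly a)
    rwa [Set.finrank, hspan, finrank_top] at h1

/-! ### Specht polynomials -/

namespace Tableau

variable {μ : YoungDiagram} {n : ℕ}

/-- The entries in column `c` are indexed by their rows. -/
def colEquiv (T : Tableau μ n) (c : ℕ) : Fin (μ.colLen c) ≃ {i : Fin n // T.colOf i = c} where
  toFun r := ⟨T ⟨(r.1, c), YoungDiagram.mem_iff_lt_colLen.2 r.2⟩, T.colOf_apply _⟩
  invFun i := ⟨T.rowOf i.1, YoungDiagram.mem_iff_lt_colLen.1 (by
    have := T.mem_cells_of i.1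
    rwa [i.2] at this)⟩
  left_inv r := Fin.ext (T.rowOf_apply _)
  right_inv i := Subtype.ext
    (T.eq_of_rowOf_colOf (T.rowOf_apply _) ((T.colOf_apply _).trans i.2.symm))

/-- The block diagonal matrix of the Vandermonde matrices of the columns. -/
def colMatrix (T : Tableau μ n) : Matrix (Fin n) (Fin n) (MvPolynomial (Fin n) ℚ) :=
  Matrix.of fun i j => if T.colOf i = T.colOf j then X i ^ T.rowOf j else 0

theorem det_colMatrix (T : Tableau μ n) :
    T.colMatrix.det = act (fiberAlt T.colOf) (mon T.rowOf) := by
  rw [Matrix.det_apply', fiberAlt, act_sum, fiberPerms, Finset.sum_filter]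
  refine Finset.sum_congr rfl fun σ _ => ?_
  split_ifs with hσ
  · rw [single_eq_smul_perm, act_smul, act_perm, mon, map_prod, smul_eq_C_mul]
    congr 1
    refine Finset.prod_congr rfl fun i _ => ?_
    rw [colMatrix, Matrix.of_apply, if_pos (hσ i), map_pow, rename_X]
  · push Not at hσ
    obtain ⟨i, hi⟩ := hσ
    rw [Finset.prod_eq_zero (Finset.mem_univ i) (by rw [colMatrix, Matrix.of_apply, if_neg hi]),
      mul_zero]

theorem det_toSquareBlock_colMatrix (T : Tableau μ n) (c : ℕ) :
    (T.colMatrix.toSquareBlock T.colOf c).det =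
      ∏ p ∈ (Finset.univ : Finset (↥μ.cells × ↥μ.cells)).filter
        (fun p => (p.1.1.2 = p.2.1.2 ∧ p.1.1.1 < p.2.1.1) ∧ p.1.1.2 = c),
        (X (T p.2) - X (T p.1)) := by
  have h1 : (T.colMatrix.toSquareBlock T.colOf c).submatrix (T.colEquiv c) (T.colEquiv c) =
      Matrix.vandermonde fun r => X (T.colEquiv c r).1 := by
    ext1 r s
    have h2 : T.colOf (T.colEquiv c r).1 = T.colOf (T.colEquiv c s).1 :=
      (T.colEquiv c r).2.trans (T.colEquiv c s).2.symm
    have h3 : T.rowOf (T.colEquiv c s).1 = s := T.rowOf_apply _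
    rw [Matrix.submatrix_apply, Matrix.toSquareBlock_def, Matrix.of_apply, colMatrix,
      Matrix.of_apply, if_pos h2, h3, Matrix.vandermonde_apply]
  rw [← Matrix.det_submatrix_equiv_self (T.colEquiv c), h1, Matrix.det_vandermonde,
    Finset.prod_sigma']
  refine Finset.prod_bij (fun q _ => (⟨(q.1.1, c), YoungDiagram.mem_iff_lt_colLen.2 q.1.2⟩,
    ⟨(q.2.1, c), YoungDiagram.mem_iff_lt_colLen.2 q.2.2⟩)) ?_ ?_ ?_ ?_
  · rintro ⟨r, s⟩ h
    simpa using h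
  · rintro ⟨r, s⟩ _ ⟨r', s'⟩ _ h
    simp only [Prod.mk.injEq, Subtype.mk.injEq, and_true] at h
    obtain ⟨h1, h2⟩ := h
    obtain rfl := Fin.ext h1
    obtain rfl := Fin.ext h2
    rfl
  · rintro ⟨⟨⟨a, b⟩, hab⟩, ⟨⟨a', b'⟩, hab'⟩⟩ h
    simp only [Finset.mem_filter, Finset.mem_univ, true_and] at h
    obtain ⟨⟨rfl, hlt⟩, rfl⟩ := h
    exact ⟨⟨⟨a, YoungDiagram.mem_iff_lt_colLen.1 hab⟩, ⟨a', YoungDiagram.mem_iff_lt_colLen.1 hab'⟩⟩,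
      by simpa using hlt, rfl⟩
  · rintro ⟨r, s⟩ _
    rfl

/-- Both sides are the determinant of `colMatrix`: its Leibniz expansion retains only column
permutations, and its diagonal blocks are Vandermonde matrices of the columns. -/
theorem spechtPoly_eq (T : Tableau μ n) :
    T.spechtPoly = act (fiberAlt T.colOf) (mon T.rowOf) := by
  have hM : T.colMatrix.BlockTriangular T.colOf := by
    intro i j hij
    rw [colMatrix, Matrix.of_apply, if_neg hij.ne']
  rw [← det_colMatrix, hM.det, spechtPoly, ← Finset.prod_fiberwise_of_maps_to
    (t := Finset.univ.image T.colOf) (g := fun p : ↥μ.cells × ↥μ.cells => p.1.1.2)]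
  · refine Finset.prod_congr rfl fun c _ => ?_
    rw [det_toSquareBlock_colMatrix, Finset.filter_filter]
  · intro p _
    exact Finset.mem_image.2 ⟨T p.1, Finset.mem_univ _, T.colOf_apply _⟩

theorem act_youngIdempotent_mon (T : Tableau μ n) :
    act T.youngIdempotent (mon T.rowOf) = ((fiberPerms T.rowOf).card : ℚ) • T.spechtPoly := by
  rw [youngIdempotent_eq, act_mul, act_fiberSum_mon, map_smul, spechtPoly_eq]

theorem rename_spechtPoly (T : Tableau μ n) (g : Equiv.Perm (Fin n)) :
    rename g T.spechtPoly = spechtPoly (T.trans g) := by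
  simp [spechtPoly, map_prod]

end Tableau

/-! ### The Specht module as the left ideal of a Young idempotent -/

/-- The orbit map at the monomial of row indices, composed with the Young idempotent. -/
def toSpecht {n : ℕ} (μ : Shape n) : GroupAlg n →ₗ[ℚ] MvPolynomial (Fin n) ℚ :=
  (LinearMap.applyₗ (mon (baseTab μ).rowOf)) ∘ₗ (polyRep n).asAlgebraHom.toLinearMap ∘ₗ
    LinearMap.mulRight ℚ (baseTab μ).youngIdempotent

section Specht

variable {n : ℕ} (μ : Shape n)

theorem toSpecht_apply (x : GroupAlg n) :
    toSpecht μ x = act (x * (baseTab μ).youngIdempotent) (mon (baseTab μ).rowOf) := rfl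

theorem toSpecht_perm_mul (g : Equiv.Perm (Fin n)) (x : GroupAlg n) :
    toSpecht μ (perm g * x) = polyRep n g (toSpecht μ x) := by
  rw [toSpecht_apply, toSpecht_apply, mul_assoc, act_mul, act_perm, polyRep_apply]

theorem toSpecht_perm (g : Equiv.Perm (Fin n)) :
    toSpecht μ (perm g) = ((fiberPerms (baseTab μ).rowOf).card : ℚ) •
      Tableau.spechtPoly ((baseTab μ).trans g) := by
  rw [toSpecht_apply, act_mul, Tableau.act_youngIdempotent_mon, act_perm, map_smul,
    Tableau.rename_spechtPoly]

theorem linearMap_mem_of_perm {V : Type*} [AddCommGroup V] [Module ℚ V] (f : GroupAlg n →ₗ[ℚ] V)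
    {W : Submodule ℚ V} (h : ∀ g, f (perm g) ∈ W) (x : GroupAlg n) : f x ∈ W := by
  induction x using MonoidAlgebra.induction_linear with
  | zero => simp
  | add x y hx hy =>
    rw [map_add]
    exact add_mem hx hy
  | single g r =>
    rw [single_eq_smul_perm, map_smul]
    exact W.smul_mem _ (h g)

theorem range_toSpecht : LinearMap.range (toSpecht μ) = (spechtModule n μ.1).toSubmodule := by
  apply le_antisymm
  · rintro _ ⟨x, rfl⟩
    refine linearMap_mem_of_perm _ (fun g => ?_) x
    rw [toSpecht_perm]
    exact Submodule.smul_mem _ _ (Submodule.subset_span ⟨_, rfl⟩)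
  · refine Submodule.span_le.2 ?_
    rintro _ ⟨T, rfl⟩
    refine ⟨((fiberPerms (baseTab μ).rowOf).card : ℚ)⁻¹ • perm ((baseTab μ).symm.trans T), ?_⟩
    rw [map_smul, toSpecht_perm, smul_smul, inv_mul_cancel₀ card_fiberPerms_ne_zero, one_smul]
    congr 1
    ext c
    simp

/-- The permutations carrying `x^f` to a given monomial form one coset of the stabilizer, on which
the coefficients of `y` agree. So the orbit map loses nothing on right invariant elements. -/
theorem coeff_act_mon (f : Fin n → ℕ) (y : GroupAlg n)
    (hy : ∀ s ∈ fiberPerms f, y * perm s = y) (g : Equiv.Perm (Fin n)) :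
    coeff (Finsupp.equivFunOnFinite.symm (f ∘ ⇑g⁻¹)) (act y (mon f)) =
      ((fiberPerms f).card : ℚ) * y.coeff g := by
  classical
  have h1 : ∀ x : GroupAlg n, coeff (Finsupp.equivFunOnFinite.symm (f ∘ ⇑g⁻¹)) (act x (mon f)) =
      (x * fiberSum f).coeff g := by
    intro x
    induction x using MonoidAlgebra.induction_linear with
    | zero => simp [act]
    | add x x' hx hx' => rw [act_add, coeff_add, hx, hx', add_mul]; simp
    | single h r =>
      rw [single_eq_smul_perm, act_smul, act_perm, rename_mon, coeff_smul, mon_eq_monomial,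
        coeff_monomial, smul_mul_assoc, MonoidAlgebra.coeff_smul, Finsupp.smul_apply,
        MonoidAlgebra.coeff_single_mul_apply, one_mul, fiberSum]
      congr 1
      have h2 : (∑ σ ∈ fiberPerms f, perm σ).coeff (h⁻¹ * g) =
          ∑ σ ∈ fiberPerms f, if σ = h⁻¹ * g then (1 : ℚ) else 0 := by
        rw [MonoidAlgebra.coeff_sum, Finsupp.finsetSum_apply]
        refine Finset.sum_congr rfl fun σ _ => ?_
        rw [perm, MonoidAlgebra.coeff_single, Finsupp.single_apply]
      rw [h2, Finset.sum_ite_eq']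
      congr 1
      apply propext
      rw [Equiv.apply_eq_iff_eq, mem_fiberPerms]
      constructor
      · intro H i
        have := congrFun H (g i)
        simpa [inv_apply_self] using this
      · intro H
        funext i
        have := H (g⁻¹ i)
        simpa [inv_apply_self] using this
  rw [h1, fiberSum, Finset.mul_sum, Finset.sum_congr rfl fun s hs => hy s hs, Finset.sum_const,
    ← Nat.cast_smul_eq_nsmul ℚ]
  simp

/-- The Young idempotent ends with the row symmetrizer, and the row permutations are the stabilizer
of the monomial of row indices; `coeff_act_mon` therefore applies. -/
theorem toSpecht_eq_zero_iff (x : GroupAlg n) :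
    toSpecht μ x = 0 ↔ x * (baseTab μ).youngIdempotent = 0 := by
  rw [toSpecht_apply]
  constructor
  · intro h
    ext g
    have h1 := coeff_act_mon (baseTab μ).rowOf (x * (baseTab μ).youngIdempotent)
      (fun s hs => by
        rw [Tableau.youngIdempotent_eq, mul_assoc, mul_assoc, fiberSum_mul_perm hs]) g
    rw [h, coeff_zero, zero_eq_mul] at h1
    simpa using h1.resolve_left card_fiberPerms_ne_zero
  · intro h
    rw [h]
    simp [act]

end Specht

/-- Both modules are the quotient of the group algebra by the same left ideal. -/
theorem nonempty_equiv_of_ker_eq {n : ℕ} {V W : Type*} [AddCommGroup V] [Module ℚ V]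
    [AddCommGroup W] [Module ℚ W] {ρ : Representation ℚ (Equiv.Perm (Fin n)) V}
    {σ : Representation ℚ (Equiv.Perm (Fin n)) W} (A : Subrepresentation ρ)
    (B : Subrepresentation σ) (f : GroupAlg n →ₗ[ℚ] V) (g : GroupAlg n →ₗ[ℚ] W)
    (hf : ∀ h x, f (perm h * x) = ρ h (f x)) (hg : ∀ h x, g (perm h * x) = σ h (g x))
    (hker : LinearMap.ker f = LinearMap.ker g) (hA : LinearMap.range f = A.toSubmodule)
    (hB : LinearMap.range g = B.toSubmodule) :
    Nonempty (A.toRepresentation.Equiv B.toRepresentation) := by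
  let e : A.toSubmodule ≃ₗ[ℚ] B.toSubmodule :=
    (LinearEquiv.ofEq _ _ hA.symm).trans (f.quotKerEquivRange.symm.trans
      ((Submodule.quotEquivOfEq _ _ hker).trans (g.quotKerEquivRange.trans
        (LinearEquiv.ofEq _ _ hB))))
  have he : ∀ (x : GroupAlg n) (hx : f x ∈ A.toSubmodule), (e ⟨f x, hx⟩).1 = g x := by
    intro x hx
    have h1 : LinearEquiv.ofEq _ _ hA.symm ⟨f x, hx⟩ =
        f.quotKerEquivRange (Submodule.Quotient.mk x) := rfl
    simp only [e, LinearEquiv.trans_apply]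
    rw [h1, LinearEquiv.symm_apply_apply]
    rfl
  refine ⟨Representation.Equiv.mk e fun h => ?_⟩
  ext ⟨v, hv⟩
  obtain ⟨x, rfl⟩ := hA.ge hv
  have hmem : f (perm h * x) ∈ A.toSubmodule := hA.le ⟨_, rfl⟩
  have h1 : A.toRepresentation h ⟨f x, hv⟩ = ⟨f (perm h * x), hmem⟩ :=
    Subtype.ext (hf h x).symm
  change (e (A.toRepresentation h ⟨f x, hv⟩)).1 = σ h (e ⟨f x, hv⟩).1
  rw [h1, he, he, hg]

/-! ### The decomposition of the quotient ring -/

/-- The indices of the summands with a given shape. -/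
abbrev SummandIndex (n k : ℕ) (μ : YoungDiagram) : Type :=
  Σ S : SYT μ n, {e : Fin (n - k) → ℕ // ∑ j, e j < k - des S.1}

instance instFiniteSummandIndex (n k : ℕ) (μ : YoungDiagram) : Finite (SummandIndex n k μ) := by
  have : ∀ S : SYT μ n, Finite {e : Fin (n - k) → ℕ // ∑ j, e j < k - des S.1} :=
    fun S => finite_sum_lt _ _
  infer_instance

section Summand

variable {n k : ℕ} {μ : Shape n}

/-- The index of a basis element in a given summand. -/
def SummandIndex.toIndex (q : SummandIndex n k μ.1) (T : SYT μ.1 n) : BasisIndex n k :=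
  ⟨μ.1, q.1, T, q.2.1, by have := q.2.2; omega⟩

/-- The symmetric factor of the basis elements in a given summand. -/
def SummandIndex.factor (q : SummandIndex n k μ.1) : MvPolynomial (Fin n) ℚ :=
  ∏ j : Fin (n - k), esymm (Fin n) ℚ (j.1 + 1) ^ q.2.1 j

theorem SummandIndex.factor_isSymmetric (q : SummandIndex n k μ.1) : q.factor.IsSymmetric := by
  intro g
  rw [factor, map_prod]
  refine Finset.prod_congr rfl fun j _ => ?_
  rw [map_pow, rename_esymm]

/-- The equivariant map from the left ideal of a Young idempotent to a summand. -/
def toSummand (q : SummandIndex n k μ.1) : GroupAlg n →ₗ[ℚ] RingR n k :=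
  (Ideal.Quotient.mkₐ ℚ (idealI n k)).toLinearMap ∘ₗ LinearMap.mulRight ℚ q.factor ∘ₗ
    (LinearMap.applyₗ (mon (cw q.1.1))) ∘ₗ (polyRep n).asAlgebraHom.toLinearMap ∘ₗ
      LinearMap.mulRight ℚ (perm (q.1.1.symm.trans (baseTab μ)))

theorem toSummand_apply (q : SummandIndex n k μ.1) (x : GroupAlg n) :
    toSummand q x = Ideal.Quotient.mk (idealI n k)
      (act (x * perm (q.1.1.symm.trans (baseTab μ))) (mon (cw q.1.1)) * q.factor) := rfl

theorem toSummand_perm_mul (q : SummandIndex n k μ.1) (g : Equiv.Perm (Fin n)) (x : GroupAlg n) :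
    toSummand q (perm g * x) = ringRep n k g (toSummand q x) := by
  rw [toSummand_apply, toSummand_apply, mul_assoc, act_mul, act_perm]
  change _ = Ideal.Quotient.mk (idealI n k) (rename g _)
  rw [map_mul (rename g), q.factor_isSymmetric g]

theorem toSummand_generator (q : SummandIndex n k μ.1) (T : SYT μ.1 n) :
    toSummand q (perm ((baseTab μ).symm.trans T.1) * (baseTab μ).youngIdempotent) =
      Ideal.Quotient.mk (idealI n k) (basisPoly (q.toIndex T)) := by
  have h1 := Tableau.youngIdempotent_trans_mul (baseTab μ) ((baseTab μ).symm.trans T.1)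
  have h2 : (baseTab μ).trans ((baseTab μ).symm.trans T.1) = T.1 := by
    ext c
    simp
  have h3 : (((baseTab μ).symm.trans T.1 : Equiv.Perm (Fin n)) *
      (q.1.1.symm.trans (baseTab μ) : Equiv.Perm (Fin n))) = q.1.1.symm.trans T.1 := by
    ext i
    simp
  rw [h2] at h1
  rw [toSummand_apply, ← h1, mul_assoc, perm_mul, h3, act_mul, ← cwMonomial_eq]
  rfl

/-- The standard tableaux already generate the left ideal of the idempotent, so the span is an
equivariant image of it; this is what makes the span a submodule. -/
theorem span_range_toIndex (q : SummandIndex n k μ.1) :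
    Submodule.span ℚ (Set.range fun T : SYT μ.1 n =>
      Ideal.Quotient.mk (idealI n k) (basisPoly (q.toIndex T))) =
    LinearMap.range (toSummand q ∘ₗ LinearMap.mulRight ℚ (baseTab μ).youngIdempotent) := by
  apply le_antisymm
  · rw [Submodule.span_le]
    rintro _ ⟨T, rfl⟩
    exact ⟨perm ((baseTab μ).symm.trans T.1), toSummand_generator q T⟩
  · rintro _ ⟨x, rfl⟩
    have h1 := Submodule.mem_map_of_mem (f := toSummand q)
      (mul_youngIdempotent_mem_span μ q.1 x)
    rw [Submodule.map_span, ← Set.range_comp] at h1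
    rw [LinearMap.comp_apply, LinearMap.mulRight_apply]
    convert h1 using 4 with T
    exact (toSummand_generator q T).symm

/-- The submodule spanned by the basis elements that differ only in `T`. -/
def summand (q : SummandIndex n k μ.1) : Subrepresentation (ringRep n k) where
  toSubmodule := Submodule.span ℚ (Set.range fun T : SYT μ.1 n =>
    Ideal.Quotient.mk (idealI n k) (basisPoly (q.toIndex T)))
  apply_mem_toSubmodule := by
    intro g v hv
    rw [span_range_toIndex] at hv ⊢
    obtain ⟨x, rfl⟩ := hv
    refine ⟨perm g * x, ?_⟩
    simp only [LinearMap.comp_apply, LinearMap.mulRight_apply]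
    rw [mul_assoc, toSummand_perm_mul]

theorem linearIndependent_toIndex (hk : 0 < k) (hkn : k ≤ n) (q : SummandIndex n k μ.1) :
    LinearIndependent ℚ fun T : SYT μ.1 n =>
      Ideal.Quotient.mk (idealI n k) (basisPoly (q.toIndex T)) := by
  refine (linearIndependent_basisPoly hk hkn).comp q.toIndex ?_
  intro T T' h
  simpa [SummandIndex.toIndex] using h

theorem toSummand_mul_eq_zero_iff (hk : 0 < k) (hkn : k ≤ n) (q : SummandIndex n k μ.1)
    (x : GroupAlg n) : toSummand q (x * (baseTab μ).youngIdempotent) = 0 ↔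
      x * (baseTab μ).youngIdempotent = 0 := by
  refine ⟨fun h => ?_, fun h => by rw [h, map_zero]⟩
  -- The spanning set of the left ideal indexed by `T` is mapped to independent basis elements of
  -- the quotient, so the map is injective on the ideal.
  obtain ⟨c, hc⟩ := (Submodule.mem_span_range_iff_exists_fun ℚ).1
    (mul_youngIdempotent_mem_span μ q.1 x)
  rw [← hc, map_sum] at h
  simp only [map_smul, toSummand_generator] at h
  have h0 := Fintype.linearIndependent_iff.1 (linearIndependent_toIndex hk hkn q) c h
  rw [← hc]
  exact Finset.sum_eq_zero fun T _ => by rw [h0, zero_smul]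

theorem nonempty_summand_equiv (hk : 0 < k) (hkn : k ≤ n) (q : SummandIndex n k μ.1) :
    Nonempty ((summand q).toRepresentation.Equiv (spechtModule n μ.1).toRepresentation) := by
  refine nonempty_equiv_of_ker_eq _ _
    (toSummand q ∘ₗ LinearMap.mulRight ℚ (baseTab μ).youngIdempotent) (toSpecht μ) ?_
    (toSpecht_perm_mul μ) ?_ (span_range_toIndex q).symm (range_toSpecht μ)
  · intro h x
    simp only [LinearMap.comp_apply, LinearMap.mulRight_apply]
    rw [mul_assoc, toSummand_perm_mul]
  · ext x
    rw [LinearMap.mem_ker, LinearMap.mem_ker, toSpecht_eq_zero_iff, LinearMap.comp_apply,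
      LinearMap.mulRight_apply, toSummand_mul_eq_zero_iff hk hkn]

end Summand

theorem iSupIndep_span_range {ι κ K V : Type*} [DivisionRing K] [AddCommGroup V] [Module K V]
    {v : ι → V} (hv : LinearIndependent K v) (s : κ → Set ι)
    (hs : Pairwise fun a b => Disjoint (s a) (s b)) :
    iSupIndep fun a => Submodule.span K (v '' s a) := by
  intro a
  rw [← Submodule.span_iUnion₂, ← Set.image_iUnion₂]
  refine hv.disjoint_span_image ?_
  simp only [Set.disjoint_iUnion_right]
  exact fun b hb => hs hb.symm

/-- The summand to which an index belongs. -/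
def summandOf {n k : ℕ} (a : BasisIndex n k) : Σ μ : Shape n, SummandIndex n k μ.1 :=
  ⟨⟨a.shape, card_of_tableau a.S.1⟩, a.S, a.exps, by have := a.sum_lt; omega⟩

theorem range_toIndex {n k : ℕ} {μ : Shape n} (q : SummandIndex n k μ.1) :
    Set.range q.toIndex = {a | summandOf a = ⟨μ, q⟩} := by
  ext a
  constructor
  · rintro ⟨T, rfl⟩
    rfl
  · intro h
    obtain ⟨ν, S, T, e, he⟩ := a
    obtain ⟨μ, hμ⟩ := μ
    simp only [summandOf, Set.mem_ofPred_eq, Sigma.mk.injEq, Subtype.mk.injEq] at h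
    obtain ⟨rfl, h⟩ := h
    obtain rfl := eq_of_heq h
    exact ⟨T, rfl⟩

/-- The indices are grouped by everything except `T`. Disjoint parts of a basis have independent
spans, and each group spans a copy of the Specht module of its shape. -/
theorem isHigherSpechtBasis {n k : ℕ} (hk : 0 < k) (hkn : k ≤ n) :
    IsHigherSpechtBasis (ringRep n k) (Ideal.Quotient.mk (idealI n k) '' setB n k) := by
  let e : ∀ μ : Shape n, Fin (Nat.card (SummandIndex n k μ.1)) ≃ SummandIndex n k μ.1 :=
    fun μ => (Finite.equivFin _).symm
  let v : BasisIndex n k → RingR n k := fun a => Ideal.Quotient.mk (idealI n k) (basisPoly a)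
  let E : (Σ μ : Shape n, Fin (Nat.card (SummandIndex n k μ.1))) ≃
      Σ μ : Shape n, SummandIndex n k μ.1 := Equiv.sigmaCongrRight e
  let s : (Σ μ : Shape n, Fin (Nat.card (SummandIndex n k μ.1))) → Set (BasisIndex n k) :=
    fun p => {a | summandOf a = E p}
  have hli : LinearIndependent ℚ v := linearIndependent_basisPoly hk hkn
  have hs : ∀ p, v '' s p = Set.range fun T : SYT p.1.1 n =>
      Ideal.Quotient.mk (idealI n k) (basisPoly ((e p.1 p.2).toIndex T)) := by
    intro p
    have h1 : s p = Set.range (e p.1 p.2).toIndex := (range_toIndex (e p.1 p.2)).symm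
    rw [h1, ← Set.range_comp]
    rfl
  have hW : ∀ p, (summand (e p.1 p.2)).toSubmodule = Submodule.span ℚ (v '' s p) := by
    intro p
    rw [hs]
    rfl
  have hB : Ideal.Quotient.mk (idealI n k) '' setB n k = ⋃ p, v '' s p := by
    have h1 : ⋃ p, s p = Set.univ :=
      Set.eq_univ_of_forall fun a => Set.mem_iUnion.2
        ⟨E.symm (summandOf a), (E.apply_symm_apply _).symm⟩
    rw [← Set.image_iUnion, h1, Set.image_univ, setB, ← Set.range_comp]
    rfl
  refine ⟨fun μ => Nat.card (SummandIndex n k μ.1), fun p => summand (e p.1 p.2),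
    fun p => v '' s p, ?_, ?_, fun p => nonempty_summand_equiv hk hkn _, fun p => ⟨?_, ?_⟩, hB⟩
  · simp only [hW]
    refine iSupIndep_span_range hli s fun a b hab => Set.disjoint_left.2 fun x hx hx' => ?_
    exact hab (E.injective (Eq.trans (Eq.symm hx) hx'))
  · simp only [hW]
    rw [← Submodule.span_iUnion, ← hB, span_setB hk hkn]
  · exact (hli.linearIndepOn_id).mono (Set.image_subset_range _ _)
  · exact (hW p).symm

end HigherSpecht

end

theorem mainTheorem1 (n k : ℕ) (hk : 0 < k) (hkn : k ≤ n) :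
    LinearIndependent ℚ (fun a : HigherSpecht.BasisIndex n k =>
      Ideal.Quotient.mk (HigherSpecht.idealI n k) (HigherSpecht.basisPoly a)) ∧
    Submodule.span ℚ
      (Ideal.Quotient.mk (HigherSpecht.idealI n k) '' HigherSpecht.setB n k) = ⊤ ∧
    HigherSpecht.IsHigherSpechtBasis (HigherSpecht.ringRep n k)
      (Ideal.Quotient.mk (HigherSpecht.idealI n k) '' HigherSpecht.setB n k) := by
  exact ⟨HigherSpecht.linearIndependent_basisPoly hk hkn, HigherSpecht.span_setB hk hkn,
    HigherSpecht.isHigherSpechtBasis hk hkn⟩
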